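/- Work over the field $\mathbb{C}(t)$, $t$ an indeterminate. **Fermions.** A Maya diagram is a string $\sigma:\mathbb{Z}\to\{0,1\}$ with $\sigma_i=1$ for $i\ll 0$ and $\sigma_i=0$ for $i\gg0$. For a partition $\lambda$ and $c\in\mathbb{Z}$ let $\sigma(\lambda,c)$ be the Maya diagram with ones exactly at the positions $c+1+\lambda_j-j$, $j\ge1$; every Maya diagram is of this form for a unique pair $(\lambda,c)$. Let $\mathcal{F}(t)$ be the $\mathbb{C}(t)$-vector space with basis the Maya diagrams. Let $\psi_i^+(t)\sigma=(-t)^{\sum_{j>i}\sigma_j}(\sigma+\epsilon_i)$ if $\sigma_i=0$ and $0$ otherwise, $\psi_i^-(t)\sigma=(-t)^{-\sum_{j>i}\sigma_j}(\sigma-\epsilon_i)$ if $\sigma_i=1$ and $0$ otherwise, where $\sigma\pm\epsilon_i$ changes the letter at position $i$. Put $E_{ij}(t)=(1-t)\psi_i^-(t)\psi_j^+(t)$ and $$A(x;t)=\sum_{r\ge0}x^rA_r(t)=1+\sum_{r>0}\ \sum_{i_1<j_1<\cdots<i_r<j_r}(xt)^{j_1-i_1+\cdots+j_r-i_r}E_{i_1j_1}(t)\cdots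 E_{i_rj_r}(t)\in \operatorname{End}(\mathcal{F}(t))[[x]].$$ **Bosons.** Let $\Lambda(t)=\mathbb{C}(t)[p_1,p_2,\dots]$ be the ring of symmetric functions in $Y=y_1+y_2+\cdots$, with power sums $p_r$, Schur functions $s_\lambda$ and Hall inner product $\langle p_\lambda,p_\mu\rangle=z_\lambda\delta_{\lambda\mu}$. Put $\langle f,g\rangle_t=\langle f[Y/(1-t)],g[Y]\rangle$, where $f\mapsto f[Y/(1-t)]$ is the $\mathbb{C}(t)$-algebra map $p_r\mapsto p_r/(1-t^r)$. Let $\imath_t:\mathcal{F}(t)\to\bigoplus_{c\in\mathbb{Z}}z^c\otimes\Lambda(t)$ be the linear map with $\sigma(\lambda,c)\mapsto z^c\otimes s_\lambda$. Let $\langle\cdot,\cdot\rangle_t$ also denote the bilinear form on $\mathcal{F}(t)$ that is the pullback along $\imath_t$ of the form $\langle z^c\otimes f,z^{d}\otimes g\rangle_t=\delta_{cd}\langle f,g\rangle_t$. All adjoints, written with $*$, are taken for $\langle\cdot,\cdot\rangle_t$, with $x^*=x^{-1}$; in particular $A^*(x;t)=\sum_s x^{-s}A_s^*$. Jing's vertex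 operators on $\Lambda(t)$, which act on $\bigoplus_c z^c\otimes\Lambda(t)$ through the second factor, are the formal Laurent series with operator coefficients $$\Phi^{-}(x;t)=\exp\Big(\sum_{r>0}\tfrac{1-t^r}{r}p_rx^r\Big)\circ\exp\Big(\sum_{r>0}\tfrac{t^r-1}{r}p_r^*x^{-r}\Big),\qquad \Phi^{+}(x;t)=\exp\Big(\sum_{r>0}\tfrac{t^r-1}{r}p_rx^r\Big)\circ\exp\Big(\sum_{r>0}\tfrac{1-t^r}{r}p_r^*x^{-r}\Big).$$ **Proposition.** 1. The map $\imath_t$ is an isomorphism. The operator $A(x;t)$ is the row transfer matrix of the asymmetric six-vertex model: for Maya diagrams $\sigma,\sigma'$ the coefficient of $\sigma'$ in $A(x;t)\sigma$ is $\sum_{e}\prod_{i\in\mathbb{Z}}\Omega(e_{i-1},\sigma_i,e_i,\sigma'_i)$, the sum over all $e:\mathbb{Z}\to\{0,1\}$ with finitely many ones, where $\Omega(W,N,E,S)$ has the values $\Omega(0,0,0,0)=\Omega(0,1,0,1)=\Omega(1,0,0,1)=1$, $\Omega(1,1,1,1)=-x$, $\Omega(1,0,1,0)=tx$, $\Omega(0,1,1,0)=(t-1)x$,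 and is zero otherwise. The power series $A(x;t)$ is invertible; write $A^{-1}(x;t)=\sum_{r\ge 0}x^rA^{-1}_r$ for its inverse. The operators $A_r$ and $A^{-1}_r$ on $\mathcal{F}(t)$ and multiplication by $p_r$ on $\Lambda(t)$ have unique adjoints, and the coefficients of all Laurent series below are sums of operators that are finite on every vector. 2. One has, coefficientwise in $x$, $$\Phi^-(x;t)\circ\imath_t=\imath_t\circ A^{-1}(x;t)\circ A^*(x;t)\qquad\text{and}\qquad \Phi^+(x;t)\circ\imath_t=\imath_t\circ A(x;t)\circ(A^{-1}(x;t))^*.$$ 3. The operators $\Psi_m=\sum_{r-s=m}A_r^{-1}A_s^*$, $m\in\mathbb{Z}$, satisfy for all $r,s\in\mathbb{Z}$ $$\Psi_{r-1}\Psi_s-t\Psi_r\Psi_{s-1}=t\Psi_s\Psi_{r-1}-\Psi_{s-1}\Psi_r .$$ 4. For every partition $\lambda$ of length $\ell$ and every $c\in\mathbb{Z}$, $$\imath_t\big(\Psi_{\lambda_1}\Psi_{\lambda_2}\cdots\Psi_{\lambda_\ell}\,\sigma(\varnothing,c)\big)=z^c\otimes Q_\lambda(y;t),$$ where $Q_\lambda(y;t)\in\Lambda(t)$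 is the Hall--Littlewood function, i.e. the symmetric function whose restriction to $n$ variables is, for all $n\ge\ell$, $$Q_\lambda(y_1,\dots,y_n;t)=(1-t)^\ell\prod_{i=1}^{n-\ell}\frac{1-t}{1-t^i}\ \sum_{w\in S_n}w\Big(y_1^{\lambda_1}\cdots y_n^{\lambda_n}\prod_{1\le i<j\le n}\frac{y_i-ty_j}{y_i-y_j}\Big).$$ -/

import Mathlib

open scoped PowerSeries

namespace HallLittlewoodIce

noncomputable section

/-! ### The ground field and locally finite sums of operators -/

/-- The ground field `ℂ(t)`. -/
abbrev K : Type := RatFunc ℂ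

/-- The indeterminate `t` of `ℂ(t)`. -/
def t : K := RatFunc.X

section Operators

variable {V : Type*} [AddCommGroup V] [Module K V]

/-- A family of operators is pointwise finite if on every vector only finitely many of its members
do not vanish. -/
def PointwiseFinite {I : Type*} (T : I → Module.End K V) : Prop :=
  ∀ v : V, (Function.support fun i => T i v).Finite

open Classical in
/-- The operator `v ↦ ∑ i, T i v`, for a pointwise finite family `T`
(and the zero operator for any other family). -/
def sumOp {I : Type*} (T : I → Module.End K V) : Module.End K V :=
  if h : PointwiseFinite T then
    { toFun := fun v => ∑ᶠ i, T i v
      map_add' := fun v w => by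
        simp only [map_add]
        exact finsum_add_distrib (h v) (h w)
      map_smul' := fun a v => by
        simp only [map_smul, RingHom.id_apply]
        exact (smul_finsum' a (h v)).symm }
  else 0

/-- The terms `a_r ∘ b_s` with `r - s = m` of the coefficient of `x ^ m` in the product of
`∑ r, a_r x ^ r` with `∑ s, b_s x ^ (-s)`. -/
def laurentTerms (a b : ℕ → Module.End K V) (m : ℤ) :
    {p : ℕ × ℕ // (p.1 : ℤ) - (p.2 : ℤ) = m} → Module.End K V :=
  fun p => a p.1.1 * b p.1.2

/-- The coefficient of `x ^ m` in the product of `∑ r, a_r x ^ r` with `∑ s, b_s x ^ (-s)`. -/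
def laurentCoeff (a b : ℕ → Module.End K V) (m : ℤ) : Module.End K V :=
  sumOp (laurentTerms a b m)

open Classical in
/-- The adjoint of `f` for the bilinear form `B`: an operator `g` with `B (f v) w = B v (g w)` for
all `v`, `w` (and zero if there is none). -/
def adjointOp (B : LinearMap.BilinForm K V) (f : Module.End K V) : Module.End K V :=
  if h : ∃ g : Module.End K V, LinearMap.IsAdjointPair B B f g then h.choose else 0

end Operators

/-- The exponential `∑ k, f ^ k / k!` of a power series `f` without constant term. The coefficients
need not commute. As `f ^ k` starts in degree `k`, the sum over `k` stops at `n` in degree `n`. -/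
def expSeries {R : Type*} [Ring R] [Algebra K R] (f : R⟦X⟧) : R⟦X⟧ :=
  PowerSeries.mk fun n =>
    ∑ k ∈ Finset.range (n + 1), ((k.factorial : K)⁻¹) • PowerSeries.coeff n (f ^ k)

/-- The power series `∑ r > 0, c_r P_r x ^ r`. -/
def positiveSeries {R : Type*} [Ring R] [Algebra K R] (c : ℕ+ → K) (P : ℕ+ → R) : R⟦X⟧ :=
  PowerSeries.mk fun n => if h : 0 < n then c ⟨n, h⟩ • P ⟨n, h⟩ else 0

/-! ### The bosonic Fock space -/

/-- The ring of symmetric functions `Λ(t) = ℂ(t)[p_1, p_2, …]`, with the power sum `p_r` as the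
variable with index `r`. -/
abbrev Lam : Type := MvPolynomial ℕ+ K

/-- The number `z_λ = ∏ r ^ (m_r) * m_r!` for a partition `λ` with multiplicities `m_r`. -/
def zNumber (m : ℕ+ →₀ ℕ) : K := m.prod fun r k => ((r : ℕ) : K) ^ k * (k.factorial : K)

/-- The Hall inner product on `Λ(t)`: `⟨p_λ, p_μ⟩ = z_λ δ_{λμ}`. -/
def hallForm : LinearMap.BilinForm K Lam :=
  (MvPolynomial.basisMonomials ℕ+ K).constr K fun m => zNumber m • MvPolynomial.lcoeff K m

/-- The plethystic substitution `f[Y] ↦ f[Y / (1 - t)]`, that is `p_r ↦ p_r / (1 - t ^ r)`. -/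
def plethysm : Lam →ₐ[K] Lam :=
  MvPolynomial.aeval fun r : ℕ+ => (1 - t ^ (r : ℕ))⁻¹ • (MvPolynomial.X r : Lam)

/-- The deformed inner product `⟨f, g⟩_t = ⟨f[Y / (1 - t)], g[Y]⟩` on `Λ(t)`. -/
def tForm : LinearMap.BilinForm K Lam := LinearMap.comp hallForm plethysm.toLinearMap

/-- Multiplication by the power sum `p_r`. -/
def pMul (r : ℕ+) : Module.End K Lam := LinearMap.mulLeft K (MvPolynomial.X r)

/-- The adjoint of `pMul r` for the deformed inner product. -/
def pAdj (r : ℕ+) : Module.End K Lam := adjointOp tForm (pMul r)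

/-- The coefficient `(1 - t ^ r) / r`. -/
def gCoeff (r : ℕ+) : K := (1 - t ^ (r : ℕ)) / ((r : ℕ) : K)

/-- The operator terms of the coefficient of `x ^ m` in Jing's vertex operator
`Φ⁻(x;t) = exp (∑ r, (1 - t ^ r) / r * p_r x ^ r) ∘ exp (∑ r, (t ^ r - 1) / r * p_r^* x ^ (-r))`. -/
def phiMinusTerms (m : ℤ) : {p : ℕ × ℕ // (p.1 : ℤ) - (p.2 : ℤ) = m} → Module.End K Lam :=
  laurentTerms (fun r => PowerSeries.coeff r (expSeries (positiveSeries gCoeff pMul)))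
    (fun s => PowerSeries.coeff s (expSeries (positiveSeries (-gCoeff) pAdj))) m

/-- The coefficient of `x ^ m` in `Φ⁻(x;t)`. -/
def phiMinus (m : ℤ) : Module.End K Lam := sumOp (phiMinusTerms m)

/-- The operator terms of the coefficient of `x ^ m` in Jing's vertex operator
`Φ⁺(x;t) = exp (∑ r, (t ^ r - 1) / r * p_r x ^ r) ∘ exp (∑ r, (1 - t ^ r) / r * p_r^* x ^ (-r))`. -/
def phiPlusTerms (m : ℤ) : {p : ℕ × ℕ // (p.1 : ℤ) - (p.2 : ℤ) = m} → Module.End K Lam :=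
  laurentTerms (fun r => PowerSeries.coeff r (expSeries (positiveSeries (-gCoeff) pMul)))
    (fun s => PowerSeries.coeff s (expSeries (positiveSeries gCoeff pAdj))) m

/-- The coefficient of `x ^ m` in `Φ⁺(x;t)`. -/
def phiPlus (m : ℤ) : Module.End K Lam := sumOp (phiPlusTerms m)

/-- The complete symmetric function `h_n`, from `∑ n, h_n x ^ n = exp (∑ r, p_r x ^ r / r)`,
with `h_n = 0` for `n < 0`. -/
def complete (n : ℤ) : Lam :=
  if 0 ≤ n then
    PowerSeries.coeff n.toNat
      (expSeries (positiveSeries (fun r => ((r : ℕ) : K)⁻¹) fun r => (MvPolynomial.X r : Lam)))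
  else 0

/-- The Schur function `s_λ = det (h_{λ_i - i + j})`. Here `λ.rowLen i` is the part `λ_{i+1}`, and
`λ.colLen 0` is the length `ℓ(λ)`. -/
def schur (lam : YoungDiagram) : Lam :=
  Matrix.det (Matrix.of fun i j : Fin (lam.colLen 0) =>
    complete ((lam.rowLen i : ℤ) - ((i : ℕ) : ℤ) + ((j : ℕ) : ℤ)))

/-! ### Hall-Littlewood functions -/

/-- The restriction of a symmetric function to `n` variables `y_1, …, y_n`. -/
def restrictVars (n : ℕ) : Lam →ₐ[K] MvPolynomial (Fin n) K :=
  MvPolynomial.aeval fun r : ℕ+ => MvPolynomial.psum (Fin n) K (r : ℕ)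

/-- The polynomial `v_m(t) = ∏_{i=1}^m (1 - t ^ i) / (1 - t)`. -/
def vPoly (m : ℕ) : K := ∏ i ∈ Finset.range m, (1 - t ^ (i + 1)) / (1 - t)

/-- The variable `y_i` as a rational function. -/
def yVar (n : ℕ) (i : Fin n) : FractionRing (MvPolynomial (Fin n) K) :=
  algebraMap (MvPolynomial (Fin n) K) _ (MvPolynomial.X i)

/-- The element `a` of `ℂ(t)` as a rational function in `y_1, …, y_n`. -/
def constRat (n : ℕ) (a : K) : FractionRing (MvPolynomial (Fin n) K) :=
  algebraMap (MvPolynomial (Fin n) K) _ (MvPolynomial.C a)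

/-- The Hall-Littlewood polynomial `Q_λ(y_1, …, y_n; t)` for `n ≥ ℓ = ℓ(λ)`, namely
`(1 - t) ^ ℓ / v_{n-ℓ}(t) * ∑_{w ∈ S_n} w (y ^ λ ∏_{i<j} (y_i - t y_j) / (y_i - y_j))`.
This is `b_λ(t) P_λ(y;t)`, since `b_λ(t) = ∏_{i ≥ 1} (1 - t) ^ (m_i) v_{m_i}(t)` and `P_λ` is the
same sum over `S_n` divided by `v_{n-ℓ}(t) ∏_{i ≥ 1} v_{m_i}(t)`, with `m_i` the multiplicity
of the part `i` in `λ`. -/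
def hallLittlewoodQ (lam : YoungDiagram) (n : ℕ) : FractionRing (MvPolynomial (Fin n) K) :=
  constRat n ((1 - t) ^ lam.colLen 0 / vPoly (n - lam.colLen 0)) *
    ∑ w : Equiv.Perm (Fin n),
      (∏ i : Fin n, yVar n (w i) ^ lam.rowLen i) *
        ∏ i : Fin n, ∏ j ∈ Finset.Ioi i,
          (yVar n (w i) - constRat n t * yVar n (w j)) / (yVar n (w i) - yVar n (w j))

/-- The symmetric function `q` is the Hall-Littlewood function `Q_λ(y;t)`: its restriction to `n`
variables is the Hall-Littlewood polynomial, for all `n ≥ ℓ(λ)`. -/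
def IsHallLittlewoodQ (lam : YoungDiagram) (q : Lam) : Prop :=
  ∀ n : ℕ, lam.colLen 0 ≤ n →
    algebraMap (MvPolynomial (Fin n) K) (FractionRing (MvPolynomial (Fin n) K)) (restrictVars n q) =
      hallLittlewoodQ lam n

/-! ### Maya diagrams and the fermionic Fock space -/

/-- A Maya diagram: a binary string indexed by `ℤ` with only ones far to the left and only zeros
far to the right (`true` is the letter one). -/
@[ext]
structure Maya where
  /-- The letter at each position. -/
  val : ℤ → Bool
  left_one : ∃ a : ℤ, ∀ i ≤ a, val i = true
  right_zero : ∃ b : ℤ, ∀ i ≥ b, val i = false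

/-- Replace the letter of a Maya diagram at position `i` by `b`. -/
def Maya.set (σ : Maya) (i : ℤ) (b : Bool) : Maya where
  val := Function.update σ.val i b
  left_one := by
    obtain ⟨a, ha⟩ := σ.left_one
    refine ⟨min a (i - 1), fun k hk => ?_⟩
    rw [Function.update_of_ne (by grind)]
    exact ha k (by grind)
  right_zero := by
    obtain ⟨a, ha⟩ := σ.right_zero
    refine ⟨max a (i + 1), fun k hk => ?_⟩
    rw [Function.update_of_ne (by grind)]
    exact ha k (by grind)

/-- The number of ones to the right of position `i`. -/
def Maya.onesAbove (σ : Maya) (i : ℤ) : ℕ := {j : ℤ | i < j ∧ σ.val j = true}.ncard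

theorem maya_rowLen_zero (lam : YoungDiagram) {j : ℕ} (h : lam.colLen 0 ≤ j) :
    lam.rowLen j = 0 := by
  by_contra h0
  have h1 : (j, 0) ∈ lam := YoungDiagram.mem_iff_lt_rowLen.2 (Nat.pos_of_ne_zero h0)
  exact absurd (YoungDiagram.mem_iff_lt_colLen.1 h1) (by omega)

open Classical in
/-- The Maya diagram `σ(λ, c)` with ones exactly at the positions `c + 1 + λ_j - j`, `j ≥ 1`. -/
def Maya.ofPartition (lam : YoungDiagram) (c : ℤ) : Maya where
  val := fun i => decide (∃ j : ℕ, i = c + 1 + (lam.rowLen j : ℤ) - ((j : ℤ) + 1))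
  left_one := by
    refine ⟨c - lam.colLen 0, fun i hi => decide_eq_true ⟨(c - i).toNat, ?_⟩⟩
    rw [maya_rowLen_zero lam (by omega)]
    omega
  right_zero := by
    refine ⟨c + 1 + lam.rowLen 0, fun i hi => decide_eq_false ?_⟩
    rintro ⟨j, hj⟩
    have := lam.rowLen_anti 0 j (Nat.zero_le j)
    omega

theorem maya_val_eq_true_iff (lam : YoungDiagram) (c i : ℤ) :
    (Maya.ofPartition lam c).val i = true ↔
      ∃ j : ℕ, i = c + 1 + (lam.rowLen j : ℤ) - ((j : ℤ) + 1) := by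
  simp [Maya.ofPartition]

/-- The partition with a given weakly decreasing sequence of parts that is eventually zero. -/
def partitionOfSeq (f : ℕ → ℕ) (hf : Antitone f) (n : ℕ) : YoungDiagram where
  cells := (Finset.range n ×ˢ Finset.range (f 0)).filter fun p => p.2 < f p.1
  isLowerSet := by
    rintro ⟨a, b⟩ ⟨a', b'⟩ ⟨h1, h2⟩ h
    simp only [Finset.coe_filter, Finset.mem_product, Finset.mem_range, Set.mem_ofPred_eq] at h ⊢
    simp only at h1 h2
    have := hf h1
    omega

theorem rowLen_partitionOfSeq (f : ℕ → ℕ) (hf : Antitone f) (n : ℕ) (hn : ∀ j ≥ n, f j = 0)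
    (i : ℕ) : (partitionOfSeq f hf n).rowLen i = f i := by
  have key : ∀ j, j < (partitionOfSeq f hf n).rowLen i ↔ j < f i := by
    intro j
    rw [← YoungDiagram.mem_iff_lt_rowLen, ← YoungDiagram.mem_cells]
    simp only [partitionOfSeq, Finset.mem_filter, Finset.mem_product, Finset.mem_range]
    refine ⟨fun h => h.2, fun h => ⟨⟨?_, lt_of_lt_of_le h (hf (Nat.zero_le i))⟩, h⟩⟩
    by_contra hi
    rw [hn i (by omega)] at h
    omega
  have h1 := key (f i)
  have h2 := key ((partitionOfSeq f hf n).rowLen i)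
  omega

/-- Partitions and charges are in bijection with Maya diagrams. -/
theorem ofPartition_bijective :
    Function.Bijective fun p : YoungDiagram × ℤ => Maya.ofPartition p.1 p.2 := by
  have anti : ∀ (lam : YoungDiagram) (c : ℤ),
      StrictAnti fun j : ℕ => c + 1 + (lam.rowLen j : ℤ) - ((j : ℤ) + 1) := by
    intro lam c i j hij
    have := lam.rowLen_anti i j hij.le
    simp only
    omega
  constructor
  · rintro ⟨lam, c⟩ ⟨mu, d⟩ h
    simp only at h
    have hr : (Set.range fun j : ℕ => c + 1 + (lam.rowLen j : ℤ) - ((j : ℤ) + 1)) =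
        Set.range fun j : ℕ => d + 1 + (mu.rowLen j : ℤ) - ((j : ℤ) + 1) := by
      ext i
      have h1 := maya_val_eq_true_iff lam c i
      have h2 := maya_val_eq_true_iff mu d i
      rw [h] at h1
      simp only [Set.mem_range, eq_comm (b := i)]
      rw [← h1, ← h2]
    have hfun := (StrictMono.range_inj (γ := ℤᵒᵈ) (anti lam c).dual_right
      (anti mu d).dual_right).1 hr
    have hval : ∀ j : ℕ, c + (lam.rowLen j : ℤ) = d + (mu.rowLen j : ℤ) := by
      intro j
      have hj : c + 1 + (lam.rowLen j : ℤ) - ((j : ℤ) + 1) =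
        d + 1 + (mu.rowLen j : ℤ) - ((j : ℤ) + 1) := congrFun hfun j
      linarith
    have hcd : c = d := by
      have := hval (max (lam.colLen 0) (mu.colLen 0))
      rw [maya_rowLen_zero lam (le_max_left _ _), maya_rowLen_zero mu (le_max_right _ _)] at this
      simpa using this
    have hrow : ∀ j, lam.rowLen j = mu.rowLen j := by
      intro j
      have := hval j
      omega
    refine Prod.ext ?_ hcd
    ext ⟨i, j⟩
    change (i, j) ∈ lam.cells ↔ (i, j) ∈ mu.cells
    rw [YoungDiagram.mem_cells, YoungDiagram.mem_cells, YoungDiagram.mem_iff_lt_rowLen,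
      YoungDiagram.mem_iff_lt_rowLen, hrow]
  · intro σ
    obtain ⟨a, ha⟩ := σ.left_one
    obtain ⟨b, hb⟩ := σ.right_zero
    let q : ℕ → Prop := fun k => σ.val (b - k) = true
    have hq : ∀ k : ℕ, (b - a).toNat ≤ k → q k := fun k hk => ha _ (by omega)
    have hinf : {k | q k}.Infinite :=
      Set.infinite_of_not_bddAbove fun ⟨N, hN⟩ => by
        have := hN (show N + 1 + (b - a).toNat ∈ {k | q k} from hq _ (by omega))
        omega
    have hmono : StrictMono (Nat.nth q) := Nat.nth_strictMono hinf
    have hrange : Set.range (Nat.nth q) = {k | q k} := Nat.range_nth_of_infinite hinf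
    have hstep : ∀ j ≥ (b - a).toNat, Nat.nth q (j + 1) = Nat.nth q j + 1 := by
      intro j hj
      have h1 : j ≤ Nat.nth q j := hmono.id_le j
      obtain ⟨l, hl⟩ : Nat.nth q j + 1 ∈ Set.range (Nat.nth q) := by
        rw [hrange]
        exact hq _ (by omega)
      have h2 : j < l := hmono.lt_iff_lt.1 (by omega)
      have h3 : Nat.nth q (j + 1) ≤ Nat.nth q l := hmono.monotone h2
      have h4 := hmono (Nat.lt_succ_self j)
      simp only [Nat.succ_eq_add_one] at h4
      omega
    set J := (b - a).toNat with hJ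
    set D := Nat.nth q J - J with hD
    have hDle : J ≤ Nat.nth q J := hmono.id_le J
    have hlarge : ∀ i : ℕ, Nat.nth q (J + i) = D + (J + i) := by
      intro i
      induction i with
      | zero => simp only [Nat.add_zero]; omega
      | succ i ih => rw [← Nat.add_assoc, hstep _ (by omega), ih]; omega
    have hlow : ∀ j, Nat.nth q j ≤ D + j := by
      intro j
      have hdiff : ∀ d : ℕ, Nat.nth q j + d ≤ Nat.nth q (j + d) := by
        intro d
        induction d with
        | zero => simp
        | succ d ih =>
          have := hmono (Nat.lt_succ_self (j + d))
          simp only [Nat.succ_eq_add_one] at this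
          rw [← Nat.add_assoc j d 1]
          omega
      have h1 := hdiff J
      have h2 := hlarge j
      rw [Nat.add_comm J j] at h2
      omega
    have hf : Antitone fun j => D + j - Nat.nth q j := by
      refine antitone_nat_of_succ_le fun j => ?_
      have := hmono (Nat.lt_succ_self j)
      simp only [Nat.succ_eq_add_one] at this
      omega
    have hz : ∀ j ≥ J, D + j - Nat.nth q j = 0 := by
      intro j hj
      have := hlarge (j - J)
      rw [Nat.add_sub_cancel' hj] at this
      omega
    refine ⟨(partitionOfSeq _ hf J, b - D), ?_⟩
    ext i
    rw [Bool.eq_iff_iff]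
    change (Maya.ofPartition (partitionOfSeq _ hf J) (b - D)).val i = true ↔ _
    rw [maya_val_eq_true_iff]
    simp only [rowLen_partitionOfSeq _ hf J hz]
    have hpos : ∀ j : ℕ, b - (D : ℤ) + 1 + ((D + j - Nat.nth q j : ℕ) : ℤ) - ((j : ℤ) + 1) =
        b - (Nat.nth q j : ℤ) := by
      intro j
      have := hlow j
      omega
    constructor
    · rintro ⟨j, hj⟩
      rw [hpos] at hj
      rw [hj]
      exact Nat.nth_mem_of_infinite hinf j
    · intro hi
      have hib : i < b := by
        by_contra hcon
        rw [hb i (by omega)] at hi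
        exact absurd hi (by simp)
      have hmem : (b - i).toNat ∈ {k | q k} := by
        change σ.val (b - ((b - i).toNat : ℤ)) = true
        rw [← hi]
        congr 1
        omega
      rw [← hrange] at hmem
      obtain ⟨j, hj⟩ := hmem
      refine ⟨j, ?_⟩
      rw [hpos, hj]
      omega

/-- The bijection `(λ, c) ↦ σ(λ, c)`. -/
def mayaEquiv : YoungDiagram × ℤ ≃ Maya := Equiv.ofBijective _ ofPartition_bijective

/-- The fermionic Fock space `ℱ(t)`, the `ℂ(t)`-linear span of the Maya diagrams of all charges. -/
abbrev Fock : Type := Maya →₀ K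

/-- The deformed fermion field `ψ_i⁺(t)`. -/
def psiPlus (i : ℤ) : Module.End K Fock :=
  Finsupp.linearCombination K fun σ : Maya =>
    if σ.val i = false then Finsupp.single (σ.set i true) ((-t) ^ σ.onesAbove i) else 0

/-- The deformed fermion field `ψ_i⁻(t)`. -/
def psiMinus (i : ℤ) : Module.End K Fock :=
  Finsupp.linearCombination K fun σ : Maya =>
    if σ.val i = true then Finsupp.single (σ.set i false) (((-t) ^ σ.onesAbove i)⁻¹) else 0

/-- The operator `E_{ij}(t) = (1 - t) ψ_i⁻(t) ψ_j⁺(t)`. -/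
def hop (p : ℤ × ℤ) : Module.End K Fock := (1 - t) • (psiMinus p.1 * psiPlus p.2)

/-- The sequences `i_1 < j_1 < i_2 < j_2 < ⋯ < i_r < j_r`, for all `r ≥ 0`, with
`(j_1 - i_1) + ⋯ + (j_r - i_r) = m`. -/
def HopSeq (m : ℕ) : Type :=
  {L : List (ℤ × ℤ) // (∀ p ∈ L, p.1 < p.2) ∧ L.Pairwise (fun p q => p.2 < q.1) ∧
    (L.map fun p => p.2 - p.1).sum = (m : ℤ)}

/-- The terms `t ^ m E_{i_1 j_1}(t) ⋯ E_{i_r j_r}(t)` of the coefficient of `x ^ m` in `A(x;t)`. -/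
def transferTerms (m : ℕ) (L : HopSeq m) : Module.End K Fock :=
  t ^ m • (L.1.map hop).prod

theorem hop_single (p : ℤ × ℤ) (hp : p.1 < p.2) (σ : Maya) (a : K) :
    ∃ b : K, hop p (Finsupp.single σ a) = Finsupp.single ((σ.set p.2 true).set p.1 false) b ∧
      (b ≠ 0 → a ≠ 0 ∧ σ.val p.1 = true ∧ σ.val p.2 = false) := by
  have hne : p.1 ≠ p.2 := hp.ne
  have hval : (σ.set p.2 true).val p.1 = σ.val p.1 := Function.update_of_ne hne _ _
  have hplus : psiPlus p.2 (Finsupp.single σ a) =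
      if σ.val p.2 = false then
        Finsupp.single (σ.set p.2 true) (a * (-t) ^ σ.onesAbove p.2) else 0 := by
    rw [psiPlus, Finsupp.linearCombination_single]
    split_ifs
    · rw [Finsupp.smul_single, smul_eq_mul]
    · rw [smul_zero]
  have hminus : ∀ c : K, psiMinus p.1 (Finsupp.single (σ.set p.2 true) c) =
      if σ.val p.1 = true then
        Finsupp.single ((σ.set p.2 true).set p.1 false)
          (c * ((-t) ^ (σ.set p.2 true).onesAbove p.1)⁻¹) else 0 := by
    intro c
    rw [psiMinus, Finsupp.linearCombination_single, hval]
    split_ifs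
    · rw [Finsupp.smul_single, smul_eq_mul]
    · rw [smul_zero]
  rw [hop, LinearMap.smul_apply, Module.End.mul_apply, hplus]
  by_cases h2 : σ.val p.2 = false
  · rw [if_pos h2, hminus]
    by_cases h1 : σ.val p.1 = true
    · rw [if_pos h1, Finsupp.smul_single]
      refine ⟨_, rfl, fun hb => ⟨?_, h1, h2⟩⟩
      rintro rfl
      simp at hb
    · exact ⟨0, by rw [if_neg h1, smul_zero, Finsupp.single_zero], fun hb => absurd rfl hb⟩
  · exact ⟨0, by rw [if_neg h2, map_zero, smul_zero, Finsupp.single_zero],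
      fun hb => absurd rfl hb⟩

theorem hop_list_bound (σ : Maya) (lo hi : ℤ) (hlo : ∀ i ≤ lo, σ.val i = true)
    (hhi : ∀ i ≥ hi, σ.val i = false) (m : ℕ) (L : List (ℤ × ℤ))
    (hL : ∀ p ∈ L, p.1 < p.2 ∧ p.2 - p.1 ≤ (m : ℤ)) :
    ∃ (τ : Maya) (a : K), (L.map hop).prod (Finsupp.single σ 1) = Finsupp.single τ a ∧
      (a ≠ 0 → (∀ i ≤ lo - m * L.length, τ.val i = true) ∧
        (∀ i ≥ hi + m * L.length, τ.val i = false) ∧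
        ∀ p ∈ L, lo - m * L.length ≤ p.1 ∧ p.2 ≤ hi + m * L.length) := by
  induction L with
  | nil => exact ⟨σ, 1, by simp, fun _ => ⟨by simpa using hlo, by simpa using hhi, by simp⟩⟩
  | cons p L ih =>
    obtain ⟨τ, a, h1, h2⟩ := ih fun q hq => hL q (List.mem_cons_of_mem _ hq)
    obtain ⟨hp, hpm⟩ := hL p List.mem_cons_self
    obtain ⟨b, h3, h4⟩ := hop_single p hp τ a
    refine ⟨_, b, by rw [List.map_cons, List.prod_cons, Module.End.mul_apply, h1, h3], fun hb => ?_⟩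
    obtain ⟨ha, hp1, hp2⟩ := h4 hb
    obtain ⟨h5, h6, h7⟩ := h2 ha
    have e : (m : ℤ) * ((p :: L).length : ℤ) = m * L.length + m := by
      rw [List.length_cons]; push_cast; ring
    rw [e]
    have g1 : p.1 < hi + m * L.length := by
      by_contra hc
      rw [h6 _ (by omega)] at hp1
      simp at hp1
    have g2 : lo - m * L.length < p.2 := by
      by_contra hc
      rw [h5 _ (by omega)] at hp2
      simp at hp2
    refine ⟨fun i hi' => ?_, fun i hi' => ?_, fun q hq => ?_⟩
    · change Function.update (Function.update τ.val p.2 true) p.1 false i = true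
      by_cases hi1 : i = p.1
      · exfalso
        omega
      · rw [Function.update_of_ne hi1]
        by_cases hi2 : i = p.2
        · rw [hi2, Function.update_self]
        · rw [Function.update_of_ne hi2]
          exact h5 i (by omega)
    · change Function.update (Function.update τ.val p.2 true) p.1 false i = false
      by_cases hi1 : i = p.1
      · rw [hi1, Function.update_self]
      · rw [Function.update_of_ne hi1]
        by_cases hi2 : i = p.2
        · exfalso
          omega
        · rw [Function.update_of_ne hi2]
          exact h6 i (by omega)
    · rcases List.mem_cons.1 hq with rfl | hq
      · constructor <;> omega
      · have := h7 q hq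
        constructor <;> omega

/-- The sum that defines `A_m(t)` is finite on every vector. -/
theorem transferTerms_pointwiseFinite (m : ℕ) : PointwiseFinite (transferTerms m) := by
  have basic : ∀ σ : Maya,
      (Function.support fun L : HopSeq m => transferTerms m L (Finsupp.single σ 1)).Finite := by
    intro σ
    obtain ⟨lo, hlo⟩ := σ.left_one
    obtain ⟨hi, hhi⟩ := σ.right_zero
    let S : Set (ℤ × ℤ) :=
      Set.Icc (lo - m * m) (hi + m * m) ×ˢ Set.Icc (lo - m * m) (hi + m * m)
    have hS : S.Finite := (Set.finite_Icc _ _).prod (Set.finite_Icc _ _)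
    have : Finite S := hS
    have hfin : ((fun l : List S => l.map Subtype.val) '' {l : List S | l.length ≤ m}).Finite :=
      (List.finite_length_le S m).image _
    refine Set.Finite.of_finite_image (f := Subtype.val) (hfin.subset ?_)
      Subtype.val_injective.injOn
    rintro _ ⟨⟨L, hL1, hL2, hL3⟩, hL, rfl⟩
    have hlen : L.length ≤ m ∧ ∀ p ∈ L, p.2 - p.1 ≤ (m : ℤ) := by
      rw [← hL3] at *
      clear hL hL2 hfin
      have : ∀ L : List (ℤ × ℤ), (∀ p ∈ L, p.1 < p.2) →
          (L.length : ℤ) ≤ (L.map fun p => p.2 - p.1).sum ∧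
            ∀ p ∈ L, p.2 - p.1 ≤ (L.map fun p => p.2 - p.1).sum := by
        intro L
        induction L with
        | nil => simp
        | cons q L ih =>
          intro h
          obtain ⟨i1, i2⟩ := ih fun p hp => h p (List.mem_cons_of_mem _ hp)
          have hq := h q List.mem_cons_self
          simp only [List.length_cons, List.map_cons, List.sum_cons]
          push_cast
          refine ⟨by omega, fun p hp => ?_⟩
          rcases List.mem_cons.1 hp with rfl | hp
          · omega
          · have := i2 p hp
            omega
      obtain ⟨j1, j2⟩ := this L hL1
      exact ⟨by omega, j2⟩
    obtain ⟨τ, a, h1, h2⟩ := hop_list_bound σ lo hi hlo hhi m L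
      fun p hp => ⟨hL1 p hp, hlen.2 p hp⟩
    have ha : a ≠ 0 := by
      rintro rfl
      apply hL
      simp [transferTerms, h1]
    have h3 := (h2 ha).2.2
    have hmm : (m : ℤ) * L.length ≤ m * m :=
      mul_le_mul_of_nonneg_left (by exact_mod_cast hlen.1) (by positivity)
    refine ⟨L.attach.map fun p => ⟨p.1, ?_⟩, by simpa using hlen.1, by
      
      change List.map Subtype.val (List.map _ L.attach) = L
      rw [List.map_map]
      exact List.attach_map_subtype_val L⟩
    have h4 := h3 p.1 p.2
    have h5 := hL1 p.1 p.2
    exact ⟨⟨by omega, by omega⟩, ⟨by omega, by omega⟩⟩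
  intro v
  refine (Set.Finite.biUnion v.support.finite_toSet fun σ _ => basic σ).subset fun L hL => ?_
  by_contra hc
  apply hL
  simp only [Set.mem_iUnion, not_exists, Function.mem_support, not_not] at hc
  change transferTerms m L v = 0
  conv_lhs => rw [← Finsupp.sum_single v]
  rw [Finsupp.sum, map_sum]
  refine Finset.sum_eq_zero fun σ hσ => ?_
  have := hc σ hσ
  rw [show Finsupp.single σ (v σ) = v σ • Finsupp.single σ (1 : K) by simp, map_smul, this,
    smul_zero]

/-- The coefficient `A_m(t)` of `A(x;t)`. -/
def transferCoeff (m : ℕ) : Module.End K Fock := sumOp (transferTerms m)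

/-- The operator
`A(x;t) = 1 + ∑_{r>0} ∑_{i_1<j_1<⋯<i_r<j_r} (xt) ^ (j_1-i_1+⋯+j_r-i_r) E_{i_1j_1}(t)⋯E_{i_rj_r}(t)`
as a power series in `x`. -/
def transfer : (Module.End K Fock)⟦X⟧ := PowerSeries.mk transferCoeff

/-- The inverse `A⁻¹(x;t)` of the power series `A(x;t)`. -/
def transferInv : (Module.End K Fock)⟦X⟧ := Ring.inverse transfer

/-- The coefficient of `x ^ m` in `A⁻¹(x;t)`. -/
def transferInvCoeff (m : ℕ) : Module.End K Fock := PowerSeries.coeff m transferInv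

/-! ### The asymmetric six-vertex model -/

/-- The Boltzmann weight of a vertex with edge values `W`, `N`, `E`, `S`, for the parameters
`ω₁ = ω₃ = ω₅ = 1`, `ω₂ = -x`, `ω₄ = tx`, `ω₆ = (t-1)x`. -/
def vertexWeight : Bool → Bool → Bool → Bool → K⟦X⟧
  | false, false, false, false => 1
  | true, true, true, true => -PowerSeries.X
  | false, true, false, true => 1
  | true, false, true, false => PowerSeries.C t * PowerSeries.X
  | true, false, false, true => 1
  | false, true, true, false => PowerSeries.C (t - 1) * PowerSeries.X
  | _, _, _, _ => 0

/-- The partition function of an infinite lattice row with upper vertical edges `σ` and lower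
vertical edges `σ'`. A row configuration is given by the values `e i` of the horizontal edges
between the vertices `i` and `i + 1`, which have to vanish far to the left and to the right. -/
def rowPartition (σ σ' : Maya) : K⟦X⟧ :=
  ∑ᶠ e : {e : ℤ → Bool // {i : ℤ | e i = true}.Finite},
    ∏ᶠ i : ℤ, vertexWeight (e.1 (i - 1)) (σ.val i) (e.1 i) (σ'.val i)

/-! ### The boson-fermion correspondence -/

/-- The space `⨁_c z ^ c ⊗ Λ(t)`. -/
abbrev Boson : Type := ℤ →₀ Lam

/-- The boson-fermion correspondence `ι_t`, the linear map with `σ(λ, c) ↦ z ^ c ⊗ s_λ`. -/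
def iota : Fock →ₗ[K] Boson :=
  Finsupp.linearCombination K fun σ : Maya =>
    Finsupp.single (mayaEquiv.symm σ).2 (schur (mayaEquiv.symm σ).1)

/-- The operator `1 ⊗ f` on `⨁_c z ^ c ⊗ Λ(t)`. -/
def onBoson (f : Module.End K Lam) : Module.End K Boson := Finsupp.mapRange.linearMap f

/-- The deformed inner product on `⨁_c z ^ c ⊗ Λ(t)`, for which the summands are orthogonal. -/
def bosonForm : LinearMap.BilinForm K Boson :=
  Finsupp.lsum K fun c : ℤ => tForm.compl₂ (Finsupp.lapply c)

/-- The deformed inner product on `ℱ(t)`, the pullback along `ι_t`. -/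
def fockForm : LinearMap.BilinForm K Fock := bosonForm.compl₁₂ iota iota

/-- The coefficient of `x ^ (-m)` in `A^*(x;t)`, where the adjoint is taken for the deformed inner
product and `x^* = x ^ (-1)`. -/
def transferAdj (m : ℕ) : Module.End K Fock := adjointOp fockForm (transferCoeff m)

/-- The coefficient of `x ^ (-m)` in `(A⁻¹(x;t))^*`. -/
def transferInvAdj (m : ℕ) : Module.End K Fock := adjointOp fockForm (transferInvCoeff m)

/-- The terms of the operator `Ψ_m = ∑_{r-s=m} A⁻¹_r A^*_s`. -/
def psiModeTerms (m : ℤ) : {p : ℕ × ℕ // (p.1 : ℤ) - (p.2 : ℤ) = m} → Module.End K Fock :=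
  laurentTerms transferInvCoeff transferAdj m

/-- The operator `Ψ_m = ∑_{r-s=m} A⁻¹_r A^*_s`, the coefficient of `x ^ m` in
`A⁻¹(x;t) ∘ A^*(x;t)`. -/
def psiMode (m : ℤ) : Module.End K Fock := sumOp (psiModeTerms m)

/-- The terms of the coefficient of `x ^ m` in `A(x;t) ∘ (A⁻¹(x;t))^*`. -/
def psiPlusModeTerms (m : ℤ) : {p : ℕ × ℕ // (p.1 : ℤ) - (p.2 : ℤ) = m} → Module.End K Fock :=
  laurentTerms transferCoeff transferInvAdj m

/-- The coefficient of `x ^ m` in `A(x;t) ∘ (A⁻¹(x;t))^*`. -/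
def psiPlusMode (m : ℤ) : Module.End K Fock := sumOp (psiPlusModeTerms m)

end

end HallLittlewoodIce

open HallLittlewoodIce

open scoped PowerSeries

namespace HallLittlewoodIce

noncomputable section

/-! ### Exponentials of power series -/

section Exponential

open PowerSeries

variable {R : Type*} [CommRing R] [Algebra K R]

/-! Let `Q(x) = ∏ (1 - t x y_i) / (1 - x y_i)` be the series `serQ` and `G(x)` its inverse `serG`.
The core is `iota_transferCoeff`: under `iota`, the operator `A(x;t)` becomes multiplication by
`G(x)`, hence `A⁻¹(x;t)` becomes multiplication by `Q(x)`. For the deformed form, `p_r` is adjoint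
to `r / (1 - t ^ r) ∂/∂p_r`. By Taylor's formula the adjoints of multiplication by `G(x)` and
`Q(x)`, with `x^* = 1/x`, are therefore the substitutions `f[Y - 1/x]` and `f[Y + 1/x]`
(`isAdjointPair_expPos`). So `A⁻¹ A^*` is `f ↦ Q(x) f[Y - 1/x]`, which is Jing's `Φ⁻`, and `A
(A⁻¹)^*` is `f ↦ G(x) f[Y + 1/x]`, which is `Φ⁺`.

To identify `A` with `G`, undeformed fermions are used. By the Jacobi-Trudi formula, the creation
operator `fermion i` becomes a mode of Bernstein's operator `f ↦ H(x) f[Y - 1/x]` (`iota_fermion`).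
The operator `A` and multiplication by `G` satisfy the same exchange relation with these modes
(`transferCoeff_fermion`, `mulG_bosonFermion`). Every Maya diagram arises from a vacuum by creation
operators, so it is enough to compare on vacua. There `A_n` moves one particle across the surface,
which gives hook shapes, and `cG_eq_sum_hooks` is the matching expansion of `G` into hook Schur
functions. The exchange relation of `A` is local: `A_m` is a sum over sets of `m` horizontal edges,
whose maximal runs are the hops (`prod_hop_eq_edgeOp`), and only the two vertices at the ends of
edge `i` interact with the fermions at `i` and `i + 1`.

The map `iota` is injective because creation operators fill the holes of a hypothetical kernel
element one by one. It is surjective because its image contains the vacua and is stable under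
multiplication by the coefficients of `G`, which generate `Λ(t)`.

The commutation relations come from `Φ(x) Φ(z) f = Q(x) Q(z) (1 - z/x) / (1 - t z/x) f[Y - 1/x -
1/z]`: multiplied by `x - t z`, the right side becomes antisymmetric in `x` and `z`.

For the Hall-Littlewood functions, `Q(x)` in finitely many variables is split into partial
fractions. A mode of positive index then acts as a sum over the variable `y_p` to be removed
(`evalVars_vertexOp`). Iterating this is the expansion of the sum over `S_n` by the value of `w` at
the first index (`hlSum_succ`). -/

theorem succ_mul_cancel {n : ℕ} {a b : R} (h : a * ((n : R) + 1) = b * ((n : R) + 1)) : a = b := by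
  have hK : ((n : K) + 1) ≠ 0 := by exact_mod_cast Nat.succ_ne_zero n
  have hu : algebraMap K R ((n : K) + 1) * algebraMap K R ((n : K) + 1)⁻¹ = 1 := by
    rw [← map_mul, mul_inv_cancel₀ hK, map_one]
  have hn : ((n : R) + 1) = algebraMap K R ((n : K) + 1) := by simp
  rw [hn] at h
  have := congrArg (· * algebraMap K R ((n : K) + 1)⁻¹) h
  simpa only [mul_assoc, hu, mul_one] using this

/-- A power series with prescribed logarithmic derivative is determined by its constant term. -/
theorem logDeriv_unique {F a b : R⟦X⟧} (h0 : constantCoeff a = constantCoeff b)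
    (ha : d⁄dX R a = F * a) (hb : d⁄dX R b = F * b) : a = b := by
  ext n
  induction n using Nat.strong_induction_on with
  | _ n ih =>
    cases n with
    | zero => simpa using h0
    | succ n =>
      apply succ_mul_cancel (n := n)
      rw [← coeff_derivative, ← coeff_derivative, ha, hb, coeff_mul, coeff_mul]
      refine Finset.sum_congr rfl fun p hp => ?_
      rw [ih p.2 (by have := Finset.HasAntidiagonal.mem_antidiagonal.1 hp; omega)]

theorem coeff_pow_of_lt {R : Type*} [CommRing R] {F : R⟦X⟧} (h0 : constantCoeff F = 0) {n k : ℕ}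
    (h : n < k) : coeff n (F ^ k) = 0 := by
  have : X ^ k ∣ F ^ k := pow_dvd_pow_of_dvd (X_dvd_iff.2 h0) k
  exact X_pow_dvd_iff.1 this n h

theorem constantCoeff_expSeries (F : R⟦X⟧) : constantCoeff (expSeries F) = 1 := by
  rw [← coeff_zero_eq_constantCoeff_apply]
  simp [expSeries]

theorem coeff_expSeries {F : R⟦X⟧} (h0 : constantCoeff F = 0) {n N : ℕ} (h : n ≤ N) :
    coeff n (expSeries F) =
      ∑ k ∈ Finset.range (N + 1), ((k.factorial : K)⁻¹) • coeff n (F ^ k) := by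
  rw [expSeries, coeff_mk]
  refine Finset.sum_subset (Finset.range_mono (by omega)) fun k _ hk => ?_
  rw [coeff_pow_of_lt h0 (by simpa using hk), smul_zero]

theorem derivative_expSeries {F : R⟦X⟧} (h0 : constantCoeff F = 0) :
    d⁄dX R (expSeries F) = d⁄dX R F * expSeries F := by
  ext n
  rw [coeff_derivative, coeff_expSeries h0 le_rfl, coeff_mul]
  have h1 : ∀ p ∈ Finset.HasAntidiagonal.antidiagonal n,
      coeff p.1 (d⁄dX R F) * coeff p.2 (expSeries F) =
      ∑ k ∈ Finset.range (n + 1), ((k.factorial : K)⁻¹) •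
        (coeff p.1 (d⁄dX R F) * coeff p.2 (F ^ k)) := by
    intro p hp
    rw [coeff_expSeries h0 (N := n)
        (by have := Finset.HasAntidiagonal.mem_antidiagonal.1 hp; omega),
      Finset.mul_sum]
    exact Finset.sum_congr rfl fun k _ => mul_smul_comm _ _ _
  rw [Finset.sum_congr rfl h1, Finset.sum_comm, Finset.sum_range_succ']
  simp only [← Finset.smul_sum, ← coeff_mul]
  rw [add_mul, Finset.sum_mul]
  simp only [pow_zero, coeff_one, Nat.succ_ne_zero, if_false, smul_zero, zero_mul, add_zero]
  refine Finset.sum_congr rfl fun k _ => ?_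
  have hk : ((k : K) + 1) ≠ 0 := by exact_mod_cast Nat.succ_ne_zero k
  rw [smul_mul_assoc, ← coeff_derivative, derivative_pow, Nat.add_sub_cancel, mul_assoc,
    ← nsmul_eq_mul, map_nsmul, ← Nat.cast_smul_eq_nsmul K, smul_smul, Nat.factorial_succ,
    mul_comm (F ^ k)]
  congr 1
  push_cast
  field_simp

/-- The tool for recognising exponentials: a logarithmic derivative and a constant term are
compared, and no sum over powers of `F` has to be handled. -/
theorem expSeries_eq_of_derivative {F a : R⟦X⟧} (h0 : constantCoeff F = 0)
    (ha0 : constantCoeff a = 1) (ha : d⁄dX R a = d⁄dX R F * a) : expSeries F = a :=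
  logDeriv_unique (by rw [constantCoeff_expSeries, ha0]) (derivative_expSeries h0) ha

theorem expSeries_add {F G : R⟦X⟧} (hF : constantCoeff F = 0) (hG : constantCoeff G = 0) :
    expSeries (F + G) = expSeries F * expSeries G := by
  refine expSeries_eq_of_derivative (by simp [hF, hG]) (by simp [constantCoeff_expSeries]) ?_
  rw [Derivation.leibniz, derivative_expSeries hF, derivative_expSeries hG, map_add]
  simp only [smul_eq_mul]
  ring

theorem expSeries_zero : expSeries (0 : R⟦X⟧) = 1 :=
  expSeries_eq_of_derivative (by simp) (by simp) (by simp)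

end Exponential

/-- Exponentials are compatible with algebra homomorphisms. -/
theorem map_expSeries {R S : Type*} [Ring R] [Ring S] [Algebra K R] [Algebra K S] (f : R →ₐ[K] S)
    (F : R⟦X⟧) :
    PowerSeries.map (f : R →+* S) (expSeries F) = expSeries (PowerSeries.map (f : R →+* S) F) := by
  ext n
  simp only [expSeries, PowerSeries.coeff_map, PowerSeries.coeff_mk, map_sum, ← map_pow]
  exact Finset.sum_congr rfl fun k _ => map_smul f _ _

theorem map_positiveSeries {R S : Type*} [Ring R] [Ring S] [Algebra K R] [Algebra K S]
    (f : R →ₐ[K] S) (c : ℕ+ → K) (P : ℕ+ → R) :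
    PowerSeries.map (f : R →+* S) (positiveSeries c P) = positiveSeries c fun r => f (P r) := by
  ext n
  simp only [positiveSeries, PowerSeries.coeff_map, PowerSeries.coeff_mk]
  split_ifs
  · exact map_smul f _ _
  · exact map_zero f

/-! ### Exponentials of `∑ c_r P_r x ^ r` over a commutative algebra. -/

section Positive

variable {R : Type*} [CommRing R] [Algebra K R]

/-- The series `exp (∑ r, c_r P_r x ^ r)` over a commutative algebra. -/
def expPos (c : ℕ+ → K) (P : ℕ+ → R) : R⟦X⟧ := expSeries (positiveSeries c P)

theorem constantCoeff_positiveSeries (c : ℕ+ → K) (P : ℕ+ → R) :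
    PowerSeries.constantCoeff (positiveSeries c P) = 0 := by
  rw [← PowerSeries.coeff_zero_eq_constantCoeff_apply]
  simp [positiveSeries]

theorem coeff_zero_expPos (c : ℕ+ → K) (P : ℕ+ → R) : PowerSeries.coeff 0 (expPos c P) = 1 := by
  rw [PowerSeries.coeff_zero_eq_constantCoeff_apply]
  exact constantCoeff_expSeries _

theorem map_expPos {S : Type*} [CommRing S] [Algebra K S] (f : R →ₐ[K] S) (c : ℕ+ → K)
    (P : ℕ+ → R) :
    PowerSeries.map (f : R →+* S) (expPos c P) = expPos c fun r => f (P r) := by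
  rw [expPos, map_expSeries, map_positiveSeries, expPos]

/-- Only the products `c_r P_r` matter, so the three exponentials may use unrelated splittings into
scalar and ring element. -/
theorem expPos_mul_of_add {c c' c'' : ℕ+ → K} {P P' P'' : ℕ+ → R}
    (h : ∀ r, c'' r • P'' r = c r • P r + c' r • P' r) :
    expPos c'' P'' = expPos c P * expPos c' P' := by
  rw [expPos, expPos, expPos, ← expSeries_add (constantCoeff_positiveSeries _ _)
    (constantCoeff_positiveSeries _ _)]
  congr 1
  ext n
  simp only [positiveSeries, map_add, PowerSeries.coeff_mk]
  split_ifs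
  · exact h _
  · simp

theorem expPos_eq_one_of_zero {c : ℕ+ → K} {P : ℕ+ → R} (h : ∀ r, c r • P r = 0) :
    expPos c P = 1 := by
  rw [expPos, ← expSeries_zero]
  congr 1
  ext n
  simp only [positiveSeries, PowerSeries.coeff_mk, map_zero]
  split_ifs
  · exact h _
  · rfl

theorem expPos_congr {c c' : ℕ+ → K} {P P' : ℕ+ → R}
    (h : ∀ r, c r • P r = c' r • P' r) : expPos c P = expPos c' P' := by
  rw [expPos, expPos]
  congr 1
  ext n
  simp only [positiveSeries, PowerSeries.coeff_mk]
  split_ifs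
  · exact h _
  · rfl

/-- Newton-type recursion for the coefficients of `exp (∑ r, c_r P_r x ^ r)`. -/
theorem expPos_recursion (c : ℕ+ → K) (P : ℕ+ → R) (n : ℕ) :
    ((n : K) + 1) • PowerSeries.coeff (n + 1) (expPos c P) =
      ∑ p ∈ Finset.HasAntidiagonal.antidiagonal n,
        (((p.1 : K) + 1) * c p.1.succPNat) • (P p.1.succPNat *
          PowerSeries.coeff p.2 (expPos c P)) := by
  have h := congrArg (PowerSeries.coeff n)
    (derivative_expSeries (constantCoeff_positiveSeries c P))
  rw [PowerSeries.coeff_derivative, PowerSeries.coeff_mul] at h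
  rw [expPos, Algebra.smul_def, map_add, map_natCast, map_one, mul_comm, h]
  refine Finset.sum_congr rfl fun p _ => ?_
  rw [PowerSeries.coeff_derivative, positiveSeries, PowerSeries.coeff_mk, dif_pos (Nat.succ_pos _)]
  rw [mul_smul, Algebra.smul_def ((p.1 : K) + 1), map_add, map_natCast, map_one]
  rw [mul_comm (_ • _) ((p.1 : R) + 1), mul_assoc, smul_mul_assoc]
  rfl

/-- The series `log (1 - a x) = -∑ a ^ r x ^ r / r`, verified through its derivative. It is the
source of all the rational factors below. -/
theorem expPos_neg_pow (a : R) :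
    expPos (fun r : ℕ+ => -((r : ℕ) : K)⁻¹) (fun r : ℕ+ => a ^ (r : ℕ)) =
      1 - PowerSeries.C a * PowerSeries.X := by
  refine expSeries_eq_of_derivative (constantCoeff_positiveSeries _ _) (by simp) ?_
  have hd : PowerSeries.derivative R (positiveSeries (fun r : ℕ+ => -((r : ℕ) : K)⁻¹)
      (fun r : ℕ+ => a ^ (r : ℕ))) = PowerSeries.mk fun n => -a ^ (n + 1) := by
    ext n
    rw [PowerSeries.coeff_derivative, positiveSeries, PowerSeries.coeff_mk,
      dif_pos (Nat.succ_pos _), PowerSeries.coeff_mk]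
    have hn : ((n : R) + 1) = algebraMap K R ((n : K) + 1) := by simp
    have hK : ((n : K) + 1) ≠ 0 := by exact_mod_cast Nat.succ_ne_zero n
    rw [mul_comm, hn, ← Algebra.smul_def, smul_smul]
    simp only [PNat.mk_coe, Nat.cast_succ, mul_neg]
    rw [mul_inv_cancel₀ hK, neg_smul, one_smul]
  rw [hd]
  ext n
  rw [mul_sub, mul_one, ← mul_assoc, PowerSeries.coeff_derivative, map_sub, map_sub]
  cases n with
  | zero => simp [PowerSeries.coeff_one, mul_assoc]
  | succ n =>
    rw [PowerSeries.coeff_succ_mul_X, PowerSeries.coeff_succ_mul_X, PowerSeries.coeff_mul_C]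
    simp [PowerSeries.coeff_one, PowerSeries.coeff_mk]
    ring

theorem one_sub_X_mul_expPos (a : R) :
    (1 - PowerSeries.C a * PowerSeries.X) *
      expPos (fun r : ℕ+ => ((r : ℕ) : K)⁻¹) (fun r : ℕ+ => a ^ (r : ℕ)) = 1 := by
  rw [← expPos_neg_pow, ← expPos_mul_of_add (c'' := 0) (P'' := 0), expPos_eq_one_of_zero]
  · simp
  · intro r
    simp

end Positive

/-! ### Generating series of symmetric functions -/

/-- The coefficient of `x ^ n` in a power series, for an integer `n`. -/
def zcoeff {R : Type*} [Semiring R] (a : R⟦X⟧) (n : ℤ) : R :=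
  if 0 ≤ n then PowerSeries.coeff n.toNat a else 0

/-! ### Coefficients indexed by all integers. -/

section ZCoeff

variable {R : Type*} [CommRing R]

theorem zcoeff_natCast (a : R⟦X⟧) (n : ℕ) : zcoeff a n = PowerSeries.coeff n a := by
  simp [zcoeff]

theorem zcoeff_neg (a : R⟦X⟧) {n : ℤ} (h : n < 0) : zcoeff a n = 0 := by
  simp [zcoeff, h]

theorem zcoeff_map {S : Type*} [CommRing S] (f : R →+* S) (a : R⟦X⟧) (n : ℤ) :
    zcoeff (PowerSeries.map f a) n = f (zcoeff a n) := by
  rw [zcoeff, zcoeff]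
  split_ifs
  · exact PowerSeries.coeff_map _ _ _
  · exact (map_zero f).symm

/-- Extension by zero to negative indices makes this recursion hold without a boundary case. The
modes of vertex operators need this, since their indices may be negative. -/
theorem zcoeff_one_sub_mul (v : R) (a : R⟦X⟧) (n : ℤ) :
    zcoeff ((1 - PowerSeries.C v * PowerSeries.X) * a) n = zcoeff a n - v * zcoeff a (n - 1) := by
  have e : (1 - PowerSeries.C v * PowerSeries.X) * a =
      a - PowerSeries.C v * (a * PowerSeries.X) := by
    ring
  rw [e]
  rcases lt_or_ge n 0 with h | h
  · rw [zcoeff_neg _ h, zcoeff_neg _ h, zcoeff_neg _ (by omega)]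
    simp
  · obtain ⟨m, rfl⟩ := Int.eq_ofNat_of_zero_le h
    rw [zcoeff_natCast, zcoeff_natCast, map_sub, PowerSeries.coeff_C_mul]
    cases m with
    | zero => simp [zcoeff]
    | succ m =>
      rw [PowerSeries.coeff_succ_mul_X]
      push_cast
      rw [add_sub_cancel_right, zcoeff_natCast]

end ZCoeff

/-- The series `∑ h_n x ^ n` of complete symmetric functions. -/
def serH : Lam⟦X⟧ := expPos (fun r => ((r : ℕ) : K)⁻¹) MvPolynomial.X

/-- The inverse of the series of complete symmetric functions, that is `∑ (-1) ^ n e_n x ^ n`. -/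
def serE : Lam⟦X⟧ := expPos (fun r => -((r : ℕ) : K)⁻¹) MvPolynomial.X

/-- The series `∏ (1 - x y_i) / (1 - t x y_i)`. -/
def serG : Lam⟦X⟧ := expPos (-gCoeff) MvPolynomial.X

/-- The series `∏ (1 - t x y_i) / (1 - x y_i)`. -/
def serQ : Lam⟦X⟧ := expPos gCoeff MvPolynomial.X

theorem serQ_mul_serG : serQ * serG = 1 := by
  rw [serQ, serG, ← expPos_mul_of_add (c'' := 0) (P'' := 0), expPos_eq_one_of_zero] <;> simp

theorem serH_mul_serE : serH * serE = 1 := by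
  rw [serH, serE, ← expPos_mul_of_add (c'' := 0) (P'' := 0), expPos_eq_one_of_zero] <;> simp

theorem gCoeff_eq (r : ℕ+) : gCoeff r = ((r : ℕ) : K)⁻¹ - t ^ (r : ℕ) * ((r : ℕ) : K)⁻¹ := by
  rw [gCoeff]
  ring

/-- This is `H(t x)`. With `serE = 1 / H` it yields the factorisation `G(x) = H(t x) / H(x)`, from
which the hook expansion is read off. -/
theorem rescale_serH : PowerSeries.rescale (algebraMap K Lam t) serH =
    expPos (fun r : ℕ+ => t ^ (r : ℕ) * ((r : ℕ) : K)⁻¹) (MvPolynomial.X : ℕ+ → Lam) := by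
  symm
  refine expSeries_eq_of_derivative (constantCoeff_positiveSeries _ _) ?_ ?_
  · rw [← PowerSeries.coeff_zero_eq_constantCoeff_apply, PowerSeries.coeff_rescale, serH,
      coeff_zero_expPos, pow_zero, one_mul]
  · have h := derivative_expSeries (constantCoeff_positiveSeries
      (fun r : ℕ+ => ((r : ℕ) : K)⁻¹) (MvPolynomial.X : ℕ+ → Lam))
    ext1 n
    have hn := congrArg (PowerSeries.coeff n) h
    rw [PowerSeries.coeff_derivative, PowerSeries.coeff_mul] at hn
    rw [PowerSeries.coeff_derivative, PowerSeries.coeff_rescale, PowerSeries.coeff_mul, mul_assoc,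
      serH, expPos, hn, Finset.mul_sum]
    refine Finset.sum_congr rfl fun p hp => ?_
    have hp := Finset.HasAntidiagonal.mem_antidiagonal.1 hp
    rw [PowerSeries.coeff_rescale, PowerSeries.coeff_derivative, PowerSeries.coeff_derivative,
      positiveSeries, positiveSeries, PowerSeries.coeff_mk, PowerSeries.coeff_mk,
      dif_pos (Nat.succ_pos _), dif_pos (Nat.succ_pos _), ← hp, mul_smul, Algebra.smul_def (t ^ _),
      map_pow]
    simp only [PNat.mk_coe]
    ring

theorem serG_eq : serG = PowerSeries.rescale (algebraMap K Lam t) serH * serE := by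
  rw [rescale_serH, serG, serE]
  refine expPos_mul_of_add fun r => ?_
  rw [← add_smul, Pi.neg_apply, gCoeff_eq]
  congr 1
  ring

/-! ### The shift `p_r ↦ p_r + ε u ^ r` -/

/-- The algebra map `f[Y] ↦ f[Y + ε u]` given by `p_r ↦ p_r + ε u ^ r`. -/
def shift (ε : K) : Lam →ₐ[K] Polynomial Lam :=
  MvPolynomial.aeval fun r : ℕ+ =>
    Polynomial.C (MvPolynomial.X r) + ε • (Polynomial.X : Polynomial Lam) ^ (r : ℕ)

theorem shift_X (ε : K) (r : ℕ+) : shift ε (MvPolynomial.X r) =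
    Polynomial.C (MvPolynomial.X r) + ε • (Polynomial.X : Polynomial Lam) ^ (r : ℕ) := by
  simp [shift]

/-- The additive shift of the power sums turns into a multiplicative factor under the exponential.
The factor contains `u` only and is rational in the cases used. -/
theorem map_shift_expPos (ε : K) (c : ℕ+ → K) :
    PowerSeries.map (shift ε : Lam →+* Polynomial Lam) (expPos c MvPolynomial.X) =
      PowerSeries.map Polynomial.C (expPos c MvPolynomial.X) *
        expPos (fun r => ε * c r) fun r => (Polynomial.X : Polynomial Lam) ^ (r : ℕ) := by
  rw [map_expPos]
  have h := map_expPos (IsScalarTower.toAlgHom K Lam (Polynomial Lam)) c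
    MvPolynomial.X
  have h2 : ((IsScalarTower.toAlgHom K Lam (Polynomial Lam)) :
      Lam →+* Polynomial Lam) = Polynomial.C := rfl
  rw [h2] at h
  rw [h]
  refine expPos_mul_of_add fun r => ?_
  rw [shift_X, smul_add, smul_smul, mul_comm (c r) ε]
  rfl

/-- The shift `p_r ↦ p_r - u ^ r`. -/
abbrev tau : Lam →ₐ[K] Polynomial Lam := shift (-1)

theorem map_tau_serH : PowerSeries.map (tau : Lam →+* Polynomial Lam) serH =
    (1 - PowerSeries.C Polynomial.X * PowerSeries.X) * PowerSeries.map Polynomial.C serH := by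
  rw [serH, map_shift_expPos, mul_comm, ← expPos_neg_pow]
  simp

theorem map_tau_serE : (1 - PowerSeries.C Polynomial.X * PowerSeries.X) *
    PowerSeries.map (tau : Lam →+* Polynomial Lam) serE = PowerSeries.map Polynomial.C serE := by
  rw [serE, map_shift_expPos, mul_left_comm]
  have := one_sub_X_mul_expPos (Polynomial.X : Polynomial Lam)
  simp only [neg_mul, one_mul, neg_neg]
  rw [this, mul_one]

theorem expPos_neg_t_pow : expPos (fun r : ℕ+ => -(t ^ (r : ℕ) * ((r : ℕ) : K)⁻¹))
      (fun r : ℕ+ => (Polynomial.X : Polynomial Lam) ^ (r : ℕ)) =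
    1 - PowerSeries.C (t • (Polynomial.X : Polynomial Lam)) * PowerSeries.X := by
  rw [← expPos_neg_pow]
  refine expPos_congr fun r => ?_
  rw [smul_pow, smul_smul]
  congr 1
  ring

/-- This is `G(x)[Y - u] = G(x) (1 - t u x) / (1 - u x)` with the denominator cleared, so that
coefficients can be compared by `zcoeff_one_sub_mul`. -/
theorem map_tau_serG : (1 - PowerSeries.C Polynomial.X * PowerSeries.X) *
    PowerSeries.map (tau : Lam →+* Polynomial Lam) serG =
      (1 - PowerSeries.C (t • Polynomial.X) * PowerSeries.X) *
        PowerSeries.map Polynomial.C serG := by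
  rw [serG, map_shift_expPos, mul_left_comm, mul_comm (1 - PowerSeries.C (t • _) * _)]
  congr 1
  rw [← expPos_neg_t_pow, expPos_mul_of_add (c := fun r : ℕ+ => ((r : ℕ) : K)⁻¹)
    (P := fun r : ℕ+ => (Polynomial.X : Polynomial Lam) ^ (r : ℕ))
    (c' := fun r : ℕ+ => -(t ^ (r : ℕ) * ((r : ℕ) : K)⁻¹))
    (P' := fun r : ℕ+ => (Polynomial.X : Polynomial Lam) ^ (r : ℕ)), ← mul_assoc,
    one_sub_X_mul_expPos, one_mul]
  intro r
  rw [← add_smul, Pi.neg_apply, gCoeff_eq]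
  congr 1
  ring

theorem map_tau_serQ : (1 - PowerSeries.C (t • Polynomial.X) * PowerSeries.X) *
    PowerSeries.map (tau : Lam →+* Polynomial Lam) serQ =
      (1 - PowerSeries.C Polynomial.X * PowerSeries.X) *
        PowerSeries.map Polynomial.C serQ := by
  have h1 : PowerSeries.map (tau : Lam →+* Polynomial Lam) serQ *
      PowerSeries.map (tau : Lam →+* Polynomial Lam) serG = 1 := by
    rw [← map_mul, serQ_mul_serG, map_one]
  have h2 : PowerSeries.map (Polynomial.C : Lam →+* Polynomial Lam) serQ *
      PowerSeries.map Polynomial.C serG = 1 := by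
    rw [← map_mul, serQ_mul_serG, map_one]
  have h3 := map_tau_serG
  set a := PowerSeries.map (tau : Lam →+* Polynomial Lam) serQ
  set b := PowerSeries.map (tau : Lam →+* Polynomial Lam) serG
  set c := PowerSeries.map (Polynomial.C : Lam →+* Polynomial Lam) serQ
  set d := PowerSeries.map (Polynomial.C : Lam →+* Polynomial Lam) serG
  calc _ = (1 - PowerSeries.C (t • Polynomial.X) * PowerSeries.X) * d * a * c := by
        rw [mul_right_comm _ d a, mul_assoc _ d c, mul_comm d c, h2, mul_one]
    _ = (1 - PowerSeries.C Polynomial.X * PowerSeries.X) * (a * b) * c := by rw [← h3]; ring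
    _ = _ := by rw [h1, mul_one]

/-- The complete symmetric function `h_n`, the coefficient of `serH`. -/
abbrev cH : ℤ → Lam := zcoeff serH
/-- The signed elementary symmetric function `(-1) ^ n e_n`. -/
abbrev cE : ℤ → Lam := zcoeff serE
/-- The coefficient of `x ^ n` in `serG`. -/
abbrev cG : ℤ → Lam := zcoeff serG
/-- The coefficient of `x ^ n` in `serQ`. -/
abbrev cQ : ℤ → Lam := zcoeff serQ

theorem cH_natCast (n : ℕ) : cH n = PowerSeries.coeff n serH := zcoeff_natCast _ _

theorem cE_natCast (n : ℕ) : cE n = PowerSeries.coeff n serE := zcoeff_natCast _ _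

theorem cG_natCast (n : ℕ) : cG n = PowerSeries.coeff n serG := zcoeff_natCast _ _

theorem cQ_natCast (n : ℕ) : cQ n = PowerSeries.coeff n serQ := zcoeff_natCast _ _

theorem tau_cH (n : ℤ) :
    tau (cH n) = Polynomial.C (cH n) - Polynomial.X * Polynomial.C (cH (n - 1)) := by
  have h := congrArg (fun a => zcoeff a n) map_tau_serH
  simp only [zcoeff_one_sub_mul, zcoeff_map] at h
  exact h

theorem tau_cE (n : ℤ) :
    tau (cE n) - Polynomial.X * tau (cE (n - 1)) = Polynomial.C (cE n) := by
  have h := congrArg (fun a => zcoeff a n) map_tau_serE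
  simp only [zcoeff_one_sub_mul, zcoeff_map] at h
  exact h

theorem tau_cG (n : ℤ) : tau (cG n) - Polynomial.X * tau (cG (n - 1)) =
    Polynomial.C (cG n) - t • Polynomial.X * Polynomial.C (cG (n - 1)) := by
  have h := congrArg (fun a => zcoeff a n) map_tau_serG
  simp only [zcoeff_one_sub_mul, zcoeff_map] at h
  exact h

theorem tau_cQ (n : ℤ) : tau (cQ n) - t • Polynomial.X * tau (cQ (n - 1)) =
    Polynomial.C (cQ n) - Polynomial.X * Polynomial.C (cQ (n - 1)) := by
  have h := congrArg (fun a => zcoeff a n) map_tau_serQ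
  simp only [zcoeff_one_sub_mul, zcoeff_map] at h
  exact h

/-! ### Vertex operators -/

/-- The `Λ`-linear map `u ^ k ↦ φ (n + k)` on `Λ[u]`. -/
def pairing (φ : ℤ → Lam) (n : ℤ) : Polynomial Lam →ₗ[Lam] Lam :=
  Polynomial.lsum fun k : ℕ => LinearMap.toSpanSingleton Lam Lam (φ (n + k))

theorem pairing_apply (φ : ℤ → Lam) (n : ℤ) (P : Polynomial Lam) :
    pairing φ n P = P.sum fun k a => a * φ (n + k) := rfl

theorem pairing_monomial (φ : ℤ → Lam) (n : ℤ) (k : ℕ) (a : Lam) :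
    pairing φ n (Polynomial.monomial k a) = a * φ (n + k) := by
  rw [pairing_apply, Polynomial.sum_monomial_index _ _ (by simp)]

theorem pairing_C_mul (φ : ℤ → Lam) (n : ℤ) (a : Lam) (P : Polynomial Lam) :
    pairing φ n (Polynomial.C a * P) = a * pairing φ n P := by
  rw [← Polynomial.smul_eq_C_mul, map_smul, smul_eq_mul]

theorem pairing_smul (φ : ℤ → Lam) (n : ℤ) (a : K) (P : Polynomial Lam) :
    pairing φ n (a • P) = a • pairing φ n P :=
  LinearMap.map_smul_of_tower _ a P

/-- Since `u` stands for `1/x`, multiplication by `u` raises the index of the mode. Identities in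
`u` become relations between neighbouring modes through this lemma. -/
theorem pairing_X_mul (φ : ℤ → Lam) (n : ℤ) (P : Polynomial Lam) :
    pairing φ n (Polynomial.X * P) = pairing φ (n + 1) P := by
  induction P using Polynomial.induction_on' with
  | add p q hp hq => rw [mul_add, map_add, map_add, hp, hq]
  | monomial k a =>
    rw [Polynomial.X_mul_monomial, pairing_monomial, pairing_monomial]
    congr 2
    push_cast
    ring

/-- The vertex operator mode `f ↦ ∑ k, φ_{n+k} f_k`, where `f[Y - u] = ∑ k, f_k u ^ k`. -/
def vertexOp (φ : ℤ → Lam) (n : ℤ) : Module.End K Lam :=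
  ((pairing φ n).restrictScalars K).comp tau.toLinearMap

theorem vertexOp_apply (φ : ℤ → Lam) (n : ℤ) (f : Lam) :
    vertexOp φ n f = pairing φ n (tau f) := rfl

/-- The exchange relation between a vertex operator and multiplication by `serG`. -/
theorem vertexOp_mul_cG (φ : ℤ → Lam) (n m : ℤ) (f : Lam) :
    vertexOp φ n (cG m * f) - vertexOp φ (n + 1) (cG (m - 1) * f) =
      cG m * vertexOp φ n f - t • (cG (m - 1) * vertexOp φ (n + 1) f) := by
  simp only [vertexOp_apply, map_mul]
  rw [← pairing_X_mul, ← pairing_X_mul, ← map_sub, ← mul_assoc, ← sub_mul, tau_cG, sub_mul,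
    map_sub, pairing_C_mul, smul_mul_assoc, smul_mul_assoc, pairing_smul,
    mul_right_comm, mul_comm _ (Polynomial.C (cG (m - 1))), pairing_C_mul]

/-- The pairing of `Λ[u][v]` with `u ^ l v ^ k ↦ φ (r + l) φ (s + k)`. -/
def pairing₂ (φ : ℤ → Lam) (r s : ℤ) : Polynomial (Polynomial Lam) →+ Lam :=
  (Polynomial.lsum fun k : ℕ =>
    (LinearMap.toSpanSingleton Lam Lam (φ (s + k))).comp (pairing φ r)).toAddMonoidHom

theorem pairing₂_monomial (φ : ℤ → Lam) (r s : ℤ) (k : ℕ) (P : Polynomial Lam) :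
    pairing₂ φ r s (Polynomial.monomial k P) = pairing φ r P * φ (s + k) := by
  change (Polynomial.lsum _) (Polynomial.monomial k P) = _
  rw [Polynomial.lsum_apply, Polynomial.sum_monomial_index _ _ (by simp)]
  rfl

theorem pairing₂_swap (φ : ℤ → Lam) (r s : ℤ) (Z : Polynomial (Polynomial Lam)) :
    pairing₂ φ r s (Polynomial.Bivariate.swap Z) = pairing₂ φ s r Z := by
  induction Z using Polynomial.induction_on' with
  | add p q hp hq => rw [map_add, map_add, map_add, hp, hq]
  | monomial k P =>
    induction P using Polynomial.induction_on' with
    | add p q hp hq => rw [map_add, map_add, map_add, map_add, hp, hq]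
    | monomial l a =>
      rw [Polynomial.Bivariate.swap_monomial_monomial, pairing₂_monomial, pairing₂_monomial,
        pairing_monomial, pairing_monomial]
      ring

theorem swap_sub_pow {R : Type*} [CommRing R] (a : R) (r : ℕ) :
    Polynomial.Bivariate.swap (Polynomial.C (Polynomial.C a) : Polynomial (Polynomial R)) +
        -(Polynomial.Bivariate.swap (Polynomial.C (Polynomial.X : Polynomial R))) ^ r +
      Polynomial.Bivariate.swap (-(Polynomial.X : Polynomial (Polynomial R)) ^ r) =
    Polynomial.C (Polynomial.C a) + -(Polynomial.C (Polynomial.X : Polynomial R)) ^ r +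
      -(Polynomial.X : Polynomial (Polynomial R)) ^ r := by
  rw [Polynomial.Bivariate.swap_C_C, Polynomial.Bivariate.swap_X, map_neg, map_pow,
    Polynomial.Bivariate.swap_Y]
  abel

/-- The double shift is `f[Y - u - v]`, which is symmetric in `u` and `v`. Both sides are algebra
maps in `f`, so power sums suffice. -/
theorem swap_map_tau_tau (f : Lam) :
    Polynomial.Bivariate.swap (Polynomial.map (tau : Lam →+* Polynomial Lam) (tau f)) =
      Polynomial.map (tau : Lam →+* Polynomial Lam) (tau f) := by
  let D : Lam →ₐ[K] Polynomial (Polynomial Lam) := (Polynomial.mapAlgHom tau).comp tau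
  have h : ((Polynomial.Bivariate.swap (R := Lam)).toAlgHom.restrictScalars K).comp D = D := by
    refine MvPolynomial.algHom_ext fun r => ?_
    simp [D, shift_X]
    exact swap_sub_pow (MvPolynomial.X r) r
  exact DFunLike.congr_fun h f

theorem pairing₂_symm (φ : ℤ → Lam) (r s : ℤ) (f : Lam) :
    pairing₂ φ r s (Polynomial.map (tau : Lam →+* Polynomial Lam) (tau f)) =
      pairing₂ φ s r (Polynomial.map (tau : Lam →+* Polynomial Lam) (tau f)) := by
  rw [← pairing₂_swap, swap_map_tau_tau]

/-- The inner mode contributes `Q(z)[Y - u]` with `u = 1/x`, and the combination on the left clears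
its denominator `1 - t u z`. What remains is the numerator `1 - u z`, paired with `f[Y - u - v]`. By
`pairing₂_symm` the right side changes sign when `r` and `s` are exchanged, and this yields the
commutation relations. -/
theorem vertexOp_cQ_comp (r s : ℤ) (f : Lam) :
    vertexOp cQ (r - 1) (vertexOp cQ s f) - t • vertexOp cQ r (vertexOp cQ (s - 1) f) =
      pairing₂ cQ (r - 1) s (Polynomial.map (tau : Lam →+* Polynomial Lam) (tau f)) -
        pairing₂ cQ r (s - 1) (Polynomial.map (tau : Lam →+* Polynomial Lam) (tau f)) := by
  simp only [vertexOp_apply]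
  generalize tau f = P
  induction P using Polynomial.induction_on' with
  | add p q hp hq =>
    simp only [map_add, Polynomial.map_add, smul_add]
    linear_combination hp + hq
  | monomial k a =>
    rw [Polynomial.map_monomial, pairing₂_monomial, pairing₂_monomial, pairing_monomial,
      pairing_monomial, map_mul tau, map_mul tau]
    have e := tau_cQ (s + k)
    rw [show s - 1 + (k : ℤ) = s + k - 1 by ring]
    -- Both terms are brought to the mode `r - 1` at the price of a factor `u`, so that `tau_cQ`
    -- applies inside one pairing.
    have e1 : pairing cQ r (tau a * tau (cQ (s + k - 1))) =
        pairing cQ (r - 1) (Polynomial.X * (tau a * tau (cQ (s + k - 1)))) := by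
      rw [pairing_X_mul, sub_add_cancel]
    rw [e1, ← pairing_smul, ← map_sub]
    have e2 : tau a * tau (cQ (s + k)) - t • (Polynomial.X * (tau a * tau (cQ (s + k - 1)))) =
        Polynomial.C (cQ (s + k)) * tau a -
          Polynomial.C (cQ (s + k - 1)) * (Polynomial.X * tau a) := by
      rw [show tau a * tau (cQ (s + k)) - t • (Polynomial.X * (tau a * tau (cQ (s + k - 1)))) =
        tau a * (tau (cQ (s + k)) - t • Polynomial.X * tau (cQ (s + k - 1))) by
          rw [mul_sub, smul_mul_assoc, mul_smul_comm, mul_left_comm], e]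
      ring
    rw [e2, map_sub, pairing_C_mul, pairing_C_mul, pairing_X_mul, sub_add_cancel]
    simp only [RingHom.coe_coe]
    rw [mul_comm, mul_comm (cQ (s + k - 1))]

/-- The commutation relations of the modes of Jing's vertex operator. -/
theorem vertexOp_cQ_relation (r s : ℤ) (f : Lam) :
    vertexOp cQ (r - 1) (vertexOp cQ s f) - t • vertexOp cQ r (vertexOp cQ (s - 1) f) =
      t • vertexOp cQ s (vertexOp cQ (r - 1) f) - vertexOp cQ (s - 1) (vertexOp cQ r f) := by
  rw [vertexOp_cQ_comp, pairing₂_symm cQ (r - 1), pairing₂_symm cQ r, ← neg_sub,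
    ← vertexOp_cQ_comp s r f, neg_sub]

/-! ### Hook functions -/

/-- Solving `tau_cE` for the shifted series gives a geometric series in `u`; each unwinding of it
moves one factor `u` into the index of the mode. -/
theorem vertexOp_cE (φ : ℤ → Lam) (n : ℤ) (b : ℕ) :
    vertexOp φ n (cE b) = ∑ l ∈ Finset.range (b + 1), φ (n + b - l) * cE l := by
  have step : ∀ (n b : ℤ), vertexOp φ n (cE b) = φ n * cE b + vertexOp φ (n + 1) (cE (b - 1)) := by
    intro n b
    rw [vertexOp_apply, vertexOp_apply, ← pairing_X_mul, ← sub_eq_iff_eq_add, ← map_sub, tau_cE,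
      ← Polynomial.monomial_zero_left, pairing_monomial, mul_comm]
    simp
  induction b generalizing n with
  | zero =>
    rw [step, show cE (((0 : ℕ) : ℤ) - 1) = 0 from zcoeff_neg _ (by simp), map_zero]
    simp
  | succ b ih =>
    rw [step, Finset.sum_range_succ, add_comm]
    push_cast
    rw [add_sub_cancel_right, ih, add_sub_cancel_right]
    congr 1
    refine Finset.sum_congr rfl fun l _ => ?_
    congr 2
    ring

theorem sum_cH_cE (n : ℕ) :
    ∑ l ∈ Finset.range (n + 2), cH ((n : ℤ) + 1 - l) * cE l = 0 := by
  have h := congrArg (PowerSeries.coeff (n + 1)) serH_mul_serE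
  rw [PowerSeries.coeff_mul, PowerSeries.coeff_one, if_neg (Nat.succ_ne_zero n),
    ← Finset.Nat.sum_antidiagonal_swap, Finset.Nat.sum_antidiagonal_eq_sum_range_succ_mk] at h
  rw [← h]
  refine Finset.sum_congr rfl fun l hl => ?_
  have hl : l < n + 2 := Finset.mem_range.1 hl
  rw [show (n : ℤ) + 1 - l = ((n + 1 - l : ℕ) : ℤ) by omega, cH_natCast, cE_natCast]
  rfl

theorem cH_zero : cH 0 = 1 := by
  rw [show (0 : ℤ) = ((0 : ℕ) : ℤ) from rfl, cH_natCast]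
  exact coeff_zero_expPos _ _

theorem cE_zero : cE 0 = 1 := by
  rw [show (0 : ℤ) = ((0 : ℕ) : ℤ) from rfl, cE_natCast]
  exact coeff_zero_expPos _ _

theorem cG_zero : cG 0 = 1 := by
  rw [show (0 : ℤ) = ((0 : ℕ) : ℤ) from rfl, cG_natCast]
  exact coeff_zero_expPos _ _

/-- The sum in `vertexOp_cE` is `H E = 1` in degree `b + 1` with one term missing. In shapes:
placing a row of length one on top of a column lengthens the column. -/
theorem vertexOp_cH_one_cE (b : ℕ) : vertexOp cH 1 (cE b) = -cE (b + 1) := by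
  have h := sum_cH_cE b
  rw [Finset.sum_range_succ] at h
  push_cast at h
  rw [sub_self, cH_zero, one_mul] at h
  rw [vertexOp_cE, add_comm (1 : ℤ)]
  exact eq_neg_of_add_eq_zero_left h

/-- After exchange of the summations, the coefficient of `c l` is the geometric sum `(t - 1) (1 + t
+ ⋯ + t ^ (n - l))`. -/
theorem sum_geometric (c : ℕ → Lam) (n : ℕ) :
    (t - 1) • ∑ b ∈ Finset.range (n + 1), t ^ (n - b) • ∑ l ∈ Finset.range (b + 1), c l =
      ∑ l ∈ Finset.range (n + 1), (t ^ (n + 1 - l) - 1) • c l := by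
  induction n with
  | zero => simp
  | succ n ih =>
    have h1 : ∑ b ∈ Finset.range (n + 1), t ^ (n + 1 - b) • ∑ l ∈ Finset.range (b + 1), c l =
        t • ∑ b ∈ Finset.range (n + 1), t ^ (n - b) • ∑ l ∈ Finset.range (b + 1), c l := by
      rw [Finset.smul_sum]
      refine Finset.sum_congr rfl fun b hb => ?_
      rw [smul_smul, ← pow_succ', show n + 1 - b = n - b + 1 by
        have := Finset.mem_range.1 hb; omega]
    have h2 : ∑ l ∈ Finset.range (n + 1), (t ^ (n + 1 + 1 - l) - 1) • c l =
        t • ∑ l ∈ Finset.range (n + 1), (t ^ (n + 1 - l) - 1) • c l +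
          (t - 1) • ∑ l ∈ Finset.range (n + 1), c l := by
      rw [Finset.smul_sum, Finset.smul_sum, ← Finset.sum_add_distrib]
      refine Finset.sum_congr rfl fun l hl => ?_
      rw [smul_smul, ← add_smul, show n + 1 + 1 - l = n + 1 - l + 1 by
        have := Finset.mem_range.1 hl; omega, pow_succ']
      congr 1
      ring
    rw [Finset.sum_range_succ, h1, smul_add, smul_comm, ih,
      Finset.sum_range_succ (fun l => (t ^ (n + 1 + 1 - l) - 1) • c l), h2, Finset.sum_range_succ c]
    rw [show n + 1 + 1 - (n + 1) = 1 by omega, pow_one]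
    simp only [Nat.sub_self, pow_zero, one_smul, smul_add, add_assoc]

/-- The expansion of `cG` into hook Schur functions. -/
theorem cG_eq_sum_hooks (n : ℕ) :
    cG (n + 1) = (t - 1) • ∑ b ∈ Finset.range (n + 1),
      t ^ (n - b) • vertexOp cH ((n : ℤ) - b + 1) (cE b) := by
  have h1 : ∀ b ∈ Finset.range (n + 1), vertexOp cH ((n : ℤ) - b + 1) (cE b) =
      ∑ l ∈ Finset.range (b + 1), cH ((n : ℤ) + 1 - l) * cE l := by
    intro b _
    rw [vertexOp_cE]
    refine Finset.sum_congr rfl fun l _ => ?_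
    congr 2
    ring
  rw [Finset.sum_congr rfl fun b hb => by rw [h1 b hb],
    sum_geometric fun l => cH ((n : ℤ) + 1 - l) * cE l]
  have h2 : cG (n + 1) = ∑ l ∈ Finset.range (n + 2),
      t ^ (n + 1 - l) • (cH ((n : ℤ) + 1 - l) * cE l) := by
    rw [show (n : ℤ) + 1 = ((n + 1 : ℕ) : ℤ) by push_cast; rfl, cG_natCast, serG_eq,
      PowerSeries.coeff_mul, ← Finset.Nat.sum_antidiagonal_swap,
      Finset.Nat.sum_antidiagonal_eq_sum_range_succ_mk]
    refine Finset.sum_congr rfl fun l hl => ?_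
    have hl : l < n + 2 := Finset.mem_range.1 hl
    rw [show ((n + 1 : ℕ) : ℤ) - l = ((n + 1 - l : ℕ) : ℤ) by omega, cH_natCast,
      cE_natCast, Algebra.smul_def]
    simp only [Prod.swap_prod_mk, PowerSeries.coeff_rescale, map_pow]
    ring
  -- Subtracting `H E = 1` in degree `n + 1` changes `t ^ (n + 1 - l)` into `t ^ (n + 1 - l) - 1`;
  -- the term `l = n + 1` then vanishes.
  rw [h2, ← sub_zero (∑ l ∈ Finset.range (n + 2), _), ← sum_cH_cE n, ← Finset.sum_sub_distrib,
    Finset.sum_range_succ]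
  simp only [sub_smul, one_smul]
  rw [add_eq_left]
  simp

/-! ### The deformed inner product and adjoints -/

theorem one_sub_t_pow_ne_zero {r : ℕ} (hr : 0 < r) : (1 : K) - t ^ r ≠ 0 := by
  intro h
  have h1 : (algebraMap (Polynomial ℂ) K) (Polynomial.X ^ r) = algebraMap _ _ 1 := by
    rw [map_pow, map_one, RatFunc.algebraMap_X]
    exact (sub_eq_zero.1 h).symm
  have h2 := congrArg (Polynomial.eval 0) (RatFunc.algebraMap_injective ℂ h1)
  simp [hr.ne'] at h2

/-- The norm `⟨p_λ, p_λ⟩_t`. -/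
def tNumber (m : ℕ+ →₀ ℕ) : K :=
  m.prod fun r k => ((r : ℕ) : K) ^ k * (k.factorial : K) * ((1 - t ^ (r : ℕ))⁻¹) ^ k

theorem tNumber_ne_zero (m : ℕ+ →₀ ℕ) : tNumber m ≠ 0 := by
  rw [tNumber, Finsupp.prod, Finset.prod_ne_zero_iff]
  intro r _
  refine mul_ne_zero (mul_ne_zero (pow_ne_zero _ ?_) ?_)
    (pow_ne_zero _ (inv_ne_zero (one_sub_t_pow_ne_zero r.pos)))
  · exact_mod_cast r.ne_zero
  · exact_mod_cast Nat.factorial_ne_zero _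

theorem tNumber_add_single (m : ℕ+ →₀ ℕ) (r : ℕ+) :
    tNumber (m + Finsupp.single r 1) =
      tNumber m * ((r : ℕ) / (1 - t ^ (r : ℕ)) * ((m r : K) + 1)) := by
  rw [tNumber, tNumber, ← Finsupp.mul_prod_erase' (m + Finsupp.single r 1) r _ (by simp),
    ← Finsupp.mul_prod_erase' m r _ (by simp), Finsupp.erase_add, Finsupp.erase_single, add_zero]
  simp only [Finsupp.add_apply, Finsupp.single_eq_same, Nat.factorial_succ]
  push_cast
  ring

/-- The power sum monomials are orthogonal and `tNumber` is their norm. Nondegeneracy and the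
adjoint of `p_r` are both read off coefficientwise. -/
theorem tForm_monomial (m : ℕ+ →₀ ℕ) (a : K) (g : Lam) :
    tForm (MvPolynomial.monomial m a) g = a * (tNumber m * MvPolynomial.coeff m g) := by
  have h1 : (MvPolynomial.monomial m a : Lam) = a • MvPolynomial.monomial m 1 := by
    rw [MvPolynomial.smul_monomial, smul_eq_mul, mul_one]
  have h2 : plethysm (MvPolynomial.monomial m 1) =
      (m.prod fun r k => ((1 - t ^ (r : ℕ))⁻¹) ^ k : K) • (MvPolynomial.monomial m 1 : Lam) := by
    rw [plethysm, MvPolynomial.aeval_monomial, map_one, one_mul, MvPolynomial.monomial_eq,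
      Finsupp.prod, Finsupp.prod, Finsupp.prod, map_one, one_mul]
    simp only [smul_pow]
    rw [Finset.prod_smul]
  have h3 : hallForm (MvPolynomial.monomial m 1) =
      zNumber m • MvPolynomial.lcoeff K m := by
    rw [hallForm]
    have := (MvPolynomial.basisMonomials ℕ+ K).constr_basis K
      (fun m => zNumber m • MvPolynomial.lcoeff K m) m
    rwa [MvPolynomial.coe_basisMonomials] at this
  rw [h1, map_smul, tForm, LinearMap.comp_apply, AlgHom.toLinearMap_apply, h2, map_smul, h3]
  simp only [LinearMap.smul_apply, smul_eq_mul, MvPolynomial.lcoeff_apply]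
  rw [tNumber, zNumber, ← mul_assoc (Finsupp.prod _ _), ← Finsupp.prod_mul]
  congr 3
  ext r k
  ring

theorem tForm_right_nondegenerate {g : Lam} (h : ∀ f, tForm f g = 0) : g = 0 := by
  ext m
  have := h (MvPolynomial.monomial m 1)
  rw [tForm_monomial, one_mul] at this
  simpa using (mul_eq_zero.1 this).resolve_left (tNumber_ne_zero m)

section Adjoint

variable {V : Type*} [AddCommGroup V] [Module K V]

theorem adjoint_unique {B : LinearMap.BilinForm K V} (hB : ∀ w, (∀ v, B v w = 0) → w = 0)
    {f g g' : Module.End K V} (h : LinearMap.IsAdjointPair B B f g)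
    (h' : LinearMap.IsAdjointPair B B f g') : g = g' := by
  ext w
  rw [← sub_eq_zero]
  refine hB _ fun v => ?_
  rw [map_sub, ← h, ← h', sub_self]

theorem adjointOp_eq {B : LinearMap.BilinForm K V} (hB : ∀ w, (∀ v, B v w = 0) → w = 0)
    {f g : Module.End K V} (h : LinearMap.IsAdjointPair B B f g) : adjointOp B f = g := by
  have hex : ∃ g : Module.End K V, LinearMap.IsAdjointPair B B f g := ⟨g, h⟩
  rw [adjointOp, dif_pos hex]
  exact adjoint_unique hB hex.choose_spec h

theorem existsUnique_adjoint {B : LinearMap.BilinForm K V} (hB : ∀ w, (∀ v, B v w = 0) → w = 0)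
    {f g : Module.End K V} (h : LinearMap.IsAdjointPair B B f g) :
    ∃! g : Module.End K V, LinearMap.IsAdjointPair B B f g :=
  ⟨g, h, fun _ h' => adjoint_unique hB h' h⟩

theorem isAdjointPair_sum {B : LinearMap.BilinForm K V} {I : Type*} (s : Finset I)
    {f g : I → Module.End K V} (h : ∀ i ∈ s, LinearMap.IsAdjointPair B B (f i) (g i)) :
    LinearMap.IsAdjointPair B B (∑ i ∈ s, f i : Module.End K V)
      (∑ i ∈ s, g i : Module.End K V) := by
  intro v w
  simp only [LinearMap.sum_apply, map_sum]
  exact Finset.sum_congr rfl fun i hi => h i hi v w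

theorem isAdjointPair_smul {B : LinearMap.BilinForm K V} (a : K) {f g : Module.End K V}
    (h : LinearMap.IsAdjointPair B B f g) :
    LinearMap.IsAdjointPair B B (a • f : Module.End K V) (a • g : Module.End K V) := by
  intro v w
  simp only [LinearMap.smul_apply, map_smul]
  rw [h v w]

/-- The exponential of a series of adjoints consists of the adjoints of the exponential. -/
theorem isAdjointPair_expSeries {B : LinearMap.BilinForm K V} {F F' : (Module.End K V)⟦X⟧}
    (h : ∀ n, LinearMap.IsAdjointPair B B (PowerSeries.coeff n F : Module.End K V)
      (PowerSeries.coeff n F' : Module.End K V))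
    (n : ℕ) : LinearMap.IsAdjointPair B B (PowerSeries.coeff n (expSeries F) : Module.End K V)
      (PowerSeries.coeff n (expSeries F') : Module.End K V) := by
  have hpow : ∀ k n, LinearMap.IsAdjointPair B B (PowerSeries.coeff n (F ^ k) : Module.End K V)
      (PowerSeries.coeff n (F' ^ k) : Module.End K V) := by
    intro k
    induction k with
    | zero =>
      intro n v w
      rw [pow_zero, pow_zero, PowerSeries.coeff_one]
      split_ifs <;> simp
    | succ k ih =>
      intro n
      -- Taking adjoints reverses products, so the new factor stands on opposite sides in the two
      -- powers.
      rw [pow_succ, pow_succ', PowerSeries.coeff_mul, PowerSeries.coeff_mul,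
        ← Finset.Nat.sum_antidiagonal_swap]
      exact isAdjointPair_sum _ fun p _ => (ih p.2).mul (h p.1)
  rw [expSeries, expSeries, PowerSeries.coeff_mk, PowerSeries.coeff_mk]
  exact isAdjointPair_sum _ fun k _ => isAdjointPair_smul _ (hpow k n)

end Adjoint

theorem isAdjointPair_pMul (r : ℕ+) : LinearMap.IsAdjointPair tForm tForm (pMul r)
    (((r : ℕ) / (1 - t ^ (r : ℕ)) : K) • (MvPolynomial.pderiv r).toLinearMap :
      Module.End K Lam) := by
  intro f g
  induction f using MvPolynomial.induction_on' with
  | add p q hp hq =>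
    rw [map_add, map_add, map_add, LinearMap.add_apply, LinearMap.add_apply, hp, hq]
  | monomial m a =>
    rw [pMul, LinearMap.mulLeft_apply, mul_comm, MvPolynomial.X, MvPolynomial.monomial_mul, mul_one,
      tForm_monomial, tForm_monomial, tNumber_add_single]
    simp only [LinearMap.smul_apply, MvPolynomial.coeff_smul, smul_eq_mul]
    have : MvPolynomial.coeff m ((MvPolynomial.pderiv r).toLinearMap g) =
        (m r + 1) * MvPolynomial.coeff (m + Finsupp.single r 1) g := by
      rw [mul_comm]
      exact MvPolynomial.coeff_pderiv _ _
    rw [this]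
    ring

theorem pAdj_eq (r : ℕ+) : pAdj r =
    ((r : ℕ) / (1 - t ^ (r : ℕ)) : K) • (MvPolynomial.pderiv r).toLinearMap :=
  adjointOp_eq (fun _ => tForm_right_nondegenerate) (isAdjointPair_pMul r)

theorem isAdjointPair_pAdj (r : ℕ+) : LinearMap.IsAdjointPair tForm tForm (pMul r) (pAdj r) := by
  rw [pAdj_eq]
  exact isAdjointPair_pMul r

/-- The operator `f ↦ f_n`, where `f[Y + ε u] = ∑ n, f_n u ^ n`. -/
def shiftCoeff (ε : K) (n : ℕ) : Module.End K Lam :=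
  ((Polynomial.lcoeff Lam n).restrictScalars K).comp (shift ε).toLinearMap

theorem shiftCoeff_apply (ε : K) (n : ℕ) (f : Lam) :
    shiftCoeff ε n f = (shift ε f).coeff n := rfl

theorem smul_leibniz {R : Type*} [CommRing R] [Algebra K R] (a : K) (x u v w z : R) :
    a • (x * u) * v + w * a • (x * z) = a • (x * (w * z + v * u)) := by
  rw [mul_add, smul_add, smul_mul_assoc, mul_smul_comm, add_comm, mul_left_comm, mul_assoc,
    mul_comm u v]

/-- The chain rule for `p_r ↦ p_r + ε u ^ r`. Only finitely many variables occur in `f`, so the sum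
over all variables may stop at any large `N`; the summation index `r` belongs to the variable
`p_{r+1}`. -/
theorem derivative_shift (ε : K) (f : Lam) : ∃ N₀ : ℕ, ∀ N ≥ N₀,
    Polynomial.derivative (shift ε f) = ∑ r ∈ Finset.range N, (((r : K) + 1) * ε) •
      (Polynomial.X ^ r * shift ε (MvPolynomial.pderiv r.succPNat f)) := by
  induction f using MvPolynomial.induction_on with
  | C a =>
    refine ⟨0, fun N _ => ?_⟩
    have h : shift ε (MvPolynomial.C a) = algebraMap K _ a := (shift ε).commutes a
    rw [h]
    simp only [MvPolynomial.pderiv_C, map_zero, mul_zero, smul_zero, Finset.sum_const_zero]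
    exact Polynomial.derivative_C
  | add p q hp hq =>
    obtain ⟨n, hn⟩ := hp
    obtain ⟨m, hm⟩ := hq
    refine ⟨max n m, fun N hN => ?_⟩
    simp only [map_add, mul_add, smul_add, Finset.sum_add_distrib]
    rw [← hn N (le_trans (le_max_left _ _) hN), ← hm N (le_trans (le_max_right _ _) hN)]
  | mul_X p k hp =>
    obtain ⟨n, hn⟩ := hp
    refine ⟨max n k, fun N hN => ?_⟩
    have hk : Polynomial.derivative (shift ε (MvPolynomial.X k)) =
        ∑ r ∈ Finset.range N, (((r : K) + 1) * ε) •
          (Polynomial.X ^ r * shift ε (MvPolynomial.pderiv r.succPNat (MvPolynomial.X k))) := by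
      rw [Finset.sum_eq_single ((k : ℕ) - 1)]
      · have hk1 : ((k : ℕ) - 1).succPNat = k := PNat.succPNat_natPred k
        rw [hk1, MvPolynomial.pderiv_X_self, map_one, mul_one, shift_X, Polynomial.derivative_add,
          Polynomial.derivative_C, zero_add, Polynomial.derivative_smul,
          Polynomial.derivative_X_pow, mul_comm _ ε, mul_smul]
        congr 1
        have hk2 : (((k : ℕ) - 1 : ℕ) : K) + 1 = ((k : ℕ) : K) := by
          exact_mod_cast congrArg (Nat.cast : ℕ → K) (Nat.sub_add_cancel k.pos)
        rw [hk2, Nat.cast_smul_eq_nsmul, nsmul_eq_mul]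
        simp
      · intro r _ hr
        rw [MvPolynomial.pderiv_X_of_ne, map_zero, mul_zero, smul_zero]
        intro h
        apply hr
        rw [h]
        simp
      · intro h
        exfalso
        have := le_trans (le_max_right _ _) hN
        have := k.pos
        simp at h
        omega
    rw [map_mul, Polynomial.derivative_mul, hn N (le_trans (le_max_left _ _) hN), hk,
      Finset.sum_mul, Finset.mul_sum, ← Finset.sum_add_distrib]
    refine Finset.sum_congr rfl fun r _ => ?_
    rw [Derivation.leibniz, map_add, smul_eq_mul, smul_eq_mul, map_mul, map_mul]
    exact smul_leibniz _ _ _ _ _ _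

/-- This is the coefficient of `u ^ n` in the chain rule. It has the shape of `expPos_recursion`
with multiplication by `p_r` replaced by `∂/∂p_r`, which is why the two families are adjoint by
induction. -/
theorem shiftCoeff_recursion (ε : K) (n : ℕ) :
    ((n : K) + 1) • shiftCoeff ε (n + 1) = ∑ p ∈ Finset.HasAntidiagonal.antidiagonal n,
      (((p.1 : K) + 1) * ε) • (shiftCoeff ε p.2 *
        (MvPolynomial.pderiv p.1.succPNat).toLinearMap : Module.End K Lam) := by
  refine LinearMap.ext fun f => ?_
  obtain ⟨N₀, hN⟩ := derivative_shift ε f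
  have h := congrArg (fun P => Polynomial.coeff P n) (hN (max N₀ (n + 1)) (le_max_left _ _))
  simp only [Polynomial.coeff_derivative, Polynomial.finsetSum_coeff, Polynomial.coeff_smul,
    Polynomial.coeff_X_pow_mul'] at h
  rw [LinearMap.smul_apply, shiftCoeff_apply, Algebra.smul_def, map_add, map_natCast, map_one,
    mul_comm, h, Finset.Nat.sum_antidiagonal_eq_sum_range_succ_mk, LinearMap.sum_apply]
  symm
  refine Finset.sum_subset_zero_on_sdiff (Finset.range_mono (le_max_right _ _)) ?_ ?_
  · intro r hr
    have : n < r := by simpa using (Finset.mem_sdiff.1 hr).2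
    rw [if_neg (by omega), smul_zero]
  · intro r hr
    have : r ≤ n := by simpa [Nat.lt_succ_iff] using hr
    rw [if_pos this]
    rfl

theorem shiftCoeff_zero (ε : K) : shiftCoeff ε 0 = 1 := by
  have h : ((Polynomial.evalRingHom (0 : Lam)).comp (shift ε : Lam →+* Polynomial Lam)) =
      RingHom.id Lam := by
    refine MvPolynomial.ringHom_ext (fun a => ?_) fun r => ?_
    · have h : shift ε (MvPolynomial.C a) = algebraMap K _ a := (shift ε).commutes a
      simp only [RingHom.comp_apply, RingHom.coe_coe, h, RingHom.id_apply]
      exact Polynomial.eval_C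
    · simp [shift_X]
  refine LinearMap.ext fun f => ?_
  rw [shiftCoeff_apply, Polynomial.coeff_zero_eq_eval_zero]
  exact DFunLike.congr_fun h f

/-- Multiplication by the coefficients of `exp (∑ r, ε (1 - t ^ r) / r * p_r x ^ r)` is adjoint to
the coefficients of the shift by `ε u`. -/
theorem isAdjointPair_expPos (ε : K) (n : ℕ) : LinearMap.IsAdjointPair tForm tForm
    (LinearMap.mulLeft K (PowerSeries.coeff n (expPos (ε • gCoeff) (MvPolynomial.X : ℕ+ → Lam))))
    (shiftCoeff ε n) := by
  induction n using Nat.strong_induction_on with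
  | _ n ih =>
    cases n with
    | zero =>
      rw [coeff_zero_expPos, shiftCoeff_zero]
      intro v w
      simp
    | succ n =>
      have hn : ((n : K) + 1) ≠ 0 := by exact_mod_cast Nat.succ_ne_zero n
      set a := expPos (ε • gCoeff) (MvPolynomial.X : ℕ+ → Lam) with ha
      have h1 : LinearMap.mulLeft K (PowerSeries.coeff (n + 1) a) = ((n : K) + 1)⁻¹ •
          ∑ p ∈ Finset.HasAntidiagonal.antidiagonal n,
            (((p.1 : K) + 1) * (ε • gCoeff) p.1.succPNat) • (pMul p.1.succPNat *
              LinearMap.mulLeft K (PowerSeries.coeff p.2 a) : Module.End K Lam) := by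
        rw [eq_inv_smul_iff₀ hn]
        refine LinearMap.ext fun f => ?_
        rw [LinearMap.smul_apply, LinearMap.mulLeft_apply, ← smul_mul_assoc, ha, expPos_recursion,
          Finset.sum_mul, LinearMap.sum_apply]
        refine Finset.sum_congr rfl fun p _ => ?_
        rw [smul_mul_assoc, mul_assoc]
        rfl
      have h2 : shiftCoeff ε (n + 1) = ((n : K) + 1)⁻¹ •
          ∑ p ∈ Finset.HasAntidiagonal.antidiagonal n,
            (((p.1 : K) + 1) * (ε • gCoeff) p.1.succPNat) • (shiftCoeff ε p.2 *
              pAdj p.1.succPNat : Module.End K Lam) := by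
        rw [eq_inv_smul_iff₀ hn, shiftCoeff_recursion]
        refine Finset.sum_congr rfl fun p _ => ?_
        rw [pAdj_eq, mul_smul_comm, smul_smul]
        congr 1
        have h3 := one_sub_t_pow_ne_zero p.1.succPNat.pos
        have h4 : ((p.1.succPNat : ℕ) : K) ≠ 0 := by exact_mod_cast p.1.succPNat.ne_zero
        rw [Pi.smul_apply, smul_eq_mul, gCoeff]
        field_simp
      rw [h1, h2]
      refine isAdjointPair_smul _ (isAdjointPair_sum _ fun p hp => isAdjointPair_smul _ ?_)
      have hp := Finset.HasAntidiagonal.mem_antidiagonal.1 hp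
      exact (isAdjointPair_pAdj _).mul (ih p.2 (by omega))

theorem coeff_expSeries_pMul (c : ℕ+ → K) (n : ℕ) :
    PowerSeries.coeff n (expSeries (positiveSeries c pMul)) =
      LinearMap.mulLeft K (PowerSeries.coeff n (expPos c (MvPolynomial.X : ℕ+ → Lam))) := by
  have h : positiveSeries c pMul = PowerSeries.map (Algebra.lmul K Lam : Lam →+* Module.End K Lam)
      (positiveSeries c MvPolynomial.X) := by
    rw [map_positiveSeries]
    rfl
  rw [h, ← map_expSeries, PowerSeries.coeff_map]
  rfl

/-- Taylor's formula obtained through duality: the left side is adjoint to an exponential of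
multiplication operators, and so is the shift, hence they agree by uniqueness of adjoints. -/
theorem coeff_expSeries_pAdj (ε : K) (n : ℕ) :
    PowerSeries.coeff n (expSeries (positiveSeries (ε • gCoeff) pAdj)) = shiftCoeff ε n := by
  refine adjoint_unique (fun _ => tForm_right_nondegenerate) ?_ (isAdjointPair_expPos ε n)
  rw [← coeff_expSeries_pMul]
  refine isAdjointPair_expSeries (fun k => ?_) n
  intro v w
  simp only [positiveSeries, PowerSeries.coeff_mk]
  split_ifs
  · exact isAdjointPair_smul _ (isAdjointPair_pAdj _) v w
  · simp

/-! ### Jacobi-Trudi determinants -/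

/-- The determinant `det (h_{a_i + j})`, with column indices `j = 0, 1, …`. -/
def jacobiTrudi (N : ℕ) (a : Fin N → ℤ) : Lam :=
  Matrix.det (Matrix.of fun i j : Fin N => cH (a i + (j : ℕ)))

/-- Since `h_k[Y - u] = h_k - u h_{k-1}`, the shift is a column operation. Adding `u` times each
column to the next turns the matrix, bordered by the row `(1, 0, …, 0)`, into one with first row
`(1, u, u ^ 2, …)` and unshifted entries below. All dependence on `u` then sits in the first row,
where the pairing replaces `u ^ j` by `h_{n+j}`. -/
theorem tau_jacobiTrudi (N : ℕ) (a : Fin N → ℤ) : tau (jacobiTrudi N a) =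
    Matrix.det (Matrix.of fun i j : Fin (N + 1) =>
      (Fin.cons (Polynomial.X ^ (j : ℕ)) (fun i => Polynomial.C (cH (a i - 1 + (j : ℕ)))) :
        Fin (N + 1) → Polynomial Lam) i) := by
  rw [Matrix.det_eq_of_forall_col_eq_smul_add_pred (B := Matrix.of fun i j : Fin (N + 1) =>
      (Fin.cons (Fin.cons 1 (fun _ => 0) : Fin (N + 1) → Polynomial Lam) (fun i =>
        (Fin.cons (Polynomial.C (cH (a i - 1))) (fun j : Fin N => tau (cH (a i + (j : ℕ)))) :
          Fin (N + 1) → Polynomial Lam)) : Fin (N + 1) → Fin (N + 1) → Polynomial Lam) i j)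
      (fun _ => Polynomial.X)]
  · rw [Matrix.det_succ_row_zero, Finset.sum_eq_single 0]
    · simp only [Fin.val_zero, pow_zero, one_mul, Matrix.of_apply, Fin.cons_zero]
      rw [jacobiTrudi, AlgHom.map_det]
      congr 1
    · intro j _ hj
      obtain ⟨j, rfl⟩ := Fin.exists_succ_eq.2 hj
      simp
    · simp
  · intro i
    refine Fin.cases ?_ (fun i => ?_) i <;> simp
  · intro i j
    refine Fin.cases ?_ (fun i => ?_) i
    · simp [pow_succ']
    · simp only [Matrix.of_apply, Fin.cons_succ]
      rw [tau_cH, Fin.val_castSucc, Fin.val_succ]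
      push_cast
      rw [show a i - 1 + ((j : ℕ) + 1 : ℤ) = a i + (j : ℕ) by ring,
        show a i - 1 + (j : ℕ) = a i + (j : ℕ) - 1 by ring]
      ring

/-- Bernstein's operators create a row in a Jacobi-Trudi determinant. -/
theorem vertexOp_jacobiTrudi (n : ℤ) (N : ℕ) (a : Fin N → ℤ) :
    vertexOp cH n (jacobiTrudi N a) = jacobiTrudi (N + 1) (Fin.cons n fun i => a i - 1) := by
  rw [vertexOp_apply, tau_jacobiTrudi, Matrix.det_succ_row_zero, jacobiTrudi,
    Matrix.det_succ_row_zero, map_sum]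
  refine Finset.sum_congr rfl fun j _ => ?_
  simp only [Matrix.of_apply, Fin.cons_zero]
  have h : ((Matrix.of fun i j : Fin (N + 1) =>
      (Fin.cons (Polynomial.X ^ (j : ℕ)) (fun i => Polynomial.C (cH (a i - 1 + (j : ℕ)))) :
        Fin (N + 1) → Polynomial Lam) i).submatrix Fin.succ j.succAbove).det =
      Polynomial.C (((Matrix.of fun i j : Fin (N + 1) => cH ((Fin.cons n fun i => a i - 1 :
        Fin (N + 1) → ℤ) i + (j : ℕ))).submatrix Fin.succ j.succAbove).det) := by
    rw [RingHom.map_det]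
    congr 1
  rw [h, show (-1 : Polynomial Lam) ^ (j : ℕ) = Polynomial.C ((-1) ^ (j : ℕ)) by simp,
    mul_right_comm, ← Polynomial.C_mul, pairing_C_mul, Polynomial.X_pow_eq_monomial,
    pairing_monomial, one_mul, mul_right_comm]

/-- Expanding along row `k` and along row `0` produces the same minors; the expansion signs differ
by `(-1) ^ k`. -/
theorem jacobiTrudi_insertNth (N : ℕ) (k : Fin (N + 1)) (n : ℤ) (a : Fin N → ℤ) :
    jacobiTrudi (N + 1) (k.insertNth n a : Fin (N + 1) → ℤ) =
      (-1) ^ (k : ℕ) * jacobiTrudi (N + 1) (Fin.cons n a) := by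
  rw [jacobiTrudi, jacobiTrudi, Matrix.det_succ_row _ k, Matrix.det_succ_row_zero, Finset.mul_sum]
  refine Finset.sum_congr rfl fun j _ => ?_
  rw [pow_add, mul_assoc, mul_assoc, mul_assoc]
  congr 2
  simp only [Matrix.of_apply, Fin.insertNth_apply_same, Fin.cons_zero]
  congr 2
  ext i l
  simp

theorem jacobiTrudi_eq_zero {N : ℕ} {a : Fin N → ℤ} {i j : Fin N} (hij : i ≠ j) (h : a i = a j) :
    jacobiTrudi N a = 0 :=
  Matrix.det_zero_of_row_eq hij (by ext l; simp [h])

/-- The added last row is `(0, …, 0, 1)`. Schur functions can hence be computed by determinants of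
any sufficiently large size. -/
theorem jacobiTrudi_succ (N : ℕ) (a : ℕ → ℤ) (h : a N = -N) :
    jacobiTrudi (N + 1) (fun j => a j) = jacobiTrudi N fun j => a j := by
  rw [jacobiTrudi, Matrix.det_succ_row _ (Fin.last N), Finset.sum_eq_single (Fin.last N)]
  · simp only [Matrix.of_apply, Fin.val_last, h, neg_add_cancel, cH_zero, mul_one]
    rw [← two_mul, pow_mul, neg_one_sq, one_pow, one_mul, jacobiTrudi]
    congr 1
    ext i j
    simp
  · intro j _ hj
    have hj : (j : ℕ) < N := Fin.val_lt_last hj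
    simp only [Matrix.of_apply, Fin.val_last, h]
    rw [show cH (-(N : ℤ) + (j : ℕ)) = 0 from zcoeff_neg _ (by omega)]
    simp
  · simp

theorem schur_eq_jacobiTrudi (lam : YoungDiagram) {N : ℕ} (hN : lam.rowLen N = 0) :
    schur lam = jacobiTrudi N fun j => (lam.rowLen j : ℤ) - (j : ℕ) := by
  have h1 : lam.colLen 0 ≤ N := by
    by_contra hc
    have := YoungDiagram.mem_iff_lt_rowLen.1 (YoungDiagram.mem_iff_lt_colLen.2 (not_le.1 hc))
    omega
  clear hN
  induction N, h1 using Nat.le_induction with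
  | base => rfl
  | succ N hN ih =>
    rw [ih, jacobiTrudi_succ N (fun j => (lam.rowLen j : ℤ) - j)]
    rw [maya_rowLen_zero lam hN]
    simp

/-! ### Fermions -/

/-- The fermion creation operator `ψ_i⁺` at `t = 1`. -/
def fermion (i : ℤ) : Module.End K Fock :=
  Finsupp.linearCombination K fun σ : Maya =>
    if σ.val i = false then Finsupp.single (σ.set i true) ((-1) ^ σ.onesAbove i) else 0

theorem fermion_single (i : ℤ) (σ : Maya) : fermion i (Finsupp.single σ 1) =
    if σ.val i = false then Finsupp.single (σ.set i true) ((-1) ^ σ.onesAbove i) else 0 := by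
  rw [fermion, Finsupp.linearCombination_single, one_smul]

/-- The bosonic form of the fermion creation operator. -/
def bosonFermion (i : ℤ) : Module.End K Boson :=
  Finsupp.lsum K fun c : ℤ => (Finsupp.lsingle (c + 1)).comp (vertexOp cH (i - c - 1))

theorem bosonFermion_single (i c : ℤ) (f : Lam) : bosonFermion i (Finsupp.single c f) =
    Finsupp.single (c + 1) (vertexOp cH (i - c - 1) f) := by
  simp [bosonFermion]

theorem iota_ofPartition (lam : YoungDiagram) (c : ℤ) :
    iota (Finsupp.single (Maya.ofPartition lam c) 1) = Finsupp.single c (schur lam) := by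
  have h : mayaEquiv.symm (Maya.ofPartition lam c) = (lam, c) :=
    mayaEquiv.symm_apply_apply (lam, c)
  rw [iota, Finsupp.linearCombination_single, one_smul, h]

theorem schur_bot : schur ⊥ = 1 := by
  have h : (⊥ : YoungDiagram).rowLen 0 = 0 := by
    by_contra h
    have := YoungDiagram.mem_iff_lt_rowLen.2 (Nat.pos_of_ne_zero h)
    exact absurd this (by simp)
  rw [schur_eq_jacobiTrudi ⊥ h, jacobiTrudi, Matrix.det_fin_zero]

theorem iota_vacuum (c : ℤ) :
    iota (Finsupp.single (Maya.ofPartition ⊥ c) 1) = Finsupp.single c 1 := by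
  rw [iota_ofPartition, schur_bot]

/-- The positions of the ones of the Maya diagram `σ(λ, c)`, in decreasing order. -/
def mayaPos (lam : YoungDiagram) (c : ℤ) (j : ℕ) : ℤ := c + (lam.rowLen j : ℤ) - j

theorem mayaPos_strictAnti (lam : YoungDiagram) (c : ℤ) : StrictAnti (mayaPos lam c) := by
  intro i j hij
  have := lam.rowLen_anti i j hij.le
  simp only [mayaPos]
  omega

theorem range_mayaPos (lam : YoungDiagram) (c : ℤ) :
    Set.range (mayaPos lam c) = {i | (Maya.ofPartition lam c).val i = true} := by
  ext i
  rw [Set.mem_range, Set.mem_ofPred_eq, maya_val_eq_true_iff]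
  refine exists_congr fun j => ?_
  rw [mayaPos]
  constructor <;> intro h <;> omega

theorem mayaPos_of_le (lam : YoungDiagram) (c : ℤ) {j : ℕ} (h : lam.colLen 0 ≤ j) :
    mayaPos lam c j = c - j := by
  rw [mayaPos, maya_rowLen_zero lam h]
  simp

/-- The slot at which `i` enters the decreasing list of ones is also the exponent of the fermionic
sign. -/
theorem exists_mayaPos_index (lam : YoungDiagram) (c i : ℤ) :
    ∃ k : ℕ, (∀ j, j < k ↔ i < mayaPos lam c j) ∧
      (Maya.ofPartition lam c).onesAbove i = k := by
  have hex : ∃ j, mayaPos lam c j ≤ i := by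
    refine ⟨max (lam.colLen 0) (c - i).toNat, ?_⟩
    rw [mayaPos_of_le _ _ (le_max_left _ _)]
    omega
  classical
  have hk : ∀ j, j < Nat.find hex ↔ i < mayaPos lam c j := by
    intro j
    rw [Nat.lt_find_iff]
    refine ⟨fun h => not_le.1 (h j le_rfl), fun h m hm => not_le.2 ?_⟩
    exact lt_of_lt_of_le h ((mayaPos_strictAnti lam c).antitone hm)
  refine ⟨Nat.find hex, hk, ?_⟩
  have : {j : ℤ | i < j ∧ (Maya.ofPartition lam c).val j = true} =
      mayaPos lam c '' Set.Iio (Nat.find hex) := by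
    ext j
    have h1 : (Maya.ofPartition lam c).val j = true ↔ j ∈ Set.range (mayaPos lam c) := by
      rw [range_mayaPos]
      rfl
    rw [Set.mem_ofPred_eq, h1]
    constructor
    · rintro ⟨h, m, rfl⟩
      exact ⟨m, (hk m).2 h, rfl⟩
    · rintro ⟨m, hm, rfl⟩
      exact ⟨(hk m).1 hm, m, rfl⟩
  rw [Maya.onesAbove, this, Set.ncard_image_of_injective _ (mayaPos_strictAnti lam c).injective,
    ← Finset.coe_Iio, Set.ncard_coe_finset, Nat.card_Iio]

/-- Bernstein's operator puts the row for position `i` on top of the Jacobi-Trudi determinant. If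
`i` is free, moving this row to its place in decreasing order costs `(-1) ^ k`, with `k` the number
of ones to the right of `i`: this is the fermionic sign. If `i` is occupied, two rows agree and both
sides vanish. -/
theorem iota_fermion_single (i : ℤ) (σ : Maya) :
    iota (fermion i (Finsupp.single σ 1)) = bosonFermion i (iota (Finsupp.single σ 1)) := by
  obtain ⟨⟨lam, c⟩, rfl⟩ := mayaEquiv.surjective σ
  change iota (fermion i (Finsupp.single (Maya.ofPartition lam c) 1)) =
    bosonFermion i (iota (Finsupp.single (Maya.ofPartition lam c) 1))
  obtain ⟨k, hk, hk'⟩ := exists_mayaPos_index lam c i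
  -- Large enough for all parts of `lam`, and for every one from index `N` on to lie strictly to the
  -- left of `i`.
  set N := max (lam.colLen 0) (c - i + 1).toNat with hN
  have hN1 : lam.colLen 0 ≤ N := le_max_left _ _
  have hNi : ∀ j ≥ N, mayaPos lam c j < i := by
    intro j hj
    rw [mayaPos_of_le _ _ (hN1.trans hj)]
    omega
  have hkN : k ≤ N := by
    by_contra hc
    have := (hk N).1 (by omega)
    have := hNi N le_rfl
    omega
  rw [iota_ofPartition, bosonFermion_single, schur_eq_jacobiTrudi lam (maya_rowLen_zero lam hN1),
    vertexOp_jacobiTrudi, fermion_single]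
  split_ifs with hv
  · obtain ⟨⟨mu, d⟩, hmu⟩ := mayaEquiv.surjective ((Maya.ofPartition lam c).set i true)
    replace hmu : Maya.ofPartition mu d = (Maya.ofPartition lam c).set i true := hmu
    have hi : ∀ j, mayaPos lam c j ≠ i := by
      intro j hj
      have : i ∈ Set.range (mayaPos lam c) := ⟨j, hj⟩
      rw [range_mayaPos, Set.mem_ofPred_eq, hv] at this
      simp at this
    -- The decreasing list of ones with `i` inserted at slot `k`. Its monotonicity identifies it
    -- with the list `mayaPos mu d` of the new diagram.
    let b : ℕ → ℤ := fun j =>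
      if j < k then mayaPos lam c j else if j = k then i else mayaPos lam c (j - 1)
    have hb : StrictAnti b := by
      refine strictAnti_nat_of_succ_lt fun j => ?_
      have h1 := (hk j).1
      have h2 : k ≤ j → mayaPos lam c j < i := fun h =>
        lt_of_le_of_ne (not_lt.1 fun hc => by have := (hk j).2 hc; omega) (hi j)
      have h3 := mayaPos_strictAnti lam c (Nat.lt_succ_self j)
      have h4 : k < j → mayaPos lam c j < mayaPos lam c (j - 1) := fun h =>
        mayaPos_strictAnti lam c (by omega)
      simp only [b, Nat.add_sub_cancel]
      simp only [Nat.succ_eq_add_one] at h3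
      split_ifs <;> omega
    have hrange : Set.range b = Set.range (mayaPos mu d) := by
      rw [range_mayaPos, hmu]
      ext l
      have h1 : (Maya.ofPartition lam c).val l = true ↔ l ∈ Set.range (mayaPos lam c) := by
        rw [range_mayaPos]
        rfl
      have h2 : ((Maya.ofPartition lam c).set i true).val l = true ↔
          l = i ∨ l ∈ Set.range (mayaPos lam c) := by
        rw [← h1]
        change Function.update (Maya.ofPartition lam c).val i true l = true ↔ _
        by_cases hl : l = i
        · simp [hl]
        · simp [hl]
      rw [Set.mem_ofPred_eq, h2]
      constructor
      · rintro ⟨j, rfl⟩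
        simp only [b]
        split_ifs
        · exact Or.inr ⟨_, rfl⟩
        · exact Or.inl rfl
        · exact Or.inr ⟨_, rfl⟩
      · rintro (rfl | ⟨j, rfl⟩)
        · exact ⟨k, by simp [b]⟩
        · by_cases hj : j < k
          · exact ⟨j, by simp [b, hj]⟩
          · refine ⟨j + 1, ?_⟩
            simp only [b, Nat.add_sub_cancel]
            rw [if_neg (by omega), if_neg (by omega)]
    have hbm : b = mayaPos mu d := (StrictMono.range_inj (γ := ℤᵒᵈ) hb.dual_right
      (mayaPos_strictAnti mu d).dual_right).1 hrange
    have hlarge : ∀ j ≥ N + 1, mayaPos mu d j = c + 1 - j := by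
      intro j hj
      rw [← hbm]
      simp only [b]
      rw [if_neg (by omega), if_neg (by omega), mayaPos_of_le _ _ (by omega)]
      omega
    have hd : d = c + 1 := by
      have h1 := hlarge (max (N + 1) (mu.colLen 0)) (le_max_left _ _)
      rw [mayaPos_of_le _ _ (le_max_right _ _)] at h1
      omega
    have hmuN : mu.rowLen (N + 1) = 0 := by
      have h1 := hlarge (N + 1) le_rfl
      rw [mayaPos, hd] at h1
      omega
    rw [← hmu, hk', show Finsupp.single (Maya.ofPartition mu d) ((-1 : K) ^ k) =
      ((-1 : K) ^ k) • Finsupp.single (Maya.ofPartition mu d) 1 by simp, map_smul,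
      iota_ofPartition, schur_eq_jacobiTrudi mu hmuN, hd, Finsupp.smul_single]
    congr 1
    have h5 : (fun j : Fin (N + 1) => (mu.rowLen j : ℤ) - (j : ℕ)) =
        ((⟨k, by omega⟩ : Fin (N + 1)).insertNth (i - c - 1)
          (fun j : Fin N => (lam.rowLen j : ℤ) - (j : ℕ) - 1) : Fin (N + 1) → ℤ) := by
      have h6 : ∀ j, (mu.rowLen j : ℤ) - j = b j - c - 1 := by
        intro j
        rw [hbm, mayaPos, hd]
        ring
      rw [Fin.eq_insertNth_iff]
      constructor
      · rw [h6]
        simp [b]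
      · ext j
        rw [Fin.removeNth, h6]
        by_cases hj : (j : ℕ) < k
        · rw [Fin.succAbove_of_castSucc_lt _ _ (by simpa [Fin.lt_def] using hj)]
          simp only [b, Fin.val_castSucc, if_pos hj, mayaPos]
          ring
        · rw [Fin.succAbove_of_le_castSucc _ _ (by simpa [Fin.le_def] using hj)]
          simp only [b, Fin.val_succ, Nat.add_sub_cancel]
          rw [if_neg (by omega), if_neg (by omega), mayaPos]
          ring
    rw [h5, jacobiTrudi_insertNth, Algebra.smul_def, ← mul_assoc]
    simp only [map_pow, map_neg, map_one]
    rw [← mul_pow, neg_one_mul, neg_neg, one_pow, one_mul]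
  · rw [map_zero]
    symm
    have hi : i ∈ Set.range (mayaPos lam c) := by
      rw [range_mayaPos, Set.mem_ofPred_eq]
      simpa using hv
    obtain ⟨j, hj⟩ := hi
    have hjN : j < N := by
      by_contra hc
      have := hNi j (not_lt.1 hc)
      omega
    rw [jacobiTrudi_eq_zero (i := 0) (j := Fin.succ ⟨j, hjN⟩) (Fin.succ_ne_zero _).symm,
      Finsupp.single_zero]
    rw [Fin.cons_zero, Fin.cons_succ, ← hj, mayaPos]
    ring

theorem iota_fermion (i : ℤ) (v : Fock) : iota (fermion i v) = bosonFermion i (iota v) := by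
  have h : iota ∘ₗ fermion i = bosonFermion i ∘ₗ iota :=
    Finsupp.lhom_ext' fun σ => LinearMap.ext_ring (iota_fermion_single i σ)
  exact LinearMap.congr_fun h v

/-! ### Row configurations -/

/-- The scalar weight of a vertex with left, upper and right edge values `W`, `N`, `E`, whose lower
edge value is then determined. -/
def edgeWeight : Bool → Bool → Bool → K
  | _, false, false => 1
  | false, true, false => 1
  | true, true, false => 0
  | false, false, true => 0
  | true, false, true => t
  | false, true, true => t - 1
  | true, true, true => -1

/-- The value of the horizontal edge `i` in the configuration `e`. -/
def edgeBit (e : Finset ℤ) (i : ℤ) : Bool := decide (i ∈ e)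

/-- The weight at position `i` of the row configuration `e` below `σ`. -/
def siteWeight (e : Finset ℤ) (σ : Maya) (i : ℤ) : K :=
  edgeWeight (edgeBit e (i - 1)) (σ.val i) (edgeBit e i)

/-- The weight of the row configuration `e` below `σ`. -/
def rowWeight (e : Finset ℤ) (σ : Maya) : K := ∏ᶠ i : ℤ, siteWeight e σ i

theorem edgeWeight_false_false (N : Bool) : edgeWeight false N false = 1 := by
  cases N <;> rfl

theorem edgeBit_eq_false {e : Finset ℤ} {i : ℤ} (h : i ∉ e) : edgeBit e i = false :=
  decide_eq_false h

theorem edgeBit_eq_true {e : Finset ℤ} {i : ℤ} (h : i ∈ e) : edgeBit e i = true :=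
  decide_eq_true h

theorem mulSupport_siteWeight (e : Finset ℤ) (σ : Maya) :
    (Function.mulSupport (siteWeight e σ)).Finite := by
  refine (e.finite_toSet.union (e.finite_toSet.image (· + 1))).subset fun i hi => ?_
  by_contra hc
  simp only [Set.mem_union, Finset.mem_coe, Set.mem_image, not_or, not_exists, not_and] at hc
  apply hi
  rw [siteWeight, edgeBit_eq_false hc.1, edgeBit_eq_false fun h => hc.2 _ h (by ring),
    edgeWeight_false_false]

/-- The lower edge values of the row configuration `e` with upper edge values `σ`. -/
def rowOut (e : Finset ℤ) (σ : Maya) : Maya where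
  val := fun i => ((edgeBit e (i - 1)).xor (σ.val i)).xor (edgeBit e i)
  left_one := by
    obtain ⟨a, ha⟩ := σ.left_one
    obtain ⟨b, hb⟩ := e.bddBelow
    refine ⟨min a (b - 1), fun i hi => ?_⟩
    rw [edgeBit_eq_false fun h => ?_, edgeBit_eq_false fun h => ?_, ha i (by omega)]
    · rfl
    · have := hb h
      omega
    · have := hb h
      omega
  right_zero := by
    obtain ⟨a, ha⟩ := σ.right_zero
    obtain ⟨b, hb⟩ := e.bddAbove
    refine ⟨max a (b + 2), fun i hi => ?_⟩
    rw [edgeBit_eq_false fun h => ?_, edgeBit_eq_false fun h => ?_, ha i (by omega)]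
    · rfl
    · have := hb h
      omega
    · have := hb h
      omega

theorem rowOut_val (e : Finset ℤ) (σ : Maya) (i : ℤ) :
    (rowOut e σ).val i = ((edgeBit e (i - 1)).xor (σ.val i)).xor (edgeBit e i) := rfl

/-- The operator given by a single row configuration. -/
def edgeOp (e : Finset ℤ) : Module.End K Fock :=
  Finsupp.linearCombination K fun σ : Maya => Finsupp.single (rowOut e σ) (rowWeight e σ)

theorem edgeOp_single (e : Finset ℤ) (σ : Maya) (a : K) :
    edgeOp e (Finsupp.single σ a) = Finsupp.single (rowOut e σ) (a * rowWeight e σ) := by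
  rw [edgeOp, Finsupp.linearCombination_single, Finsupp.smul_single, smul_eq_mul]

/-! ### Counting ones -/

theorem Maya.finite_onesAbove (σ : Maya) (i : ℤ) : {j : ℤ | i < j ∧ σ.val j = true}.Finite := by
  obtain ⟨b, hb⟩ := σ.right_zero
  refine (Set.finite_Ioo i b).subset fun j hj => ⟨hj.1, ?_⟩
  by_contra hc
  have h := hj.2
  rw [hb j (by omega)] at h
  simp at h

theorem Maya.onesAbove_eq (σ : Maya) (i : ℤ) :
    σ.onesAbove i = σ.onesAbove (i + 1) + if σ.val (i + 1) = true then 1 else 0 := by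
  rw [Maya.onesAbove, Maya.onesAbove]
  split_ifs with h
  · rw [← Set.ncard_insert_of_notMem _ (σ.finite_onesAbove (i + 1))]
    · congr 1
      ext j
      simp only [Set.mem_ofPred_eq, Set.mem_insert_iff]
      constructor
      · rintro ⟨h1, h2⟩
        by_cases hj : j = i + 1
        · exact Or.inl hj
        · exact Or.inr ⟨by omega, h2⟩
      · rintro (rfl | ⟨h1, h2⟩)
        · exact ⟨by omega, h⟩
        · exact ⟨by omega, h2⟩
    · simp
  · rw [add_zero]
    congr 1
    ext j
    simp only [Set.mem_ofPred_eq]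
    refine ⟨fun ⟨h1, h2⟩ => ⟨?_, h2⟩, fun ⟨h1, h2⟩ => ⟨by omega, h2⟩⟩
    by_contra hc
    have : j = i + 1 := by omega
    rw [this] at h2
    exact h h2

theorem Maya.onesAbove_congr {σ τ : Maya} {i : ℤ} (h : ∀ j, i < j → σ.val j = τ.val j) :
    σ.onesAbove i = τ.onesAbove i := by
  rw [Maya.onesAbove, Maya.onesAbove]
  congr 1
  ext j
  simp only [Set.mem_ofPred_eq]
  exact and_congr_right fun hj => by rw [h j hj]

theorem Maya.onesAbove_eq_zero {σ : Maya} {i : ℤ} (h : ∀ j, i < j → σ.val j = false) :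
    σ.onesAbove i = 0 := by
  rw [Maya.onesAbove, Set.ncard_eq_zero (σ.finite_onesAbove i)]
  ext j
  simp only [Set.mem_ofPred_eq, Set.mem_empty_iff_false, iff_false, not_and]
  intro hj
  rw [h j hj]
  simp

/-- The sign `-1` for the letter one and `1` for the letter zero. -/
def bitSign (b : Bool) : K := if b = true then -1 else 1

theorem neg_one_pow_onesAbove (σ : Maya) (i : ℤ) :
    (-1 : K) ^ σ.onesAbove i = (-1) ^ σ.onesAbove (i + 1) * bitSign (σ.val (i + 1)) := by
  rw [σ.onesAbove_eq i, bitSign]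
  split_ifs
  · rw [pow_succ]
  · rw [add_zero, mul_one]

theorem bitSign_xor (a b : Bool) : bitSign (a.xor b) = bitSign a * bitSign b := by
  cases a <;> cases b <;> simp [bitSign]

/-- Conservation of flux: the letters to the right of `i` change in total only by what enters
through the horizontal edge `i`. The induction runs leftwards from a point where everything is zero.
-/
theorem neg_one_pow_onesAbove_rowOut (e : Finset ℤ) (σ : Maya) (i : ℤ) :
    (-1 : K) ^ (rowOut e σ).onesAbove i = (-1) ^ σ.onesAbove i * bitSign (edgeBit e i) := by
  obtain ⟨a, ha⟩ := σ.right_zero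
  obtain ⟨a', ha'⟩ := (rowOut e σ).right_zero
  obtain ⟨b, hb⟩ := e.bddAbove
  have main : ∀ n : ℕ, ∀ i : ℤ, max (max a a') (b + 1) ≤ i + n →
      (-1 : K) ^ (rowOut e σ).onesAbove i = (-1) ^ σ.onesAbove i * bitSign (edgeBit e i) := by
    intro n
    induction n with
    | zero =>
      intro i hi
      rw [Maya.onesAbove_eq_zero fun j hj => ha' j (by omega),
        Maya.onesAbove_eq_zero fun j hj => ha j (by omega), edgeBit_eq_false fun h => ?_]
      · simp [bitSign]
      · have := hb h
        omega
    | succ n ih =>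
      intro i hi
      have hsq : bitSign (edgeBit e (i + 1)) * bitSign (edgeBit e (i + 1)) = 1 := by
        rw [bitSign]
        split_ifs <;> simp
      rw [neg_one_pow_onesAbove, neg_one_pow_onesAbove σ, ih (i + 1) (by push_cast at hi; omega),
        rowOut_val, bitSign_xor, bitSign_xor, add_sub_cancel_right]
      linear_combination ((-1 : K) ^ σ.onesAbove (i + 1) * bitSign (edgeBit e i) *
        bitSign (σ.val (i + 1))) * hsq
  exact main (max (max a a') (b + 1) - i).toNat i (by omega)

/-! ### Exchange relations of row configurations and fermions -/

theorem Maya.set_val (σ : Maya) (i : ℤ) (b : Bool) (j : ℤ) :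
    (σ.set i b).val j = if j = i then b else σ.val j := by
  change Function.update σ.val i b j = _
  rw [Function.update_apply]

theorem finprod_eq_prod_mul {M : Type*} [CommMonoid M] (s : Finset ℤ) {f : ℤ → M}
    (hf : (Function.mulSupport f).Finite) :
    ∏ᶠ i, f i = (∏ i ∈ s, f i) * ∏ᶠ i, if i ∈ s then 1 else f i := by
  have h1 : ∏ i ∈ s, f i = ∏ᶠ i, if i ∈ s then f i else 1 := by
    rw [finprod_eq_prod_of_mulSupport_subset (s := s)]
    · exact Finset.prod_congr rfl fun i hi => by rw [if_pos hi]
    · intro i hi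
      by_contra hc
      exact hi (if_neg hc)
  rw [h1, ← finprod_mul_distrib]
  · refine finprod_congr fun i => ?_
    split_ifs <;> simp
  · refine s.finite_toSet.subset fun i hi => ?_
    by_contra hc
    exact hi (if_neg hc)
  · refine hf.subset fun i hi => ?_
    intro hc
    apply hi
    simp [hc]

section Exchange

variable (e₀ : Finset ℤ) (σ : Maya) (i : ℤ)

/-- The contribution to the weight of the sites other than `i` and `i + 1`. -/
def restWeight : K := ∏ᶠ j : ℤ, if j ∈ ({i, i + 1} : Finset ℤ) then 1 else siteWeight e₀ σ j

/-- The lower edge values with prescribed letters at `i` and `i + 1`. -/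
def modOut (x y : Bool) : Maya := ((rowOut e₀ σ).set i x).set (i + 1) y

variable {e₀ σ i} {e : Finset ℤ} {σ' : Maya}

/-- Only the vertices `i` and `i + 1` touch the edge `i`. Keeping `e₀` as a reference makes the
remaining factor the same for `e` and `insert i e` and for all changes of the two letters, so that
exchange relations reduce to a finite check. -/
theorem rowWeight_eq_rest (he : ∀ j, j ≠ i → edgeBit e j = edgeBit e₀ j)
    (hσ : ∀ j, j ≠ i → j ≠ i + 1 → σ'.val j = σ.val j) :
    rowWeight e σ' = edgeWeight (edgeBit e₀ (i - 1)) (σ'.val i) (edgeBit e i) *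
      edgeWeight (edgeBit e i) (σ'.val (i + 1)) (edgeBit e₀ (i + 1)) * restWeight e₀ σ i := by
  rw [rowWeight, finprod_eq_prod_mul {i, i + 1} (mulSupport_siteWeight e σ'),
    Finset.prod_pair (by omega), restWeight]
  congr 1
  · rw [siteWeight, siteWeight, add_sub_cancel_right, he (i - 1) (by omega),
      he (i + 1) (by omega)]
  · refine finprod_congr fun j => ?_
    split_ifs with hj
    · rfl
    · simp only [Finset.mem_insert, Finset.mem_singleton, not_or] at hj
      rw [siteWeight, siteWeight, he j hj.1, he (j - 1) (by omega), hσ j hj.1 hj.2]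

theorem rowOut_eq_modOut (he : ∀ j, j ≠ i → edgeBit e j = edgeBit e₀ j)
    (hσ : ∀ j, j ≠ i → j ≠ i + 1 → σ'.val j = σ.val j) :
    rowOut e σ' = modOut e₀ σ i (((edgeBit e₀ (i - 1)).xor (σ'.val i)).xor (edgeBit e i))
      (((edgeBit e i).xor (σ'.val (i + 1))).xor (edgeBit e₀ (i + 1))) := by
  ext j
  rw [modOut, Maya.set_val, Maya.set_val, rowOut_val]
  split_ifs with h1 h2
  · rw [h1, add_sub_cancel_right, he (i + 1) (by omega)]
  · rw [h2, he (i - 1) (by omega)]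
  · rw [rowOut_val, he j h2, he (j - 1) (by omega), hσ j h2 h1]

theorem modOut_set_left (x y b : Bool) : (modOut e₀ σ i x y).set i b = modOut e₀ σ i b y := by
  ext j
  simp only [modOut, Maya.set_val]
  split_ifs <;> first | rfl | omega

theorem modOut_set_right (x y b : Bool) :
    (modOut e₀ σ i x y).set (i + 1) b = modOut e₀ σ i x b := by
  ext j
  simp only [modOut, Maya.set_val]
  split_ifs <;> rfl

theorem modOut_val_left (x y : Bool) : (modOut e₀ σ i x y).val i = x := by
  simp [modOut, Maya.set_val]

theorem modOut_val_right (x y : Bool) : (modOut e₀ σ i x y).val (i + 1) = y := by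
  simp [modOut, Maya.set_val]

/-- The basis vector of a Maya diagram. -/
def mayaVec (τ : Maya) : Fock := Finsupp.single τ 1

theorem edgeOp_fermion_left (he : ∀ j, j ≠ i → edgeBit e j = edgeBit e₀ j) :
    edgeOp e (fermion i (Finsupp.single σ 1)) = if σ.val i = false then
      ((-1) ^ σ.onesAbove (i + 1) * bitSign (σ.val (i + 1)) *
          (edgeWeight (edgeBit e₀ (i - 1)) true (edgeBit e i) *
            edgeWeight (edgeBit e i) (σ.val (i + 1)) (edgeBit e₀ (i + 1)) * restWeight e₀ σ i)) •
        mayaVec (modOut e₀ σ i (((edgeBit e₀ (i - 1)).xor true).xor (edgeBit e i))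
        (((edgeBit e i).xor (σ.val (i + 1))).xor (edgeBit e₀ (i + 1))))
      else 0 := by
  rw [fermion_single]
  split_ifs with h
  · have hσ : ∀ j, j ≠ i → j ≠ i + 1 → (σ.set i true).val j = σ.val j := fun j h1 _ => by
      rw [Maya.set_val, if_neg h1]
    rw [edgeOp_single, rowOut_eq_modOut he hσ, rowWeight_eq_rest he hσ, neg_one_pow_onesAbove,
      Maya.set_val, Maya.set_val, if_pos rfl, if_neg (by omega), mayaVec, Finsupp.smul_single_one]
  · exact map_zero _

theorem edgeOp_fermion_right (he : ∀ j, j ≠ i → edgeBit e j = edgeBit e₀ j) :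
    edgeOp e (fermion (i + 1) (Finsupp.single σ 1)) = if σ.val (i + 1) = false then
      ((-1) ^ σ.onesAbove (i + 1) * (edgeWeight (edgeBit e₀ (i - 1)) (σ.val i) (edgeBit e i) *
            edgeWeight (edgeBit e i) true (edgeBit e₀ (i + 1)) * restWeight e₀ σ i)) •
        mayaVec (modOut e₀ σ i (((edgeBit e₀ (i - 1)).xor (σ.val i)).xor (edgeBit e i))
        (((edgeBit e i).xor true).xor (edgeBit e₀ (i + 1))))
      else 0 := by
  rw [fermion_single]
  split_ifs with h
  · have hσ : ∀ j, j ≠ i → j ≠ i + 1 → (σ.set (i + 1) true).val j = σ.val j := fun j _ h1 => by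
      rw [Maya.set_val, if_neg h1]
    rw [edgeOp_single, rowOut_eq_modOut he hσ, rowWeight_eq_rest he hσ,
      Maya.set_val, Maya.set_val, if_pos rfl, if_neg (by omega), mayaVec, Finsupp.smul_single_one]
  · exact map_zero _

theorem fermion_left_edgeOp (he : ∀ j, j ≠ i → edgeBit e j = edgeBit e₀ j) :
    fermion i (edgeOp e (Finsupp.single σ 1)) =
      if ((edgeBit e₀ (i - 1)).xor (σ.val i)).xor (edgeBit e i) = false then
      ((-1) ^ σ.onesAbove (i + 1) * bitSign (σ.val (i + 1)) * bitSign (edgeBit e i) *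
          (edgeWeight (edgeBit e₀ (i - 1)) (σ.val i) (edgeBit e i) *
            edgeWeight (edgeBit e i) (σ.val (i + 1)) (edgeBit e₀ (i + 1)) * restWeight e₀ σ i)) •
        mayaVec (modOut e₀ σ i true
        (((edgeBit e i).xor (σ.val (i + 1))).xor (edgeBit e₀ (i + 1))))
      else 0 := by
  rw [edgeOp_single, one_mul, fermion, Finsupp.linearCombination_single,
    neg_one_pow_onesAbove_rowOut, neg_one_pow_onesAbove, rowWeight_eq_rest he fun _ _ _ => rfl,
    rowOut_eq_modOut he fun _ _ _ => rfl, modOut_val_left, modOut_set_left]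
  split_ifs
  · rw [mayaVec, Finsupp.smul_single, Finsupp.smul_single_one, smul_eq_mul]
    congr 1
    ring
  · exact smul_zero _

theorem fermion_right_edgeOp (he : ∀ j, j ≠ i → edgeBit e j = edgeBit e₀ j) :
    fermion (i + 1) (edgeOp e (Finsupp.single σ 1)) =
      if ((edgeBit e i).xor (σ.val (i + 1))).xor (edgeBit e₀ (i + 1)) = false then
      ((-1) ^ σ.onesAbove (i + 1) * bitSign (edgeBit e₀ (i + 1)) *
          (edgeWeight (edgeBit e₀ (i - 1)) (σ.val i) (edgeBit e i) *
            edgeWeight (edgeBit e i) (σ.val (i + 1)) (edgeBit e₀ (i + 1)) * restWeight e₀ σ i)) •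
        mayaVec (modOut e₀ σ i
        (((edgeBit e₀ (i - 1)).xor (σ.val i)).xor (edgeBit e i)) true)
      else 0 := by
  rw [edgeOp_single, one_mul, fermion, Finsupp.linearCombination_single,
    neg_one_pow_onesAbove_rowOut, rowWeight_eq_rest he fun _ _ _ => rfl,
    rowOut_eq_modOut he fun _ _ _ => rfl, modOut_val_right, modOut_set_right,
    he (i + 1) (by omega)]
  split_ifs
  · rw [mayaVec, Finsupp.smul_single, Finsupp.smul_single_one, smul_eq_mul]
    congr 1
    ring
  · exact smul_zero _

end Exchange

/-- First of three local relations into which the exchange relation splits, according to the state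
of edge `i`. Here edge `i` is empty and must remain so. -/
theorem edgeOp_comm_fermion {e : Finset ℤ} {i : ℤ} (hi : i ∉ e) (v : Fock) :
    edgeOp e (fermion i v) = fermion i (edgeOp e v) := by
  suffices h : edgeOp e ∘ₗ fermion i = fermion i ∘ₗ edgeOp e from LinearMap.congr_fun h v
  refine Finsupp.lhom_ext' fun σ => LinearMap.ext_ring ?_
  change edgeOp e (fermion i (Finsupp.single σ 1)) = fermion i (edgeOp e (Finsupp.single σ 1))
  rw [edgeOp_fermion_left (e₀ := e) fun _ _ => rfl, fermion_left_edgeOp (e₀ := e) fun _ _ => rfl,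
    edgeBit_eq_false hi]
  cases edgeBit e (i - 1) <;> cases edgeBit e (i + 1) <;> cases σ.val i <;>
    cases σ.val (i + 1) <;> simp [edgeWeight, bitSign]

theorem edgeOp_comm_fermion_succ {e : Finset ℤ} {i : ℤ} (hi : i ∈ e) (v : Fock) :
    t • edgeOp e (fermion (i + 1) v) = fermion (i + 1) (edgeOp e v) := by
  suffices h : t • (edgeOp e ∘ₗ fermion (i + 1)) = fermion (i + 1) ∘ₗ edgeOp e from
    LinearMap.congr_fun h v
  refine Finsupp.lhom_ext' fun σ => LinearMap.ext_ring ?_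
  change t • edgeOp e (fermion (i + 1) (Finsupp.single σ 1)) =
    fermion (i + 1) (edgeOp e (Finsupp.single σ 1))
  rw [edgeOp_fermion_right (e₀ := e) fun _ _ => rfl, fermion_right_edgeOp (e₀ := e) fun _ _ => rfl,
    edgeBit_eq_true hi]
  cases edgeBit e (i - 1) <;> cases edgeBit e (i + 1) <;> cases σ.val i <;>
    cases σ.val (i + 1) <;>
    simp [edgeWeight, bitSign] <;> rw [← sub_eq_zero] <;>
    simp only [smul_smul, sub_eq_add_neg, ← neg_smul, neg_neg, ← add_smul] <;>
    refine (congrArg (· • _) ?_).trans (zero_smul K _) <;> ring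

/-- The two configurations differ in edge `i`, which compensates for the difference between creating
a particle at `i` and at `i + 1`. Neither configuration satisfies such a relation alone. -/
theorem edgeOp_insert_fermion {e : Finset ℤ} {i : ℤ} (hi : i ∉ e) (v : Fock) :
    edgeOp (insert i e) (fermion i v) - t • edgeOp e (fermion (i + 1) v) =
      fermion i (edgeOp (insert i e) v) - fermion (i + 1) (edgeOp e v) := by
  suffices h : edgeOp (insert i e) ∘ₗ fermion i - t • (edgeOp e ∘ₗ fermion (i + 1)) =
      fermion i ∘ₗ edgeOp (insert i e) - fermion (i + 1) ∘ₗ edgeOp e from LinearMap.congr_fun h v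
  refine Finsupp.lhom_ext' fun σ => LinearMap.ext_ring ?_
  change edgeOp (insert i e) (fermion i (Finsupp.single σ 1)) -
      t • edgeOp e (fermion (i + 1) (Finsupp.single σ 1)) =
    fermion i (edgeOp (insert i e) (Finsupp.single σ 1)) -
      fermion (i + 1) (edgeOp e (Finsupp.single σ 1))
  have he : ∀ j, j ≠ i → edgeBit (insert i e) j = edgeBit e j := by
    intro j hj
    simp [edgeBit, hj]
  rw [edgeOp_fermion_left he, edgeOp_fermion_right (e₀ := e) fun _ _ => rfl,
    fermion_left_edgeOp he, fermion_right_edgeOp (e₀ := e) fun _ _ => rfl,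
    edgeBit_eq_true (Finset.mem_insert_self i e), edgeBit_eq_false hi]
  -- Two outer edges and two letters leave sixteen cases. In those that are not trivial, the terms
  -- are multiples of a common basis vector and the scalars are compared.
  cases edgeBit e (i - 1) <;> cases edgeBit e (i + 1) <;> cases σ.val i <;>
    cases σ.val (i + 1) <;>
    simp [edgeWeight, bitSign] <;> rw [← sub_eq_zero] <;>
    simp only [smul_smul, sub_eq_add_neg, ← neg_smul, neg_add, neg_neg, ← add_smul, neg_zero,
      add_zero, zero_add] <;>
    refine (congrArg (· • _) ?_).trans (zero_smul K _) <;> ring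

/-! ### Hops and row configurations -/

/-- The horizontal edges with value one for a sequence of hops. -/
def hopEdges : List (ℤ × ℤ) → Finset ℤ
  | [] => ∅
  | p :: L => Finset.Ico p.1 p.2 ∪ hopEdges L

/-- The condition `i_1 < j_1 < i_2 < j_2 < ⋯`. -/
def IsHopList (L : List (ℤ × ℤ)) : Prop :=
  (∀ p ∈ L, p.1 < p.2) ∧ L.Pairwise fun p q => p.2 < q.1

theorem isHopList_cons {p : ℤ × ℤ} {L : List (ℤ × ℤ)} :
    IsHopList (p :: L) ↔ p.1 < p.2 ∧ (∀ q ∈ L, p.2 < q.1) ∧ IsHopList L := by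
  simp only [IsHopList, List.forall_mem_cons, List.pairwise_cons]
  tauto

theorem mem_hopEdges {L : List (ℤ × ℤ)} {i : ℤ} :
    i ∈ hopEdges L ↔ ∃ p ∈ L, p.1 ≤ i ∧ i < p.2 := by
  induction L with
  | nil => simp [hopEdges]
  | cons p L ih => simp [hopEdges, ih]

theorem lt_of_mem_hopEdges {p : ℤ × ℤ} {L : List (ℤ × ℤ)} (h : IsHopList (p :: L)) {i : ℤ}
    (hi : i ∈ hopEdges L) : p.2 < i := by
  obtain ⟨q, hq, h1, _⟩ := mem_hopEdges.1 hi
  have := (isHopList_cons.1 h).2.1 q hq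
  omega

theorem card_hopEdges {L : List (ℤ × ℤ)} (h : IsHopList L) :
    ((hopEdges L).card : ℤ) = (L.map fun p => p.2 - p.1).sum := by
  induction L with
  | nil => simp [hopEdges]
  | cons p L ih =>
    have hp := isHopList_cons.1 h
    rw [hopEdges, Finset.card_union_of_disjoint, List.map_cons, List.sum_cons, ← ih hp.2.2,
      Int.card_Ico]
    · push_cast
      rw [Int.toNat_of_nonneg (by omega)]
    · rw [Finset.disjoint_left]
      intro i h1 h2
      have := lt_of_mem_hopEdges h h2
      have := (Finset.mem_Ico.1 h1).2
      omega

theorem hopEdges_cons_mem_iff {p : ℤ × ℤ} {L : List (ℤ × ℤ)} (h : IsHopList (p :: L)) (i : ℤ) :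
    i ∈ hopEdges (p :: L) ↔ (p.1 ≤ i ∧ i < p.2) ∨ (p.2 < i ∧ i ∈ hopEdges L) := by
  rw [hopEdges, Finset.mem_union, Finset.mem_Ico]
  refine or_congr_right ⟨fun hi => ⟨lt_of_mem_hopEdges h hi, hi⟩, fun hi => hi.2⟩

/-- Because `j_k < i_{k+1}` is strict, the edge `j_k` stays empty, so the intervals `[i_k, j_k)` are
the maximal runs of the edge set and can be recovered from it. -/
theorem hopEdges_injective {L L' : List (ℤ × ℤ)} (h : IsHopList L) (h' : IsHopList L')
    (he : hopEdges L = hopEdges L') : L = L' := by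
  have ne : ∀ {p : ℤ × ℤ} {L : List (ℤ × ℤ)}, IsHopList (p :: L) → hopEdges (p :: L) ≠ ∅ := by
    intro p L h h0
    have : p.1 ∈ hopEdges (p :: L) :=
      (hopEdges_cons_mem_iff h _).2 (Or.inl ⟨le_rfl, (isHopList_cons.1 h).1⟩)
    rw [h0] at this
    simp at this
  induction L generalizing L' with
  | nil =>
    cases L' with
    | nil => rfl
    | cons p' L' => exact absurd he.symm (ne h')
  | cons p L ih =>
    cases L' with
    | nil => exact absurd he (ne h)
    | cons p' L' =>
      have hm := hopEdges_cons_mem_iff h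
      have hm' := hopEdges_cons_mem_iff h'
      have hmm := fun i => (hm i).symm.trans ((Finset.ext_iff.1 he i).trans (hm' i))
      have hp := (isHopList_cons.1 h).1
      have hp' := (isHopList_cons.1 h').1
      have e1 : p.1 = p'.1 := by
        have h1 := (hmm p.1).1 (Or.inl ⟨le_rfl, hp⟩)
        have h2 := (hmm p'.1).2 (Or.inl ⟨le_rfl, hp'⟩)
        omega
      have e2 : p.2 = p'.2 := by
        by_contra hne
        rcases lt_or_gt_of_ne hne with hlt | hlt
        · have h1 := (hmm p.2).2 (Or.inl ⟨by omega, hlt⟩)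
          omega
        · have h1 := (hmm p'.2).1 (Or.inl ⟨by omega, hlt⟩)
          omega
      have e3 : hopEdges L = hopEdges L' := by
        ext i
        have h1 := hmm i
        have h2 : i ∈ hopEdges L → p.2 < i := lt_of_mem_hopEdges h
        have h3 : i ∈ hopEdges L' → p'.2 < i := lt_of_mem_hopEdges h'
        constructor
        · intro hi
          have h4 := h2 hi
          rcases h1.1 (Or.inr ⟨h4, hi⟩) with hc | hc
          · omega
          · exact hc.2
        · intro hi
          have h4 := h3 hi
          rcases h1.2 (Or.inr ⟨h4, hi⟩) with hc | hc
          · omega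
          · exact hc.2
      rw [ih (isHopList_cons.1 h).2.2 (isHopList_cons.1 h').2.2 e3, Prod.ext e1 e2]

theorem exists_hopList (e : Finset ℤ) : ∃ L, IsHopList L ∧ hopEdges L = e := by
  induction hn : e.card using Nat.strong_induction_on generalizing e with
  | _ n ih =>
    rcases e.eq_empty_or_nonempty with rfl | hne
    · exact ⟨[], ⟨by simp, List.Pairwise.nil⟩, rfl⟩
    · set i := e.min' hne with hi
      have hie : i ∈ e := e.min'_mem hne
      have hex : ∃ d : ℕ, i + d ∉ e := by
        refine ⟨(e.max' hne - i + 1).toNat, fun h => ?_⟩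
        have h1 := e.le_max' _ h
        have h2 := e.le_max' _ hie
        omega
      classical
      -- The length of the first maximal run of `e`. The edge `i + d` is empty, so what is left lies
      -- strictly to the right of it and the recursion keeps the strict inequality between hops.
      set d := Nat.find hex with hd
      have hd1 : i + d ∉ e := Nat.find_spec hex
      have hd2 : ∀ k < d, i + (k : ℤ) ∈ e := fun k hk => not_not.1 (Nat.find_min hex hk)
      have hd0 : 0 < d := by
        rcases Nat.eq_zero_or_pos d with h0 | h0
        · rw [h0] at hd1
          simp [hie] at hd1
        · exact h0
      obtain ⟨L, hL, hLe⟩ := ih (e.filter fun k => i + d < k).card (by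
        rw [← hn]
        refine Finset.card_lt_card (Finset.filter_ssubset.2 ⟨i, hie, by omega⟩)) _ rfl
      have hlist : IsHopList ((i, i + d) :: L) := by
        refine isHopList_cons.2 ⟨by simp only; omega, fun q hq => ?_, hL⟩
        have : q.1 ∈ hopEdges L := mem_hopEdges.2 ⟨q, hq, le_rfl, hL.1 q hq⟩
        rw [hLe, Finset.mem_filter] at this
        exact this.2
      refine ⟨_, hlist, ?_⟩
      ext k
      rw [hopEdges_cons_mem_iff hlist, hLe, Finset.mem_filter]
      constructor
      · rintro (⟨h1, h2⟩ | h)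
        · simp only at h1 h2
          have := hd2 (k - i).toNat (by omega)
          rwa [show i + ((k - i).toNat : ℤ) = k by omega] at this
        · exact h.2.1
      · intro hk
        have h1 : i ≤ k := e.min'_le _ hk
        have h2 : k ≠ i + d := fun h => hd1 (h ▸ hk)
        simp only
        rcases lt_or_gt_of_ne h2 with h3 | h3
        · exact Or.inl ⟨h1, h3⟩
        · exact Or.inr ⟨h3, hk, h3⟩

/-- Hop sequences of total length `m` correspond to row configurations with `m` edges. -/
def hopEquiv (m : ℕ) : HopSeq m ≃ {e : Finset ℤ // e.card = m} :=
  Equiv.ofBijective (fun L => ⟨hopEdges L.1, by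
    have := card_hopEdges (L := L.1) ⟨L.2.1, L.2.2.1⟩
    rw [L.2.2.2] at this
    exact_mod_cast this⟩) (by
    constructor
    · intro L L' h
      exact Subtype.ext (hopEdges_injective ⟨L.2.1, L.2.2.1⟩ ⟨L'.2.1, L'.2.2.1⟩
        (congrArg Subtype.val h))
    · rintro ⟨e, he⟩
      obtain ⟨L, hL, hLe⟩ := exists_hopList e
      refine ⟨⟨L, hL.1, hL.2, ?_⟩, Subtype.ext hLe⟩
      rw [← card_hopEdges hL, hLe, he])

/-- The two fermionic factors differ by the particle at `j` and by the ones among the `n` sites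
strictly between. Each of these ones turns a factor `t` into `-1`, as in the vertex weights `tx` and
`-x`; the particle at `j` leaves the overall sign, which turns `1 - t` into `t - 1`. -/
theorem hop_factor (σ : Maya) (j : ℤ) (n : ℕ) :
    t ^ (n + 1) * ((-t) ^ σ.onesAbove j * ((-t) ^ (σ.set j true).onesAbove (j - 1 - n))⁻¹) =
      -∏ k ∈ Finset.Ioo (j - 1 - n) j, (if σ.val k = true then -1 else t) := by
  have ht : t ≠ 0 := RatFunc.X_ne_zero
  have ht' : -t ≠ 0 := neg_ne_zero.2 ht
  induction n with
  | zero =>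
    have h1 : (σ.set j true).onesAbove (j - 1 - (0 : ℕ)) = σ.onesAbove j + 1 := by
      rw [Maya.onesAbove_eq, Nat.cast_zero, sub_zero, sub_add_cancel, Maya.set_val, if_pos rfl,
        if_pos rfl]
      congr 1
      refine Maya.onesAbove_congr fun k hk => ?_
      rw [Maya.set_val, if_neg hk.ne']
    have h2 : Finset.Ioo (j - 1 - ((0 : ℕ) : ℤ)) j = ∅ := by
      ext k
      simp only [Finset.mem_Ioo, Finset.notMem_empty, iff_false]
      omega
    rw [h1, h2, Finset.prod_empty, pow_succ]
    field_simp
    ring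
  | succ n ih =>
    have h1 : (σ.set j true).onesAbove (j - 1 - (n + 1 : ℕ)) =
        (σ.set j true).onesAbove (j - 1 - n) + if σ.val (j - 1 - n) = true then 1 else 0 := by
      have h := (σ.set j true).onesAbove_eq (j - 1 - (n + 1 : ℕ))
      rw [show j - 1 - ((n + 1 : ℕ) : ℤ) + 1 = j - 1 - n by push_cast; ring] at h
      rw [h, Maya.set_val, if_neg (show j - 1 - (n : ℤ) ≠ j by omega)]
    have h2 : Finset.Ioo (j - 1 - ((n + 1 : ℕ) : ℤ)) j =
        insert (j - 1 - (n : ℤ)) (Finset.Ioo (j - 1 - (n : ℤ)) j) := by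
      ext k
      simp only [Finset.mem_Ioo, Finset.mem_insert]
      push_cast
      omega
    rw [h1, h2, Finset.prod_insert (by simp), ← mul_neg, ← ih]
    split_ifs
    · rw [pow_succ (-t)]
      field_simp
      ring
    · rw [add_zero]
      ring

theorem rowWeight_Ico (σ : Maya) {i j : ℤ} (hij : i < j) : rowWeight (Finset.Ico i j) σ =
    (if σ.val i = true then t - 1 else 0) * (if σ.val j = true then 0 else 1) *
      ∏ k ∈ Finset.Ioo i j, (if σ.val k = true then -1 else t) := by
  have hbit : ∀ k, edgeBit (Finset.Ico i j) k = decide (i ≤ k ∧ k < j) := fun k => by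
    rw [edgeBit]
    congr 1
    rw [Finset.mem_Ico]
  rw [rowWeight, finprod_eq_prod_of_mulSupport_subset (s := insert i (insert j (Finset.Ioo i j))),
    Finset.prod_insert, Finset.prod_insert, ← mul_assoc]
  · congr 1
    · congr 1
      · rw [siteWeight, hbit, hbit, decide_eq_false (by omega), decide_eq_true (by omega)]
        cases σ.val i <;> simp [edgeWeight]
      · rw [siteWeight, hbit, hbit, decide_eq_true (by omega), decide_eq_false (by omega)]
        cases σ.val j <;> simp [edgeWeight]
    · refine Finset.prod_congr rfl fun k hk => ?_
      rw [Finset.mem_Ioo] at hk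
      rw [siteWeight, hbit, hbit, decide_eq_true (by omega), decide_eq_true (by omega)]
      cases σ.val k <;> simp [edgeWeight]
  · simp
  · simp only [Finset.mem_insert, Finset.mem_Ioo]
    omega
  · intro k hk
    by_contra hc
    simp only [Finset.coe_insert, Finset.coe_Ioo, Set.mem_insert_iff, Set.mem_Ioo] at hc
    apply hk
    rw [siteWeight, hbit, hbit, decide_eq_false (by omega), decide_eq_false (by omega),
      edgeWeight_false_false]

/-- A single hop is the operator of a row configuration. -/
theorem hop_eq_edgeOp (p : ℤ × ℤ) (hp : p.1 < p.2) :
    t ^ (p.2 - p.1).toNat • hop p = edgeOp (Finset.Ico p.1 p.2) := by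
  refine Finsupp.lhom_ext' fun σ => LinearMap.ext_ring ?_
  change t ^ (p.2 - p.1).toNat • hop p (Finsupp.single σ 1) =
    edgeOp (Finset.Ico p.1 p.2) (Finsupp.single σ 1)
  rw [edgeOp_single, one_mul, rowWeight_Ico σ hp, hop, LinearMap.smul_apply, Module.End.mul_apply,
    psiPlus, Finsupp.linearCombination_single, one_smul]
  by_cases h2 : σ.val p.2 = true
  · rw [if_pos h2, if_neg (by simp [h2]), map_zero, smul_zero, smul_zero, mul_zero, zero_mul,
      Finsupp.single_zero]
  · have h2' : σ.val p.2 = false := by simpa using h2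
    rw [if_neg h2, if_pos h2', psiMinus, Finsupp.linearCombination_single, Maya.set_val,
      if_neg hp.ne]
    by_cases h1 : σ.val p.1 = true
    · have hout : rowOut (Finset.Ico p.1 p.2) σ = (σ.set p.2 true).set p.1 false := by
        ext k
        rw [rowOut_val, Maya.set_val, Maya.set_val, edgeBit, edgeBit]
        simp only [Finset.mem_Ico]
        split_ifs with h3 h4
        · rw [h3, decide_eq_false (by omega), decide_eq_true (by omega), h1]
          rfl
        · rw [h4, decide_eq_true (by omega), decide_eq_false (by omega), h2']
          rfl
        · by_cases h5 : p.1 ≤ k ∧ k < p.2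
          · rw [decide_eq_true (by omega), decide_eq_true (by omega)]
            cases σ.val k <;> rfl
          · rw [decide_eq_false (by omega), decide_eq_false (by omega)]
            cases σ.val k <;> rfl
      obtain ⟨n, hn⟩ : ∃ n : ℕ, p.2 - p.1 = n + 1 := ⟨(p.2 - p.1 - 1).toNat, by omega⟩
      have hf := hop_factor σ p.2 n
      rw [show p.2 - 1 - (n : ℤ) = p.1 by omega] at hf
      rw [if_pos h1, if_pos h1, hout, Finsupp.smul_single, Finsupp.smul_single, Finsupp.smul_single,
        show (p.2 - p.1).toNat = n + 1 by omega]
      congr 1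
      simp only [smul_eq_mul, mul_one]
      rw [← neg_eq_iff_eq_neg] at hf
      rw [← hf]
      ring
    · rw [if_neg h1, if_neg h1, zero_mul, zero_mul, Finsupp.single_zero, smul_zero, smul_zero,
        smul_zero]

/-- The interval acts on the sites up to `j` and `e` on those beyond `j`, so at each site at most
one of the two factors is nontrivial. -/
theorem edgeOp_mul {i j : ℤ} {e : Finset ℤ} (he : ∀ k ∈ e, j < k) :
    edgeOp (Finset.Ico i j) * edgeOp e = edgeOp (Finset.Ico i j ∪ e) := by
  refine Finsupp.lhom_ext' fun σ => LinearMap.ext_ring ?_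
  change edgeOp (Finset.Ico i j) (edgeOp e (Finsupp.single σ 1)) =
    edgeOp (Finset.Ico i j ∪ e) (Finsupp.single σ 1)
  have hlow : ∀ k ≤ j, edgeBit e k = false := fun k hk => edgeBit_eq_false fun h => by
    have := he k h
    omega
  have hhigh : ∀ k, j ≤ k → edgeBit (Finset.Ico i j) k = false := fun k hk =>
    edgeBit_eq_false fun h => by
      have := (Finset.mem_Ico.1 h).2
      omega
  have hu : ∀ k, edgeBit (Finset.Ico i j ∪ e) k = (edgeBit (Finset.Ico i j) k || edgeBit e k) :=
    fun k => by
      simp only [edgeBit, Finset.mem_union, Bool.decide_or]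
  rw [edgeOp_single, edgeOp_single, edgeOp_single, one_mul, one_mul]
  congr 1
  · ext k
    rw [rowOut_val, rowOut_val, rowOut_val, hu, hu]
    rcases le_or_gt k j with hk | hk
    · rw [hlow k hk, hlow (k - 1) (by omega)]
      simp
    · rw [hhigh k (by omega), hhigh (k - 1) (by omega)]
      simp
  · rw [rowWeight, rowWeight, rowWeight, ← finprod_mul_distrib (mulSupport_siteWeight _ _)
      (mulSupport_siteWeight _ _)]
    refine finprod_congr fun k => ?_
    rw [siteWeight, siteWeight, siteWeight, rowOut_val, hu, hu]
    rcases le_or_gt k j with hk | hk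
    · rw [hlow k hk, hlow (k - 1) (by omega), edgeWeight_false_false]
      simp
    · rw [hhigh k (by omega), hhigh (k - 1) (by omega), edgeWeight_false_false]
      simp

theorem prod_hop_eq_edgeOp {L : List (ℤ × ℤ)} (h : IsHopList L) :
    t ^ (hopEdges L).card • (L.map hop).prod = edgeOp (hopEdges L) := by
  induction L with
  | nil =>
    refine Finsupp.lhom_ext' fun σ => LinearMap.ext_ring ?_
    change t ^ (0 : ℕ) • Finsupp.single σ 1 = edgeOp ∅ (Finsupp.single σ 1)
    rw [edgeOp_single, pow_zero, one_smul, one_mul]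
    have h0 : ∀ k, edgeBit ∅ k = false := fun k => edgeBit_eq_false (by simp)
    congr 1
    · ext k
      rw [rowOut_val, h0, h0]
      simp
    · rw [rowWeight, finprod_congr (g := fun _ => 1), finprod_one]
      intro k
      rw [siteWeight, h0, h0, edgeWeight_false_false]
  | cons p L ih =>
    have hp := isHopList_cons.1 h
    rw [hopEdges, ← edgeOp_mul fun k hk => lt_of_mem_hopEdges h hk, ← ih hp.2.2,
      ← hop_eq_edgeOp p hp.1, Finset.card_union_of_disjoint, Int.card_Ico, List.map_cons,
      List.prod_cons, pow_add, smul_mul_smul_comm]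
    rw [Finset.disjoint_left]
    intro i h1 h2
    have := lt_of_mem_hopEdges h h2
    have := (Finset.mem_Ico.1 h1).2
    omega

theorem transferTerms_eq_edgeOp (m : ℕ) (L : HopSeq m) :
    transferTerms m L = edgeOp (hopEquiv m L).1 := by
  have h := prod_hop_eq_edgeOp (L := L.1) ⟨L.2.1, L.2.2.1⟩
  have h2 : (hopEdges L.1).card = m := (hopEquiv m L).2
  rw [h2] at h
  exact h

/-! ### The transfer matrix as a sum over row configurations -/

theorem sumOp_apply {V : Type*} [AddCommGroup V] [Module K V] {I : Type*}
    {T : I → Module.End K V} (h : PointwiseFinite T) (v : V) : sumOp T v = ∑ᶠ i, T i v := by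
  rw [sumOp, dif_pos h]
  rfl

theorem transferCoeff_eq_finsum (m : ℕ) (v : Fock) :
    transferCoeff m v = ∑ᶠ e : {e : Finset ℤ // e.card = m}, edgeOp e.1 v := by
  rw [transferCoeff, sumOp_apply (transferTerms_pointwiseFinite m),
    ← finsum_comp_equiv (hopEquiv m)]
  exact finsum_congr fun L => by rw [transferTerms_eq_edgeOp]

theorem finite_support_edgeOp (m : ℕ) (v : Fock) :
    (Function.support fun e : {e : Finset ℤ // e.card = m} => edgeOp e.1 v).Finite := by
  have h := (transferTerms_pointwiseFinite m v).image (hopEquiv m)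
  refine h.subset fun e he => ⟨(hopEquiv m).symm e, ?_, by simp⟩
  rw [Function.mem_support, transferTerms_eq_edgeOp]
  simpa using he

/-- On every vector, `A_m` is the sum over the row configurations with `m` edges in any
sufficiently large window. -/
theorem exists_window (m : ℕ) (v : Fock) : ∃ S₀ : Finset ℤ, ∀ S, S₀ ⊆ S →
    transferCoeff m v = ∑ e ∈ Finset.powersetCard m S, edgeOp e v := by
  classical
  have hfin := finite_support_edgeOp m v
  refine ⟨hfin.toFinset.biUnion fun e => e.1, fun S hS => ?_⟩
  rw [transferCoeff_eq_finsum, finsum_eq_sum_of_support_subset (s := hfin.toFinset) _ (by simp)]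
  rw [← Finset.sum_image (f := fun e => edgeOp e v) (g := Subtype.val)
    Subtype.val_injective.injOn]
  refine Finset.sum_subset (fun e he => ?_) fun e he hne => ?_
  · obtain ⟨e', he', rfl⟩ := Finset.mem_image.1 he
    refine Finset.mem_powersetCard.2 ⟨fun i hi => hS ?_, e'.2⟩
    exact Finset.mem_biUnion.2 ⟨e', he', hi⟩
  · by_contra hc
    apply hne
    refine Finset.mem_image.2 ⟨⟨e, (Finset.mem_powersetCard.1 he).2⟩, ?_, rfl⟩
    simpa using hc

theorem transferCoeff_zero : transferCoeff 0 = 1 := by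
  refine LinearMap.ext fun v => ?_
  obtain ⟨S, hS⟩ := exists_window 0 v
  rw [hS S subset_rfl, Finset.powersetCard_zero, Finset.sum_singleton]
  have h := prod_hop_eq_edgeOp (L := []) ⟨by simp, List.Pairwise.nil⟩
  have h2 : edgeOp ∅ = 1 := by
    rw [← show hopEdges [] = ∅ from rfl, ← h]
    simp [hopEdges]
  rw [h2]

/-- The exchange relation between the transfer matrix and the fermions. -/
theorem transferCoeff_fermion (m : ℕ) (i : ℤ) (v : Fock) :
    transferCoeff (m + 1) (fermion i v) - t • transferCoeff m (fermion (i + 1) v) =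
      fermion i (transferCoeff (m + 1) v) - fermion (i + 1) (transferCoeff m v) := by
  obtain ⟨S₁, h₁⟩ := exists_window (m + 1) (fermion i v)
  obtain ⟨S₂, h₂⟩ := exists_window m (fermion (i + 1) v)
  obtain ⟨S₃, h₃⟩ := exists_window (m + 1) v
  obtain ⟨S₄, h₄⟩ := exists_window m v
  -- One window `insert i S` serves all four terms, and removing `i` from `S` lets each sum be split
  -- according to whether edge `i` is occupied.
  set S := (S₁ ∪ S₂ ∪ S₃ ∪ S₄).erase i with hS
  have hi : i ∉ S := Finset.notMem_erase i _
  have hsub : S₁ ∪ S₂ ∪ S₃ ∪ S₄ ⊆ insert i S := by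
    intro k hk
    by_cases h : k = i
    · exact h ▸ Finset.mem_insert_self _ _
    · exact Finset.mem_insert_of_mem (Finset.mem_erase.2 ⟨h, hk⟩)
  have split : ∀ (k : ℕ) (f : Finset ℤ → Fock),
      ∑ e ∈ Finset.powersetCard (k + 1) (insert i S), f e =
        ∑ e ∈ Finset.powersetCard (k + 1) S, f e +
          ∑ e ∈ Finset.powersetCard k S, f (insert i e) := by
    intro k f
    rw [Finset.powersetCard_succ_insert hi, Finset.sum_union, Finset.sum_image]
    · intro e he e' he' h
      have h1 : i ∉ e := fun hc => hi ((Finset.mem_powersetCard.1 he).1 hc)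
      have h2 : i ∉ e' := fun hc => hi ((Finset.mem_powersetCard.1 he').1 hc)
      rw [← Finset.erase_insert h1, ← Finset.erase_insert h2]
      exact congrArg (fun s => s.erase i) h
    · rw [Finset.disjoint_left]
      intro e he he'
      obtain ⟨e'', _, rfl⟩ := Finset.mem_image.1 he'
      exact hi ((Finset.mem_powersetCard.1 he).1 (Finset.mem_insert_self _ _))
  have hmem : ∀ {k : ℕ} {e : Finset ℤ}, e ∈ Finset.powersetCard k S → i ∉ e := fun he hc =>
    hi ((Finset.mem_powersetCard.1 he).1 hc)
  rw [h₁ (insert i S) (by grind), h₂ (insert i S) (by grind), h₃ (insert i S) (by grind),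
    h₄ (insert i S) (by grind), split, split]
  have e1 : ∑ e ∈ Finset.powersetCard (m + 1) S, edgeOp e (fermion i v) =
      fermion i (∑ e ∈ Finset.powersetCard (m + 1) S, edgeOp e v) := by
    rw [map_sum]
    exact Finset.sum_congr rfl fun e he => edgeOp_comm_fermion (hmem he) v
  have e2 : ∑ e ∈ Finset.powersetCard m S, edgeOp (insert i e) (fermion i v) -
      t • ∑ e ∈ Finset.powersetCard m S, edgeOp e (fermion (i + 1) v) =
      fermion i (∑ e ∈ Finset.powersetCard m S, edgeOp (insert i e) v) -
        fermion (i + 1) (∑ e ∈ Finset.powersetCard m S, edgeOp e v) := by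
    rw [map_sum, map_sum, Finset.smul_sum, ← Finset.sum_sub_distrib, ← Finset.sum_sub_distrib]
    exact Finset.sum_congr rfl fun e he => edgeOp_insert_fermion (hmem he) v
  rw [map_add, ← e1]
  cases m with
  | zero =>
    simp only [Finset.powersetCard_zero, Finset.sum_singleton] at e2 ⊢
    rw [add_sub_assoc, e2, add_sub_assoc]
  -- For `m > 0` the operator `A_m` also has configurations containing `i`; they cancel among
  -- themselves by `edgeOp_comm_fermion_succ`. For `m = 0` there are none.
  | succ m =>
    have e3 : t • ∑ e ∈ Finset.powersetCard m S, edgeOp (insert i e) (fermion (i + 1) v) =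
        fermion (i + 1) (∑ e ∈ Finset.powersetCard m S, edgeOp (insert i e) v) := by
      rw [map_sum, Finset.smul_sum]
      exact Finset.sum_congr rfl fun e _ =>
        edgeOp_comm_fermion_succ (Finset.mem_insert_self i e) v
    rw [split, split, map_add (fermion (i + 1)), smul_add, e3, add_sub_assoc, ← sub_sub, e2,
      sub_sub, add_sub_assoc]

/-! ### The six-vertex model -/

/-- The ice rule determines the lower edge. A vertex carries a factor `x` exactly when its right
edge is occupied, so the power of `x` in a row counts horizontal edges. -/
theorem vertexWeight_eq (W N E S : Bool) : vertexWeight W N E S =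
    if S = ((W.xor N).xor E) then
      (if E = true then PowerSeries.X else 1) * PowerSeries.C (edgeWeight W N E) else 0 := by
  cases W <;> cases N <;> cases E <;> cases S <;>
    simp [vertexWeight, edgeWeight, mul_comm]

theorem finprod_vertexWeight (e : Finset ℤ) (σ σ' : Maya) :
    ∏ᶠ i : ℤ, vertexWeight (edgeBit e (i - 1)) (σ.val i) (edgeBit e i) (σ'.val i) =
      PowerSeries.X ^ e.card * PowerSeries.C (edgeOp e (Finsupp.single σ 1) σ') := by
  classical
  rw [edgeOp_single, one_mul]
  by_cases h : σ' = rowOut e σ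
  · rw [h, Finsupp.single_eq_same, finprod_congr fun i => by
      rw [vertexWeight_eq, if_pos (rowOut_val e σ i)], finprod_mul_distrib]
    · congr 1
      · rw [finprod_eq_prod_of_mulSupport_subset (s := e), Finset.prod_congr rfl fun i hi => by
          rw [edgeBit_eq_true hi, if_pos rfl], Finset.prod_const]
        intro i hi
        by_contra hc
        apply hi
        simp only [edgeBit_eq_false (fun h => hc h : i ∉ e)]
        rfl
      · rw [rowWeight]
        exact (MonoidHom.map_finprod (PowerSeries.C (R := K)).toMonoidHom
          (mulSupport_siteWeight e σ)).symm
    · refine e.finite_toSet.subset fun i hi => ?_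
      by_contra hc
      apply hi
      simp only [edgeBit_eq_false (fun h => hc h : i ∉ e)]
      rfl
    · refine (mulSupport_siteWeight e σ).subset fun i hi => ?_
      intro hc
      apply hi
      change PowerSeries.C (siteWeight e σ i) = 1
      rw [hc, map_one]
  · rw [Finsupp.single_eq_of_ne h, map_zero, mul_zero]
    obtain ⟨i, hi⟩ : ∃ i, σ'.val i ≠ (rowOut e σ).val i := by
      by_contra hc
      push Not at hc
      exact h (Maya.ext (funext hc))
    -- A vanishing factor kills the product only if almost all factors are one: far to the left all
    -- vertices have type `(0,1,0,1)`, far to the right type `(0,0,0,0)`, both of weight one.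
    refine finprod_eq_zero _ i ?_ ?_
    · rw [vertexWeight_eq]
      exact if_neg hi
    · obtain ⟨a, ha⟩ := σ.left_one
      obtain ⟨a', ha'⟩ := σ'.left_one
      obtain ⟨b, hb⟩ := σ.right_zero
      obtain ⟨b', hb'⟩ := σ'.right_zero
      refine ((Set.finite_Ioo (min a a') (max b b')).union
        (e.finite_toSet.union (e.finite_toSet.image (· + 1)))).subset fun i hi => ?_
      by_contra hc
      simp only [Set.mem_union, Finset.mem_coe, Set.mem_image, not_or, not_exists, not_and,
        Set.mem_Ioo] at hc
      apply hi
      simp only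
      rw [edgeBit_eq_false hc.2.1, edgeBit_eq_false fun h => hc.2.2 _ h (by ring)]
      rcases le_or_gt i (min a a') with h1 | h1
      · rw [ha i (by omega), ha' i (by omega)]
        rfl
      · have := hc.1 h1
        rw [hb i (by omega), hb' i (by omega)]
        rfl

/-- The horizontal edges can be reconstructed from left to right out of the upper and lower letters.
Given both rows, at most one configuration contributes, so matrix entries are monomials in `x`. -/
theorem rowOut_injective (σ : Maya) : Function.Injective fun e => rowOut e σ := by
  intro e e' h
  obtain ⟨a, ha⟩ := e.bddBelow
  obtain ⟨a', ha'⟩ := e'.bddBelow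
  have hbit : ∀ n : ℕ, ∀ i : ℤ, i - n < min a a' → edgeBit e i = edgeBit e' i := by
    intro n
    induction n with
    | zero =>
      intro i hi
      rw [edgeBit_eq_false fun h => ?_, edgeBit_eq_false fun h => ?_]
      · have := ha' h
        omega
      · have := ha h
        omega
    | succ n ih =>
      intro i hi
      have h1 : (rowOut e σ).val i = (rowOut e' σ).val i := congrArg (fun τ => τ.val i) h
      rw [rowOut_val, rowOut_val, ih (i - 1) (by push_cast at hi; omega)] at h1
      exact Bool.xor_right_inj.1 h1
  ext i
  have := hbit (i - min a a' + 1).toNat i (by omega)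
  rwa [edgeBit, edgeBit, decide_eq_decide] at this

/-- Horizontal edge values with finitely many ones, as finite sets. -/
def rowEquiv : Finset ℤ ≃ {e : ℤ → Bool // {i : ℤ | e i = true}.Finite} where
  toFun e := ⟨edgeBit e, by
    refine e.finite_toSet.subset fun i hi => ?_
    simpa [edgeBit] using hi⟩
  invFun e := e.2.toFinset
  left_inv e := by
    ext i
    simp [edgeBit]
  right_inv e := by
    refine Subtype.ext (funext fun i => ?_)
    simp [edgeBit]

/-- `A(x;t)` is the row transfer matrix of the six-vertex model. -/
theorem transfer_eq_rowPartition (σ σ' : Maya) :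
    PowerSeries.mk (fun m => transferCoeff m (Finsupp.single σ 1) σ') = rowPartition σ σ' := by
  classical
  have hrow : rowPartition σ σ' = ∑ᶠ e : Finset ℤ,
      PowerSeries.X ^ e.card * PowerSeries.C (edgeOp e (Finsupp.single σ 1) σ') := by
    rw [rowPartition, ← finsum_comp_equiv rowEquiv]
    exact finsum_congr fun e => finprod_vertexWeight e σ σ'
  have hne : ∀ e, rowOut e σ ≠ σ' → edgeOp e (Finsupp.single σ 1) σ' = 0 := fun e h => by
    rw [edgeOp_single, Finsupp.single_eq_of_ne h.symm]
  have htr : ∀ m, transferCoeff m (Finsupp.single σ 1) σ' =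
      ∑ᶠ e : {e : Finset ℤ // e.card = m}, edgeOp e.1 (Finsupp.single σ 1) σ' := by
    intro m
    rw [transferCoeff_eq_finsum]
    exact AddMonoidHom.map_finsum (Finsupp.applyAddHom σ') (finite_support_edgeOp m _)
  rw [hrow]
  ext m
  rw [PowerSeries.coeff_mk, htr]
  by_cases hex : ∃ e, rowOut e σ = σ'
  · obtain ⟨e, he⟩ := hex
    have huniq : ∀ e', e' ≠ e → edgeOp e' (Finsupp.single σ 1) σ' = 0 := fun e' h =>
      hne e' fun h' => h (rowOut_injective σ (h'.trans he.symm))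
    rw [finsum_eq_single _ e fun e' h => by rw [huniq e' h, map_zero, mul_zero],
      PowerSeries.coeff_mul_C, PowerSeries.coeff_X_pow]
    split_ifs with hm
    · rw [finsum_eq_single _ ⟨e, hm.symm⟩ fun e' h => huniq e'.1 fun h' => h (Subtype.ext h'),
          one_mul]
    · rw [zero_mul]
      refine (finsum_congr fun e' => ?_).trans finsum_zero
      exact huniq e'.1 fun h => hm (h ▸ e'.2.symm)
  · push Not at hex
    rw [finsum_congr fun e : {e : Finset ℤ // e.card = m} => hne e.1 (hex e.1), finsum_zero,
      finsum_congr fun e : Finset ℤ => by rw [hne e (hex e), map_zero, mul_zero], finsum_zero,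
      map_zero]

/-! ### The transfer matrix on the vacuum -/

theorem rowLen_bot (j : ℕ) : (⊥ : YoungDiagram).rowLen j = 0 := by
  by_contra h
  exact absurd (YoungDiagram.mem_iff_lt_rowLen.2 (Nat.pos_of_ne_zero h)) (by simp)

theorem vacuum_val (c k : ℤ) : (Maya.ofPartition ⊥ c).val k = decide (k ≤ c) := by
  rw [Bool.eq_iff_iff, maya_val_eq_true_iff, decide_eq_true_iff]
  simp only [rowLen_bot]
  constructor
  · rintro ⟨j, rfl⟩
    push_cast
    omega
  · intro h
    exact ⟨(c - k).toNat, by push_cast; omega⟩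

theorem eq_vacuum {σ : Maya} {c : ℤ} (h1 : ∀ k ≤ c, σ.val k = true)
    (h2 : ∀ k, c < k → σ.val k = false) : σ = Maya.ofPartition ⊥ c := by
  ext k
  rw [vacuum_val]
  rcases le_or_gt k c with h | h
  · rw [h1 k h, decide_eq_true h]
  · rw [h2 k h, decide_eq_false (by omega)]

theorem fermion_single_top {σ : Maya} {i : ℤ} (h : ∀ k, i ≤ k → σ.val k = false) :
    fermion i (Finsupp.single σ 1) = Finsupp.single (σ.set i true) 1 := by
  rw [fermion_single, if_pos (h i le_rfl), Maya.onesAbove_eq_zero fun k hk => h k hk.le, pow_zero]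

/-- A hole at depth `b` below the surface is the column shape, with Schur function `e_b`. Induction
step: a hole at depth `b + 1` in one vacuum is a hole at depth `b` in the next lower vacuum, with a
particle added at `c` by the mode of index one. -/
theorem iota_vacuum_hole (b : ℕ) (c : ℤ) :
    iota (Finsupp.single ((Maya.ofPartition ⊥ c).set (c - b) false) 1) =
      Finsupp.single (c - 1) ((-1 : K) ^ b • cE b) := by
  induction b generalizing c with
  | zero =>
    have h : (Maya.ofPartition ⊥ c).set (c - (0 : ℕ)) false = Maya.ofPartition ⊥ (c - 1) := by
      refine eq_vacuum (fun k hk => ?_) fun k hk => ?_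
      · rw [Maya.set_val, if_neg (by push_cast; omega), vacuum_val, decide_eq_true (by omega)]
      · rw [Maya.set_val, vacuum_val]
        split_ifs with h
        · rfl
        · exact decide_eq_false (by push_cast at h; omega)
    rw [h, iota_vacuum, pow_zero, one_smul, Nat.cast_zero, cE_zero]
  | succ b ih =>
    have h1 : (Maya.ofPartition ⊥ c).set (c - (b + 1 : ℕ)) false =
        ((Maya.ofPartition ⊥ (c - 1)).set (c - 1 - b) false).set c true := by
      ext k
      simp only [Maya.set_val, vacuum_val]
      push_cast
      split_ifs with h h' h'
      · omega
      · rfl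
      · omega
      · rw [decide_eq_true (by omega)]
      · omega
      · exact decide_eq_decide.2 (by omega)
    rw [h1, ← fermion_single_top, iota_fermion, ih, bosonFermion_single, map_smul,
      show c - (c - 1 - 1) - 1 = 1 by ring, vertexOp_cH_one_cE, pow_succ, mul_smul]
    · simp
    · intro k hk
      rw [Maya.set_val, vacuum_val]
      split_ifs with h
      · rfl
      · exact decide_eq_false (by omega)

/-- Below an occupied site a horizontal path cannot end, and below an empty site it cannot begin.
Every run therefore begins at or before `c` and ends after it, so there is just one. -/
theorem eq_Ico_of_rowWeight_vacuum {c : ℤ} {e : Finset ℤ} {n : ℕ} (he : e.card = n + 1)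
    (h : rowWeight e (Maya.ofPartition ⊥ c) ≠ 0) :
    ∃ b ∈ Finset.range (n + 1), Finset.Ico (c - (b : ℕ)) (c - b + (n + 1)) = e := by
  have hsite : ∀ k, siteWeight e (Maya.ofPartition ⊥ c) k ≠ 0 := fun k hk =>
    h (finprod_eq_zero _ k hk (mulSupport_siteWeight _ _))
  have hin : ∀ k ≤ c, k - 1 ∈ e → k ∈ e := by
    intro k hk h1
    by_contra h2
    apply hsite k
    rw [siteWeight, edgeBit_eq_true h1, edgeBit_eq_false h2, vacuum_val, decide_eq_true hk]
    rfl
  have hout : ∀ k, c < k → k ∈ e → k - 1 ∈ e := by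
    intro k hk h1
    by_contra h2
    apply hsite k
    rw [siteWeight, edgeBit_eq_true h1, edgeBit_eq_false h2, vacuum_val,
      decide_eq_false (by omega)]
    rfl
  have hne : e.Nonempty := Finset.card_pos.1 (by omega)
  set i := e.min' hne
  set M := e.max' hne
  have hie : i ∈ e := e.min'_mem hne
  have hMe : M ∈ e := e.max'_mem hne
  have hic : i ≤ c := by
    by_contra hc
    have := e.min'_le _ (hout i (by omega) hie)
    omega
  have hup : ∀ d : ℕ, i + d ≤ c → i + (d : ℤ) ∈ e := by
    intro d
    induction d with
    | zero => simpa using fun _ => hie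
    | succ d ih =>
      intro hd
      refine hin _ hd ?_
      have := ih (by push_cast at hd; omega)
      rwa [show i + ((d + 1 : ℕ) : ℤ) - 1 = i + d by push_cast; ring]
  have hcM : c ≤ M := by
    have := hup (c - i).toNat (by omega)
    rw [show i + ((c - i).toNat : ℤ) = c by omega] at this
    exact e.le_max' _ this
  have hdown : ∀ d : ℕ, c < M - d + 1 → M - (d : ℤ) ∈ e := by
    intro d
    induction d with
    | zero => simpa using fun _ => hMe
    | succ d ih =>
      intro hd
      push_cast at hd ⊢
      have := hout (M - d) (by omega) (ih (by omega))
      rwa [show M - ((d : ℤ) + 1) = M - d - 1 by ring]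
  have heq : e = Finset.Ico i (M + 1) := by
    ext k
    rw [Finset.mem_Ico]
    constructor
    · intro hk
      have := e.min'_le _ hk
      have := e.le_max' _ hk
      omega
    · rintro ⟨h1, h2⟩
      rcases le_or_gt k c with hk | hk
      · have := hup (k - i).toNat (by omega)
        rwa [show i + ((k - i).toNat : ℤ) = k by omega] at this
      · have := hdown (M - k).toNat (by omega)
        rwa [show M - ((M - k).toNat : ℤ) = k by omega] at this
  have hcard : M + 1 - i = n + 1 := by
    have h1 : (Finset.Ico i (M + 1)).card = n + 1 := by rw [← heq, he]
    rw [Int.card_Ico] at h1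
    omega
  refine ⟨(c - i).toNat, Finset.mem_range.2 (by omega), ?_⟩
  rw [heq]
  congr 1 <;> omega

theorem transferCoeff_vacuum (n : ℕ) (c : ℤ) :
    transferCoeff (n + 1) (Finsupp.single (Maya.ofPartition ⊥ c) 1) =
      ∑ b ∈ Finset.range (n + 1), edgeOp (Finset.Ico (c - (b : ℕ)) (c - b + (n + 1)))
        (Finsupp.single (Maya.ofPartition ⊥ c) 1) := by
  classical
  obtain ⟨S₀, hS₀⟩ := exists_window (n + 1) (Finsupp.single (Maya.ofPartition ⊥ c) 1)
  rw [hS₀ (S₀ ∪ Finset.Icc (c - n) (c + n + 1)) Finset.subset_union_left,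
    ← Finset.sum_image (f := fun e => edgeOp e (Finsupp.single (Maya.ofPartition ⊥ c) 1))
      (g := fun b : ℕ => Finset.Ico (c - (b : ℤ)) (c - b + (n + 1)))]
  · symm
    refine Finset.sum_subset ?_ ?_
    · intro e he
      obtain ⟨b, hb, rfl⟩ := Finset.mem_image.1 he
      have hb := Finset.mem_range.1 hb
      refine Finset.mem_powersetCard.2 ⟨fun k hk => Finset.mem_union_right _ ?_, ?_⟩
      · rw [Finset.mem_Ico] at hk
        rw [Finset.mem_Icc]
        omega
      · rw [Int.card_Ico]
        omega
    · intro e he hne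
      rw [edgeOp_single, one_mul]
      by_contra hc
      apply hne
      refine Finset.mem_image.2 (eq_Ico_of_rowWeight_vacuum (Finset.mem_powersetCard.1 he).2 ?_)
      intro h0
      rw [h0, Finsupp.single_zero] at hc
      exact hc rfl
  · intro b _ b' _ h
    have h1 : c - (b : ℤ) ∈ Finset.Ico (c - (b : ℤ)) (c - b + (n + 1)) := by
      rw [Finset.mem_Ico]
      omega
    have h2 : c - (b' : ℤ) ∈ Finset.Ico (c - (b' : ℤ)) (c - b' + (n + 1)) := by
      rw [Finset.mem_Ico]
      omega
    simp only at h
    rw [h, Finset.mem_Ico] at h1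
    rw [← h, Finset.mem_Ico] at h2
    omega

theorem rowWeight_vacuum {n b : ℕ} (hb : b ≤ n) (c : ℤ) :
    rowWeight (Finset.Ico (c - (b : ℕ)) (c - b + (n + 1))) (Maya.ofPartition ⊥ c) =
      (t - 1) * t ^ (n - b) * (-1) ^ b := by
  rw [rowWeight_Ico _ (by omega), vacuum_val, vacuum_val, if_pos (decide_eq_true (by omega)),
    if_neg (by simpa using (by omega : c < c - b + (n + 1))), mul_one]
  simp only [vacuum_val, decide_eq_true_iff]
  rw [Finset.prod_ite, Finset.prod_const, Finset.prod_const]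
  have h1 : (Finset.Ioo (c - (b : ℤ)) (c - b + (n + 1))).filter (fun k => k ≤ c) =
      Finset.Ioc (c - (b : ℤ)) c := by
    ext k
    simp only [Finset.mem_filter, Finset.mem_Ioo, Finset.mem_Ioc]
    omega
  have h2 : (Finset.Ioo (c - (b : ℤ)) (c - b + (n + 1))).filter (fun k => ¬k ≤ c) =
      Finset.Ioo c (c - b + (n + 1)) := by
    ext k
    simp only [Finset.mem_filter, Finset.mem_Ioo]
    omega
  rw [h1, h2, Int.card_Ioc, Int.card_Ioo, show (c - (c - (b : ℤ))).toNat = b by omega,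
    show (c - (b : ℤ) + (n + 1) - c - 1).toNat = n - b by omega]
  ring

/-- A particle is taken from depth `b` and placed on top: first the hole gives `e_b`, then a
creation operator adds the arm, which makes a hook. The sign `(-1) ^ b` of the row weight cancels
the one in `iota_vacuum_hole`. -/
theorem iota_edgeOp_vacuum {n b : ℕ} (hb : b ≤ n) (c : ℤ) :
    iota (edgeOp (Finset.Ico (c - (b : ℕ)) (c - b + (n + 1)))
        (Finsupp.single (Maya.ofPartition ⊥ c) 1)) =
      Finsupp.single c ((t - 1) • t ^ (n - b) • vertexOp cH ((n : ℤ) - b + 1) (cE b)) := by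
  have hout : rowOut (Finset.Ico (c - (b : ℕ)) (c - b + (n + 1))) (Maya.ofPartition ⊥ c) =
      ((Maya.ofPartition ⊥ c).set (c - b) false).set (c - b + (n + 1)) true := by
    ext k
    rw [rowOut_val, Maya.set_val, Maya.set_val, edgeBit, edgeBit, vacuum_val]
    simp only [Finset.mem_Ico]
    split_ifs with h3 h4
    · rw [h3, decide_eq_true (by omega), decide_eq_false (by omega), decide_eq_false (by omega)]
      rfl
    · rw [h4, decide_eq_false (by omega), decide_eq_true (by omega), decide_eq_true (by omega)]
      rfl
    · by_cases h5 : c - b ≤ k ∧ k < c - b + (n + 1)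
      · rw [decide_eq_true (by omega), decide_eq_true h5]
        cases decide (k ≤ c) <;> rfl
      · rw [decide_eq_false (by omega), decide_eq_false h5]
        cases decide (k ≤ c) <;> rfl
  rw [edgeOp_single, one_mul, hout, rowWeight_vacuum hb, ← Finsupp.smul_single_one,
    ← fermion_single_top, map_smul, iota_fermion, iota_vacuum_hole, bosonFermion_single, map_smul,
    Finsupp.smul_single, show c - 1 + 1 = c by ring,
    show c - b + (n + 1) - (c - 1) - 1 = (n : ℤ) - b + 1 by ring, smul_smul, smul_smul, mul_assoc,
    ← mul_pow, neg_one_mul, neg_neg, one_pow, mul_one]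
  intro k hk
  rw [Maya.set_val, vacuum_val]
  split_ifs with h
  · rfl
  · exact decide_eq_false (by omega)

/-! ### The transfer matrix in terms of symmetric functions -/

theorem onBoson_single (f : Module.End K Lam) (c : ℤ) (g : Lam) :
    onBoson f (Finsupp.single c g) = Finsupp.single c (f g) := by
  simp [onBoson]

/-- Multiplication by `cG m` on the bosonic side. -/
abbrev mulG (m : ℕ) : Module.End K Boson := onBoson (LinearMap.mulLeft K (cG m))

/-- The bosonic twin of `transferCoeff_fermion`; both express that `A(x)` or `G(x)` passes the
fermion field in `z` with the factor `(1 - x/z) / (1 - t x/z)`. -/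
theorem mulG_bosonFermion (m : ℕ) (i : ℤ) (w : Boson) :
    mulG (m + 1) (bosonFermion i w) - t • mulG m (bosonFermion (i + 1) w) =
      bosonFermion i (mulG (m + 1) w) - bosonFermion (i + 1) (mulG m w) := by
  induction w using Finsupp.induction_linear with
  | zero => simp
  | add v w hv hw =>
    simp only [map_add, smul_add]
    rw [add_sub_add_comm, add_sub_add_comm, hv, hw]
  | single c f =>
    have h := vertexOp_mul_cG cH (i - c - 1) (m + 1) f
    rw [add_sub_cancel_right] at h
    simp only [bosonFermion_single, onBoson_single, LinearMap.mulLeft_apply, Finsupp.smul_single,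
      ← Finsupp.single_sub]
    rw [show i + 1 - c - 1 = i - c - 1 + 1 by ring]
    push_cast
    rw [h]

theorem iota_transferCoeff_vacuum (m : ℕ) (c : ℤ) :
    iota (transferCoeff (m + 1) (Finsupp.single (Maya.ofPartition ⊥ c) 1)) =
      mulG (m + 1) (iota (Finsupp.single (Maya.ofPartition ⊥ c) 1)) := by
  rw [iota_vacuum, onBoson_single, LinearMap.mulLeft_apply, mul_one, transferCoeff_vacuum, map_sum,
    Nat.cast_succ, cG_eq_sum_hooks, Finset.smul_sum, Finsupp.single_finsetSum]
  exact Finset.sum_congr rfl fun b hb =>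
    iota_edgeOp_vacuum (Nat.lt_succ_iff.1 (Finset.mem_range.1 hb)) c

theorem Maya.exists_lowest_hole (σ : Maya) :
    ∃ h, (∀ k < h, σ.val k = true) ∧ σ.val h = false := by
  obtain ⟨a, ha⟩ := σ.left_one
  obtain ⟨b, hb⟩ := σ.right_zero
  obtain ⟨h, h1, h2⟩ := Int.exists_least_of_bdd (P := fun k => σ.val k = false)
    ⟨a, fun z hz => by
      by_contra hc
      rw [ha z (by omega)] at hz
      simp at hz⟩ ⟨b, hb b le_rfl⟩
  refine ⟨h, fun k hk => ?_, h1⟩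
  by_contra hc
  have := h2 k (by simpa using hc)
  omega

/-- The correspondence turns the transfer matrix into multiplication by `∏ (1 - xy) / (1 - txy)`. -/
theorem iota_transferCoeff (m : ℕ) (v : Fock) :
    iota (transferCoeff m v) = mulG m (iota v) := by
  induction m generalizing v with
  | zero =>
    rw [transferCoeff_zero, Module.End.one_apply, mulG, Nat.cast_zero, cG_zero,
      LinearMap.mulLeft_one, onBoson]
    simp
  | succ m ih =>
    have basic : ∀ (n : ℕ) (σ : Maya) (h : ℤ), (∀ k < h, σ.val k = true) → σ.val h = false →
        σ.onesAbove h = n → iota (transferCoeff (m + 1) (Finsupp.single σ 1)) =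
          mulG (m + 1) (iota (Finsupp.single σ 1)) := by
      -- Inner induction on the number of ones above the lowest hole. The topmost of them is removed
      -- and recreated by a fermion, with no sign because nothing lies to its right.
      intro n
      induction n with
      | zero =>
        intro σ h h1 h2 h3
        rw [Maya.onesAbove, Set.ncard_eq_zero (σ.finite_onesAbove h)] at h3
        rw [eq_vacuum (σ := σ) (c := h - 1) (fun k hk => h1 k (by omega)) fun k hk => ?_]
        · exact iota_transferCoeff_vacuum m _
        · by_cases hkh : k = h
          · rw [hkh, h2]
          · by_contra hc
            have : k ∈ {j : ℤ | h < j ∧ σ.val j = true} := ⟨by omega, by simpa using hc⟩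
            rw [h3] at this
            exact this
      | succ n ihn =>
        intro σ h h1 h2 h3
        have hfin := σ.finite_onesAbove h
        have hne : {j : ℤ | h < j ∧ σ.val j = true}.Nonempty := by
          rw [← Set.ncard_pos hfin]
          rw [Maya.onesAbove] at h3
          omega
        obtain ⟨i, ⟨hi1, hi2⟩, hi3⟩ := Set.exists_max_image _ id hfin hne
        have htop : ∀ k, i < k → σ.val k = false := by
          intro k hk
          by_contra hc
          have := hi3 k ⟨by omega, by simpa using hc⟩
          simp only [id] at this
          omega
        have hσ : fermion i (Finsupp.single (σ.set i false) 1) = Finsupp.single σ 1 := by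
          rw [fermion_single_top fun k hk => ?_]
          · congr 1
            ext k
            rw [Maya.set_val, Maya.set_val]
            split_ifs with hk
            · rw [hk, hi2]
            · rfl
          · rw [Maya.set_val]
            split_ifs with hki
            · rfl
            · exact htop k (by omega)
        have hσ' := ihn (σ.set i false) h (fun k hk => by
          rw [Maya.set_val, if_neg (by omega), h1 k hk]) (by
          rw [Maya.set_val, if_neg (by omega), h2]) (by
          have : {j : ℤ | h < j ∧ (σ.set i false).val j = true} =
              {j : ℤ | h < j ∧ σ.val j = true} \ {i} := by
            ext k
            simp only [Set.mem_ofPred_eq, Set.mem_sdiff, Set.mem_singleton_iff, Maya.set_val]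
            split_ifs with hk
            · simp [hk]
            · simp [hk]
          have hmem : i ∈ {j : ℤ | h < j ∧ σ.val j = true} := ⟨hi1, hi2⟩
          rw [Maya.onesAbove, this, Set.ncard_sdiff_singleton_of_mem hmem]
          rw [Maya.onesAbove] at h3
          omega)
        -- Of the four terms of the exchange relation, the two with `A_m` are covered by the outer
        -- induction and the one with `A_{m+1}` on the smaller diagram by the inner one. The
        -- remaining term is the claim.
        have e1 := congrArg iota (transferCoeff_fermion m i (Finsupp.single (σ.set i false) 1))
        have e2 := mulG_bosonFermion m i (iota (Finsupp.single (σ.set i false) 1))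
        rw [map_sub, map_sub, map_smul, iota_fermion, iota_fermion, ih, ih, hσ', iota_fermion, ← e2,
          ← iota_fermion, ← iota_fermion, hσ] at e1
        exact sub_left_inj.1 e1
    have hmap : iota ∘ₗ transferCoeff (m + 1) = mulG (m + 1) ∘ₗ iota := by
      refine Finsupp.lhom_ext' fun σ => LinearMap.ext_ring ?_
      obtain ⟨h, h1, h2⟩ := σ.exists_lowest_hole
      exact basic _ σ h h1 h2 rfl
    exact LinearMap.congr_fun hmap v

/-! ### The correspondence is an isomorphism -/

theorem fermion_apply (i : ℤ) (w : Fock) (τ : Maya) : fermion i w τ = if τ.val i = true then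
    (-1) ^ (τ.set i false).onesAbove i * w (τ.set i false) else 0 := by
  classical
  induction w using Finsupp.induction_linear with
  | zero => simp
  | add v w hv hw =>
    rw [map_add, Finsupp.add_apply, hv, hw, Finsupp.add_apply]
    split_ifs
    · ring
    · simp
  | single σ a =>
    rw [← Finsupp.smul_single_one, map_smul, Finsupp.smul_apply, fermion_single,
      Finsupp.smul_apply]
    by_cases h : σ.val i = false
    · rw [if_pos h]
      by_cases h2 : τ.val i = true
      · rw [if_pos h2]
        by_cases h3 : τ = σ.set i true
        · have h4 : τ.set i false = σ := by
            ext k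
            rw [h3, Maya.set_val, Maya.set_val]
            split_ifs with hk
            · rw [hk, h]
            · rfl
          rw [h4, ← h3, Finsupp.single_eq_same, Finsupp.single_eq_same]
          simp only [smul_eq_mul]
          ring
        · have h4 : τ.set i false ≠ σ := by
            intro h4
            apply h3
            ext k
            rw [← h4, Maya.set_val, Maya.set_val]
            split_ifs with hk
            · rw [hk, h2]
            · rfl
          rw [Finsupp.single_eq_of_ne h3, Finsupp.single_eq_of_ne h4]
          simp
      · rw [if_neg h2, Finsupp.single_eq_of_ne, smul_zero]
        rintro rfl
        rw [Maya.set_val, if_pos rfl] at h2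
        exact h2 rfl
    · rw [if_neg h, Finsupp.zero_apply, smul_zero]
      split_ifs with h2
      · rw [Finsupp.single_eq_of_ne]
        · simp
        · rintro rfl
          rw [Maya.set_val, if_pos rfl] at h
          exact h rfl
      · rfl

/-- For a kernel element whose diagrams vanish from `M` on, creation at a position `i < M` gives a
kernel element with fewer holes below `M`, hence zero by induction. So no diagram in its support has
a hole below `M`; only the vacuum of charge `M - 1` is left, and its image is not zero. -/
theorem iota_injective : Function.Injective iota := by
  rw [← LinearMap.ker_eq_bot, LinearMap.ker_eq_bot']
  have key : ∀ (M : ℤ) (n : ℕ) (w : Fock), (∀ σ ∈ w.support, (∀ k, M ≤ k → σ.val k = false) ∧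
      {k : ℤ | k < M ∧ σ.val k = false}.ncard ≤ n) → iota w = 0 → w = 0 := by
    intro M n
    have hfin : ∀ σ : Maya, {k : ℤ | k < M ∧ σ.val k = false}.Finite := by
      intro σ
      obtain ⟨a, ha⟩ := σ.left_one
      refine (Set.finite_Ioo a M).subset fun k hk => ⟨?_, hk.1⟩
      by_contra hc
      have h := hk.2
      rw [ha k (by omega)] at h
      simp at h
    have vac : ∀ w : Fock, (∀ σ ∈ w.support, (∀ k, M ≤ k → σ.val k = false) ∧
        ∀ k < M, σ.val k = true) → iota w = 0 → w = 0 := by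
      intro w hw h0
      have h1 : w = Finsupp.single (Maya.ofPartition ⊥ (M - 1))
          (w (Maya.ofPartition ⊥ (M - 1))) := by
        rw [Finsupp.eq_single_iff]
        refine ⟨fun σ hσ => ?_, rfl⟩
        rw [Finset.mem_singleton]
        exact eq_vacuum (fun k hk => (hw σ hσ).2 k (by omega)) fun k hk => (hw σ hσ).1 k (by omega)
      rw [h1, ← Finsupp.smul_single_one, map_smul, iota_vacuum, Finsupp.smul_single] at h0
      have h2 := Finsupp.single_eq_zero.1 h0
      rw [h1, (smul_eq_zero.1 h2).resolve_right one_ne_zero, Finsupp.single_zero]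
    induction n with
    | zero =>
      intro w hw h0
      refine vac w (fun σ hσ => ⟨(hw σ hσ).1, fun k hk => ?_⟩) h0
      have h1 := (Set.ncard_eq_zero (hfin σ)).1 (Nat.le_zero.1 (hw σ hσ).2)
      by_contra hc
      have : k ∈ {k : ℤ | k < M ∧ σ.val k = false} := ⟨hk, by simpa using hc⟩
      rw [h1] at this
      exact this
    | succ n ih =>
      intro w hw h0
      refine vac w (fun σ hσ => ⟨(hw σ hσ).1, fun i hi => ?_⟩) h0
      by_contra hc
      have hσi : σ.val i = false := by simpa using hc
      have h1 : fermion i w = 0 := by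
        refine ih _ (fun τ hτ => ?_) (by rw [iota_fermion, h0, map_zero])
        rw [Finsupp.mem_support_iff, fermion_apply] at hτ
        have h2 : τ.val i = true := by
          by_contra h2
          rw [if_neg h2] at hτ
          exact hτ rfl
        rw [if_pos h2] at hτ
        have h3 := hw (τ.set i false) (Finsupp.mem_support_iff.2 (right_ne_zero_of_mul hτ))
        constructor
        · intro k hk
          have h4 := h3.1 k hk
          rwa [Maya.set_val, if_neg (by omega)] at h4
        · have h4 : {k : ℤ | k < M ∧ (τ.set i false).val k = false} =
              insert i {k : ℤ | k < M ∧ τ.val k = false} := by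
            ext k
            simp only [Set.mem_ofPred_eq, Set.mem_insert_iff, Maya.set_val]
            split_ifs with hk
            · simp [hk, hi]
            · simp [hk]
          have h5 := h3.2
          rw [h4, Set.ncard_insert_of_notMem (by simp [h2]) (hfin τ)] at h5
          omega
      have h2 := DFunLike.congr_fun h1 (σ.set i true)
      have h3 : (σ.set i true).set i false = σ := by
        ext k
        rw [Maya.set_val, Maya.set_val]
        split_ifs with hk
        · rw [hk, hσi]
        · rfl
      rw [fermion_apply, Maya.set_val, if_pos rfl, if_pos rfl, h3, Finsupp.zero_apply] at h2
      exact Finsupp.mem_support_iff.1 hσ ((mul_eq_zero.1 h2).resolve_left (by simp))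
  intro w hw
  choose b hb using fun σ : Maya => σ.right_zero
  obtain ⟨M, hM⟩ := (w.support.image b).bddAbove
  refine key M (w.support.sup fun σ => {k : ℤ | k < M ∧ σ.val k = false}.ncard) w
    (fun σ hσ => ⟨fun k hk => hb σ k (le_trans (hM ?_) hk), ?_⟩) hw
  · exact Finset.mem_coe.2 (Finset.mem_image_of_mem b hσ)
  · exact Finset.le_sup (f := fun σ => {k : ℤ | k < M ∧ σ.val k = false}.ncard) hσ

theorem gCoeff_ne_zero (r : ℕ+) : gCoeff r ≠ 0 :=
  div_ne_zero (one_sub_t_pow_ne_zero r.pos) (by exact_mod_cast r.ne_zero)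

/-- The coefficients of `serG` generate the ring of symmetric functions. -/
theorem eq_top_of_cG_mem (A : Subalgebra K Lam) (h : ∀ m : ℕ, cG m ∈ A) : A = ⊤ := by
  have hp : ∀ n : ℕ, (MvPolynomial.X n.succPNat : Lam) ∈ A := by
    intro n
    induction n using Nat.strong_induction_on with
    | _ n ih =>
      have hrec := expPos_recursion (-gCoeff) (MvPolynomial.X : ℕ+ → Lam) n
      rw [Finset.Nat.sum_antidiagonal_eq_sum_range_succ_mk, Finset.sum_range_succ, Nat.sub_self,
        coeff_zero_expPos, mul_one, ← sub_eq_iff_eq_add'] at hrec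
      have hn : ((n : K) + 1) ≠ 0 := by exact_mod_cast Nat.succ_ne_zero n
      have hne : ((n : K) + 1) * (-gCoeff) n.succPNat ≠ 0 :=
        mul_ne_zero hn (neg_ne_zero.2 (gCoeff_ne_zero _))
      have h1 : ∀ m, PowerSeries.coeff m (expPos (-gCoeff) (MvPolynomial.X : ℕ+ → Lam)) ∈ A := by
        intro m
        have := h m
        rwa [cG_natCast] at this
      -- Newton's recursion has `p_{n+1}` as its last term, with a nonzero scalar, so it can be
      -- solved for it.
      rw [← inv_smul_smul₀ hne (MvPolynomial.X n.succPNat : Lam), ← hrec]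
      refine A.smul_mem (A.sub_mem (A.smul_mem (h1 _) _) (A.sum_mem fun k hk => ?_)) _
      exact A.smul_mem (A.mul_mem (ih k (Finset.mem_range.1 hk)) (h1 _)) _
  rw [eq_top_iff, ← MvPolynomial.adjoin_range_X, Algebra.adjoin_le_iff]
  rintro _ ⟨r, rfl⟩
  have := hp (r : ℕ).pred
  rwa [show (r : ℕ).pred.succPNat = r from PNat.succPNat_natPred r] at this

theorem iota_surjective : Function.Surjective iota := by
  -- The multiplications that preserve the image of `iota` form a subalgebra. It contains every `cG
  -- m`, as `iota` turns `A_m` into multiplication by `cG m`.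
  let A : Subalgebra K Lam :=
    { carrier := {g | ∀ (c : ℤ) (f : Lam), Finsupp.single c f ∈ LinearMap.range iota →
        Finsupp.single c (g * f) ∈ LinearMap.range iota}
      mul_mem' := fun {g g'} hg hg' c f hf => by
        rw [mul_assoc]
        exact hg _ _ (hg' _ _ hf)
      add_mem' := fun {g g'} hg hg' c f hf => by
        rw [add_mul, Finsupp.single_add]
        exact Submodule.add_mem _ (hg _ _ hf) (hg' _ _ hf)
      algebraMap_mem' := fun a c f hf => by
        rw [← Algebra.smul_def, ← Finsupp.smul_single]
        exact Submodule.smul_mem _ _ hf }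
  have hA : A = ⊤ := by
    refine eq_top_of_cG_mem A fun m c f hf => ?_
    obtain ⟨v, hv⟩ := hf
    exact ⟨transferCoeff m v, by
      rw [iota_transferCoeff, hv, onBoson_single, LinearMap.mulLeft_apply]⟩
  have hsingle : ∀ (c : ℤ) (g : Lam), Finsupp.single c g ∈ LinearMap.range iota := by
    intro c g
    have hg : g ∈ A := by
      rw [hA]
      trivial
    have := hg c 1 ⟨_, iota_vacuum c⟩
    rwa [mul_one] at this
  intro w
  change w ∈ LinearMap.range iota
  induction w using Finsupp.induction_linear with
  | zero => exact Submodule.zero_mem _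
  | add v w hv hw => exact Submodule.add_mem _ hv hw
  | single c g => exact hsingle c g

theorem iota_bijective : Function.Bijective iota := ⟨iota_injective, iota_surjective⟩

/-! ### Evaluation of symmetric functions in finitely many variables -/

/-- The variables `y` with `y_p` removed. -/
def removeVar {F : Type*} {n : ℕ} (y : Fin (n + 1) → F) (p : Fin (n + 1)) (j : Fin n) : F :=
  y (Equiv.swap 0 p j.succ)

theorem removeVar_injective {F : Type*} {n : ℕ} {y : Fin (n + 1) → F} (hy : Function.Injective y)
    (p : Fin (n + 1)) : Function.Injective (removeVar y p) :=
  hy.comp ((Equiv.swap 0 p).injective.comp (Fin.succ_injective n))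

theorem removeVar_ne {F : Type*} [Field F] {n : ℕ} {y : Fin (n + 1) → F} (hy : Function.Injective y)
    (p : Fin (n + 1)) (j : Fin n) : y p - removeVar y p j ≠ 0 := by
  intro h
  have h1 := hy (sub_eq_zero.1 h)
  have h2 := congrArg (Equiv.swap 0 p) h1
  rw [Equiv.swap_apply_right, Equiv.swap_apply_self] at h2
  exact (Fin.succ_ne_zero j) h2.symm

theorem prod_removeVar {F M : Type*} [CommMonoid M] {n : ℕ} (y : Fin (n + 1) → F) (p : Fin (n + 1))
    (g : F → M) : g (y p) * ∏ j, g (removeVar y p j) = ∏ i, g (y i) := by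
  rw [← Equiv.prod_comp (Equiv.swap 0 p) fun i => g (y i), Fin.prod_univ_succ,
    Equiv.swap_apply_left]
  rfl

theorem sum_removeVar {F M : Type*} [AddCommMonoid M] {n : ℕ} (y : Fin (n + 1) → F)
    (p : Fin (n + 1)) (g : F → M) :
    g (y p) + ∑ j, g (removeVar y p j) = ∑ i, g (y i) := by
  rw [← Equiv.sum_comp (Equiv.swap 0 p) fun i => g (y i), Fin.sum_univ_succ,
    Equiv.swap_apply_left]
  rfl

theorem exists_eq_removeVar {F : Type*} {n : ℕ} (y : Fin (n + 1) → F) {p q : Fin (n + 1)}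
    (h : q ≠ p) :
    ∃ j, removeVar y p j = y q := by
  have h1 : Equiv.swap 0 p q ≠ 0 := by
    intro h2
    apply h
    have := congrArg (Equiv.swap 0 p) h2
    rwa [Equiv.swap_apply_self, Equiv.swap_apply_left] at this
  obtain ⟨j, hj⟩ := Fin.exists_succ_eq.2 h1
  exact ⟨j, by rw [removeVar, hj, Equiv.swap_apply_self]⟩

theorem one_sub_mul_geometric {R : Type*} [CommRing R] (a : R) :
    (1 - PowerSeries.C a * PowerSeries.X) * PowerSeries.mk (fun n => a ^ n) = 1 := by
  ext n
  rw [sub_mul, one_mul, map_sub, mul_assoc, PowerSeries.coeff_C_mul, PowerSeries.coeff_mk]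
  cases n with
  | zero => simp
  | succ n =>
    rw [PowerSeries.coeff_succ_X_mul, PowerSeries.coeff_mk, PowerSeries.coeff_one,
      if_neg (Nat.succ_ne_zero n), pow_succ']
    ring

/-! ### Partial fractions and vertex operators in finitely many variables. -/

section Evaluation

variable {F : Type*} [Field F] [Algebra K F]

/-- The evaluation `p_r ↦ ∑ i, y_i ^ r` of symmetric functions. -/
def evalVars {n : ℕ} (y : Fin n → F) : Lam →ₐ[K] F :=
  MvPolynomial.aeval fun r : ℕ+ => ∑ i, y i ^ (r : ℕ)

theorem evalVars_X {n : ℕ} (y : Fin n → F) (r : ℕ+) :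
    evalVars y (MvPolynomial.X r) = ∑ i, y i ^ (r : ℕ) := by
  simp [evalVars]

theorem expPos_gCoeff_pow (a : F) :
    expPos gCoeff (fun r : ℕ+ => a ^ (r : ℕ)) * (1 - PowerSeries.C a * PowerSeries.X) =
      1 - PowerSeries.C (t • a) * PowerSeries.X := by
  rw [← expPos_neg_pow (t • a), expPos_mul_of_add (c := fun r : ℕ+ => ((r : ℕ) : K)⁻¹)
    (P := fun r : ℕ+ => a ^ (r : ℕ)) (c' := fun r : ℕ+ => -((r : ℕ) : K)⁻¹)
    (P' := fun r : ℕ+ => (t • a) ^ (r : ℕ)), mul_right_comm, mul_comm (expPos _ _),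
    one_sub_X_mul_expPos, one_mul]
  intro r
  rw [smul_pow, smul_smul, ← add_smul, gCoeff_eq]
  congr 1
  ring

theorem expPos_gCoeff_sum_pow {ι : Type*} (s : Finset ι) (y : ι → F) :
    expPos gCoeff (fun r : ℕ+ => ∑ i ∈ s, y i ^ (r : ℕ)) *
        ∏ i ∈ s, (1 - PowerSeries.C (y i) * PowerSeries.X) =
      ∏ i ∈ s, (1 - PowerSeries.C (t • y i) * PowerSeries.X) := by
  classical
  induction s using Finset.induction_on with
  | empty => simp [expPos_eq_one_of_zero]
  | insert i s hi ih =>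
    rw [Finset.prod_insert hi, Finset.prod_insert hi, ← ih, ← expPos_gCoeff_pow,
      expPos_mul_of_add (c := gCoeff) (P := fun r : ℕ+ => y i ^ (r : ℕ)) (c' := gCoeff)
      (P' := fun r : ℕ+ => ∑ i ∈ s, y i ^ (r : ℕ))]
    · ring
    · intro r
      rw [Finset.sum_insert hi, smul_add]

/-- The product `∏ j ≠ p, (y_p - t y_j) / (y_p - y_j)`. -/
def residue {n : ℕ} (y : Fin (n + 1) → F) (p : Fin (n + 1)) : F :=
  ∏ j, (y p - t • removeVar y p j) / (y p - removeVar y p j)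

/-- The partial fraction decomposition of `∏ i, (1 - t y_i x) / (1 - y_i x)`, with the
denominators cleared. -/
theorem partial_fractions {n : ℕ} {y : Fin (n + 1) → F} (hy : Function.Injective y)
    (h0 : ∀ i, y i ≠ 0) :
    ∏ i, (1 - Polynomial.C (t • y i) * Polynomial.X) =
      Polynomial.C (algebraMap K F t ^ (n + 1)) * ∏ i, (1 - Polynomial.C (y i) * Polynomial.X) +
        ∑ p, Polynomial.C ((1 - algebraMap K F t) * residue y p) *
          ∏ j, (1 - Polynomial.C (removeVar y p j) * Polynomial.X) := by
  have hdeg : ∀ (a : F), (1 - Polynomial.C a * Polynomial.X).natDegree ≤ 1 := fun a => by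
    refine (Polynomial.natDegree_sub_le _ _).trans (max_le (by simp) ?_)
    exact (Polynomial.natDegree_C_mul_le a _).trans Polynomial.natDegree_X_le
  have hco : ∀ (a : F), (1 - Polynomial.C a * Polynomial.X).coeff 1 = -a := fun a => by
    simp [Polynomial.coeff_one]
  have hprod : ∀ (m : ℕ) (z : Fin m → F),
      (∏ i, (1 - Polynomial.C (z i) * Polynomial.X)).natDegree ≤ m := by
    intro m z
    refine (Polynomial.natDegree_prod_le _ _).trans ?_
    refine (Finset.sum_le_sum fun i _ => hdeg (z i)).trans (by simp)
  have hprodco : ∀ (m : ℕ) (z : Fin m → F),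
      (∏ i, (1 - Polynomial.C (z i) * Polynomial.X)).coeff m = ∏ i, -z i := by
    intro m z
    have := Polynomial.coeff_prod_of_natDegree_le (s := Finset.univ)
      (f := fun i : Fin m => 1 - Polynomial.C (z i) * Polynomial.X) 1 fun i _ => hdeg (z i)
    simp only [Finset.card_univ, Fintype.card_fin, mul_one] at this
    rw [this]
    exact Finset.prod_congr rfl fun i _ => hco _
  rw [← sub_eq_iff_eq_add']
  -- After subtraction of the leading coefficient `t ^ (n + 1)` both sides have degree at most `n`,
  -- so it suffices to compare them at the `n + 1` distinct points `1 / y_k`. There only the summand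
  -- `p = k` survives.
  have hinj : Set.InjOn (fun i : Fin (n + 1) => (y i)⁻¹) (Finset.univ : Finset (Fin (n + 1))) :=
    (inv_injective.comp hy).injOn
  refine Polynomial.eq_of_degrees_lt_of_eval_index_eq Finset.univ hinj ?_ ?_ fun k _ => ?_
  · rw [Finset.card_univ, Fintype.card_fin, Polynomial.degree_lt_iff_coeff_zero]
    intro m hm
    rw [Polynomial.coeff_sub, Polynomial.coeff_C_mul]
    rcases hm.eq_or_lt with rfl | hm
    · rw [hprodco, hprodco, sub_eq_zero, Finset.prod_congr rfl fun i _ =>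
        show -(t • y i) = algebraMap K F t * -y i by rw [Algebra.smul_def]; ring,
        Finset.prod_mul_distrib]
      simp
    · rw [Polynomial.coeff_eq_zero_of_natDegree_lt ((hprod _ _).trans_lt hm),
        Polynomial.coeff_eq_zero_of_natDegree_lt ((hprod _ _).trans_lt hm), mul_zero, sub_zero]
  · rw [Finset.card_univ, Fintype.card_fin, Polynomial.degree_lt_iff_coeff_zero]
    intro m hm
    rw [Polynomial.finsetSum_coeff]
    refine Finset.sum_eq_zero fun p _ => ?_
    rw [Polynomial.coeff_C_mul, Polynomial.coeff_eq_zero_of_natDegree_lt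
      ((hprod _ _).trans_lt (by omega)), mul_zero]
  · have hk := h0 k
    have he : ∀ a : F, Polynomial.eval (y k)⁻¹ (1 - Polynomial.C a * Polynomial.X) =
        (y k - a) * (y k)⁻¹ := by
      intro a
      simp only [Polynomial.eval_sub, Polynomial.eval_one, Polynomial.eval_mul, Polynomial.eval_C,
        Polynomial.eval_X]
      rw [sub_mul, mul_inv_cancel₀ hk]
    have hE : ∀ (m : ℕ) (z : Fin m → F), Polynomial.eval (y k)⁻¹
        (∏ i, (1 - Polynomial.C (z i) * Polynomial.X)) = ∏ i, (y k - z i) * (y k)⁻¹ := by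
      intro m z
      rw [Polynomial.eval_prod]
      exact Finset.prod_congr rfl fun i _ => he _
    rw [Polynomial.eval_sub, Polynomial.eval_mul, Polynomial.eval_C, Polynomial.eval_finsetSum, hE,
      hE, Finset.sum_eq_single k]
    · rw [Polynomial.eval_mul, Polynomial.eval_C, hE,
        ← prod_removeVar y k fun z => (y k - t • z) * (y k)⁻¹,
        ← prod_removeVar y k fun z => (y k - z) * (y k)⁻¹, sub_self, zero_mul, zero_mul, mul_zero,
        sub_zero, residue, mul_assoc (1 - algebraMap K F t), ← Finset.prod_mul_distrib]
      congr 1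
      · rw [sub_mul, Algebra.smul_def, mul_assoc, mul_inv_cancel₀ hk, mul_one]
      · refine Finset.prod_congr rfl fun j _ => ?_
        rw [← mul_assoc, div_mul_cancel₀ _ (removeVar_ne hy k j)]
    · intro p _ hp
      obtain ⟨j, hj⟩ := exists_eq_removeVar y hp.symm
      rw [Polynomial.eval_mul, hE, Finset.prod_eq_zero (Finset.mem_univ j), mul_zero]
      rw [hj, sub_self, zero_mul]
    · simp

theorem map_evalVars_serQ {n : ℕ} {y : Fin (n + 1) → F} (hy : Function.Injective y)
    (h0 : ∀ i, y i ≠ 0) :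
    PowerSeries.map (evalVars y : Lam →+* F) serQ = PowerSeries.C (algebraMap K F t ^ (n + 1)) +
      ∑ p, PowerSeries.C ((1 - algebraMap K F t) * residue y p) *
        PowerSeries.mk fun m => y p ^ m := by
  have hP : ∏ i, (1 - PowerSeries.C (y i) * PowerSeries.X) ≠ 0 := by
    refine Finset.prod_ne_zero_iff.2 fun i _ h => ?_
    have := congrArg PowerSeries.constantCoeff h
    simp at this
  refine mul_right_cancel₀ hP ?_
  rw [serQ, map_expPos]
  simp only [evalVars_X]
  rw [expPos_gCoeff_sum_pow, add_mul, Finset.sum_mul]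
  have h := congrArg (Polynomial.coeToPowerSeries.ringHom (R := F)) (partial_fractions hy h0)
  simp only [map_add, map_mul, map_prod, map_sum, map_sub, map_one,
    Polynomial.coeToPowerSeries.ringHom_apply, Polynomial.coe_C, Polynomial.coe_X] at h
  rw [h]
  congr 1
  refine Finset.sum_congr rfl fun p _ => ?_
  rw [← prod_removeVar y p fun z => 1 - PowerSeries.C z * PowerSeries.X]
  have hg := one_sub_mul_geometric (y p)
  simp only [map_mul, map_sub, map_one]
  linear_combination (-(1 - PowerSeries.C (algebraMap K F t)) * PowerSeries.C (residue y p) *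
    ∏ j, (1 - PowerSeries.C (removeVar y p j) * PowerSeries.X)) * hg

theorem evalVars_cQ {n : ℕ} {y : Fin (n + 1) → F} (hy : Function.Injective y)
    (h0 : ∀ i, y i ≠ 0) (m : ℕ) :
    evalVars y (cQ (m + 1 : ℕ)) =
      ∑ p, (1 - algebraMap K F t) * residue y p * y p ^ (m + 1) := by
  have h := congrArg (PowerSeries.coeff (m + 1)) (map_evalVars_serQ hy h0)
  rw [PowerSeries.coeff_map, map_add, PowerSeries.coeff_C, if_neg (Nat.succ_ne_zero m), zero_add,
    map_sum] at h
  rw [cQ_natCast]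
  refine h.trans (Finset.sum_congr rfl fun p _ => ?_)
  rw [PowerSeries.coeff_C_mul, PowerSeries.coeff_mk]

/-- The constant term of the partial fraction expansion, in which `Q(0) = 1` is compared with `t ^
(n + 1)` plus the residues. -/
theorem sum_residue {n : ℕ} {y : Fin (n + 1) → F} (hy : Function.Injective y)
    (h0 : ∀ i, y i ≠ 0) :
    ∑ p, (1 - algebraMap K F t) * residue y p = 1 - algebraMap K F t ^ (n + 1) := by
  have h := congrArg (PowerSeries.coeff 0) (map_evalVars_serQ hy h0)
  rw [PowerSeries.coeff_map, serQ, coeff_zero_expPos, map_add, PowerSeries.coeff_C, if_pos rfl,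
    map_sum, map_one] at h
  rw [eq_sub_iff_add_eq']
  refine Eq.trans ?_ h.symm
  congr 1
  refine Finset.sum_congr rfl fun p _ => ?_
  rw [PowerSeries.coeff_C_mul, PowerSeries.coeff_mk, pow_zero, mul_one]

/-- Setting `u = y_p` in `f[Y - u]` deletes the variable `y_p`. -/
theorem eval₂_tau {n : ℕ} (y : Fin (n + 1) → F) (p : Fin (n + 1)) (f : Lam) :
    Polynomial.eval₂ (evalVars y : Lam →+* F) (y p) (tau f) = evalVars (removeVar y p) f := by
  have h : (Polynomial.eval₂RingHom (evalVars y : Lam →+* F) (y p)).comp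
      (tau : Lam →+* Polynomial Lam) = (evalVars (removeVar y p) : Lam →+* F) := by
    refine MvPolynomial.ringHom_ext (fun a => ?_) fun r => ?_
    · have h1 : tau (MvPolynomial.C a) = Polynomial.C (MvPolynomial.C a) := tau.commutes a
      have h2 : evalVars y (MvPolynomial.C a) = algebraMap K F a := (evalVars y).commutes a
      have h3 : evalVars (removeVar y p) (MvPolynomial.C a) = algebraMap K F a :=
        (evalVars (removeVar y p)).commutes a
      simp [h1, h2, h3]
    · simp only [RingHom.comp_apply, RingHom.coe_coe, shift_X, evalVars_X, neg_smul, one_smul,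
        map_add, map_neg, map_pow, Polynomial.coe_eval₂RingHom, Polynomial.eval₂_C,
        Polynomial.eval₂_X]
      rw [← sum_removeVar y p fun z => z ^ (r : ℕ)]
      ring
  exact DFunLike.congr_fun h f

/-- The evaluation of a mode of Jing's vertex operator. -/
theorem evalVars_vertexOp {n : ℕ} {y : Fin (n + 1) → F} (hy : Function.Injective y)
    (h0 : ∀ i, y i ≠ 0) {m : ℕ} (hm : 0 < m) (f : Lam) :
    evalVars y (vertexOp cQ m f) = ∑ p, (1 - algebraMap K F t) * residue y p * y p ^ m *
      evalVars (removeVar y p) f := by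
  obtain ⟨m, rfl⟩ := Nat.exists_eq_succ_of_ne_zero hm.ne'
  simp only [← eval₂_tau]
  rw [vertexOp_apply]
  generalize tau f = P
  induction P using Polynomial.induction_on' with
  | add P Q hP hQ =>
    rw [map_add, map_add, hP, hQ, ← Finset.sum_add_distrib]
    refine Finset.sum_congr rfl fun p _ => ?_
    rw [Polynomial.eval₂_add, mul_add]
  | monomial k a =>
    -- The coefficient of `Q` used here has positive index. Thus the constant `t ^ (n + 1)` of the
    -- partial fractions never enters, and this is where positivity of the mode is needed.
    rw [pairing_monomial, map_mul, show ((m.succ : ℕ) : ℤ) + k = ((m + k + 1 : ℕ) : ℤ) by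
      push_cast; ring, evalVars_cQ hy h0, Finset.mul_sum]
    refine Finset.sum_congr rfl fun p _ => ?_
    rw [Polynomial.eval₂_monomial, Nat.succ_eq_add_one, show m + k + 1 = m + 1 + k by ring, pow_add]
    simp only [RingHom.coe_coe]
    ring

/-! ### Hall-Littlewood sums -/

/-- The sum `∑_{w ∈ S_n} w (y ^ α ∏_{i<j} (y_i - t y_j) / (y_i - y_j))`. -/
def hlSum {n : ℕ} (a : Fin n → ℕ) (y : Fin n → F) : F :=
  ∑ w : Equiv.Perm (Fin n), (∏ i, y (w i) ^ a i) *
    ∏ i, ∏ j ∈ Finset.Ioi i, (y (w i) - t • y (w j)) / (y (w i) - y (w j))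

/-- The permutations are grouped by `p = w 0`. The factors involving the first index form `y_p ^
a_0` times the residue, and the others are a sum in the remaining variables. The order chosen in
`removeVar` is that of `Equiv.Perm.decomposeFin`. -/
theorem hlSum_succ {n : ℕ} (a : Fin (n + 1) → ℕ) (y : Fin (n + 1) → F) :
    hlSum a y = ∑ p, y p ^ a 0 * residue y p * hlSum (fun i => a i.succ) (removeVar y p) := by
  rw [hlSum, ← Equiv.sum_comp Equiv.Perm.decomposeFin.symm, Fintype.sum_prod_type]
  refine Finset.sum_congr rfl fun p _ => ?_
  rw [hlSum, Finset.mul_sum]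
  refine Finset.sum_congr rfl fun e _ => ?_
  simp only [Fin.prod_univ_succ (n := n), Fin.prod_Ioi_zero, Fin.prod_Ioi_succ,
    Equiv.Perm.decomposeFin_symm_apply_zero, Equiv.Perm.decomposeFin_symm_apply_succ]
  rw [residue, ← Equiv.prod_comp e fun j => (y p - t • removeVar y p j) / (y p - removeVar y p j)]
  simp only [removeVar]
  ring

theorem vPoly_succ (n : ℕ) : vPoly (n + 1) = vPoly n * ((1 - t ^ (n + 1)) / (1 - t)) :=
  Finset.prod_range_succ _ _

theorem one_sub_t_ne_zero : (1 : K) - t ≠ 0 := by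
  simpa using one_sub_t_pow_ne_zero one_pos

theorem vPoly_ne_zero (n : ℕ) : vPoly n ≠ 0 :=
  Finset.prod_ne_zero_iff.2 fun i _ =>
    div_ne_zero (one_sub_t_pow_ne_zero i.succ_pos) one_sub_t_ne_zero

theorem hlSum_zero {n : ℕ} {y : Fin n → F} (hy : Function.Injective y) (h0 : ∀ i, y i ≠ 0) :
    hlSum (fun _ => 0) y = algebraMap K F (vPoly n) := by
  induction n with
  | zero => simp [hlSum, vPoly]
  | succ n ih =>
    have h1 : 1 - algebraMap K F t ≠ 0 := by
      rw [← map_one (algebraMap K F), ← map_sub]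
      exact (map_ne_zero _).2 one_sub_t_ne_zero
    rw [hlSum_succ]
    simp only [pow_zero, one_mul]
    rw [Finset.sum_congr rfl fun p _ => by
      rw [ih (removeVar_injective hy p) fun j => h0 _], ← Finset.sum_mul, vPoly_succ, map_mul,
      mul_comm, map_div₀, map_sub, map_sub, map_one, map_pow, ← sum_residue hy h0,
      ← Finset.mul_sum, mul_div_cancel_left₀ _ h1]

/-- Each mode removes one variable and contributes a factor `1 - t`. Once the list is exhausted, the
constant `1` is rewritten by `hlSum_zero` as `hlSum` of the zero exponent divided by `v_{n-ℓ}(t)`,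
which is the normalisation of `Q_λ`. -/
theorem evalVars_prod_vertexOp (L : List ℕ) (hL : ∀ k ∈ L, 0 < k) {n : ℕ} (hn : L.length ≤ n)
    {y : Fin n → F} (hy : Function.Injective y) (h0 : ∀ i, y i ≠ 0) :
    evalVars y ((L.map fun k : ℕ => vertexOp cQ (k : ℤ)).prod 1) =
      algebraMap K F ((1 - t) ^ L.length / vPoly (n - L.length)) *
        hlSum (fun i => L.getD i 0) y := by
  induction L generalizing n with
  | nil =>
    simp only [List.map_nil, List.prod_nil, Module.End.one_apply, map_one, List.length_nil,
      pow_zero, List.getD_nil, Nat.sub_zero]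
    rw [hlSum_zero hy h0, ← map_mul, one_div_mul_cancel (vPoly_ne_zero n), map_one]
  | cons k L ih =>
    obtain ⟨n, rfl⟩ := Nat.exists_eq_succ_of_ne_zero (n := n) (by simp at hn; omega)
    have hn' : L.length ≤ n := by simpa using hn
    rw [List.map_cons, List.prod_cons, Module.End.mul_apply,
      evalVars_vertexOp hy h0 (hL k List.mem_cons_self), hlSum_succ, Finset.mul_sum]
    refine Finset.sum_congr rfl fun p _ => ?_
    rw [ih (fun l hl => hL l (List.mem_cons_of_mem _ hl)) hn' (removeVar_injective hy p)
      fun j => h0 _]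
    simp only [List.length_cons, Nat.succ_eq_add_one, Nat.add_sub_add_right, Fin.val_zero,
      List.getD_cons_zero, Fin.val_succ, List.getD_cons_succ, pow_succ, map_div₀, map_mul, map_sub,
      map_one]
    ring

end Evaluation

/-! ### Specialisation to independent variables. -/

theorem yVar_injective (n : ℕ) : Function.Injective (yVar n) :=
  (IsFractionRing.injective (MvPolynomial (Fin n) K) _).comp MvPolynomial.X_injective

theorem yVar_ne_zero (n : ℕ) (i : Fin n) : yVar n i ≠ 0 := fun h =>
  MvPolynomial.X_ne_zero i (IsFractionRing.injective (MvPolynomial (Fin n) K)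
    (FractionRing (MvPolynomial (Fin n) K)) (h.trans (map_zero _).symm))

theorem constRat_eq (n : ℕ) (a : K) : constRat n a = algebraMap K _ a :=
  (IsScalarTower.algebraMap_apply K (MvPolynomial (Fin n) K) _ a).symm

theorem evalVars_yVar (n : ℕ) (q : Lam) :
    algebraMap (MvPolynomial (Fin n) K) (FractionRing (MvPolynomial (Fin n) K))
      (restrictVars n q) = evalVars (yVar n) q := by
  have h : (IsScalarTower.toAlgHom K (MvPolynomial (Fin n) K)
      (FractionRing (MvPolynomial (Fin n) K))).comp (restrictVars n) = evalVars (yVar n) := by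
    refine MvPolynomial.algHom_ext fun r => ?_
    rw [evalVars_X]
    simp [restrictVars, MvPolynomial.psum, yVar]
  exact DFunLike.congr_fun h q

theorem getD_rowLens (lam : YoungDiagram) (i : ℕ) : lam.rowLens.getD i 0 = lam.rowLen i := by
  rcases lt_or_ge i (lam.colLen 0) with h | h
  · rw [List.getD_eq_getElem _ _ (by simpa using h), YoungDiagram.get_rowLens]
  · rw [List.getD_eq_default _ _ (by simpa using h), maya_rowLen_zero lam h]

/-- The modes of Jing's vertex operator create the Hall-Littlewood functions. -/
theorem isHallLittlewoodQ_prod_vertexOp (lam : YoungDiagram) :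
    IsHallLittlewoodQ lam ((lam.rowLens.map fun k : ℕ => vertexOp cQ (k : ℤ)).prod 1) := by
  intro n hn
  rw [evalVars_yVar, evalVars_prod_vertexOp _ (fun k hk => lam.pos_of_mem_rowLens k hk)
    (by simpa using hn) (yVar_injective n) (yVar_ne_zero n), YoungDiagram.length_rowLens,
    hallLittlewoodQ, constRat_eq, hlSum]
  simp only [getD_rowLens, constRat_eq, Algebra.smul_def]

/-! ### Transport along the correspondence -/

theorem onBoson_apply (f : Module.End K Lam) (w : Boson) (c : ℤ) : onBoson f w c = f (w c) := rfl

/-- The correspondence as a linear equivalence. -/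
def iotaEquiv : Fock ≃ₗ[K] Boson := LinearEquiv.ofBijective iota iota_bijective

/-- The operator on `Fock` that corresponds to `1 ⊗ f`. -/
def pullback : Module.End K Lam →ₐ[K] Module.End K Fock where
  toFun f := iotaEquiv.symm.toLinearMap ∘ₗ onBoson f ∘ₗ iota
  map_one' := by
    refine LinearMap.ext fun v => iota_injective ?_
    refine (iotaEquiv.apply_symm_apply _).trans ?_
    ext1 c
    rfl
  map_mul' f g := by
    refine LinearMap.ext fun v => ?_
    refine iota_injective ((iotaEquiv.apply_symm_apply _).trans ?_)
    refine Eq.trans ?_ (iotaEquiv.apply_symm_apply _).symm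
    have h : iota (iotaEquiv.symm (onBoson g (iota v))) = onBoson g (iota v) :=
      iotaEquiv.apply_symm_apply _
    change _ = onBoson f (iota (iotaEquiv.symm (onBoson g (iota v))))
    rw [h]
    ext1 c
    rfl
  map_zero' := by
    refine LinearMap.ext fun v => iota_injective ?_
    refine (iotaEquiv.apply_symm_apply _).trans ?_
    rw [LinearMap.zero_apply, map_zero]
    ext1 c
    rfl
  map_add' f g := by
    refine LinearMap.ext fun v => iota_injective ?_
    refine (iotaEquiv.apply_symm_apply _).trans ?_
    rw [LinearMap.add_apply, map_add]
    refine Eq.trans ?_ (congrArg₂ (· + ·) (iotaEquiv.apply_symm_apply _).symm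
      (iotaEquiv.apply_symm_apply _).symm)
    ext1 c
    rfl
  commutes' a := by
    refine LinearMap.ext fun v => iota_injective ?_
    refine (iotaEquiv.apply_symm_apply _).trans ?_
    rw [Module.algebraMap_end_apply, map_smul]
    ext1 c
    rfl

theorem iota_pullback (f : Module.End K Lam) (v : Fock) :
    iota (pullback f v) = onBoson f (iota v) :=
  iotaEquiv.apply_symm_apply _

/-- Operators on `Fock` are identified by their effect after `iota`. As `pullback` is an algebra
map, identities on `Λ(t)` transfer through it. -/
theorem eq_pullback {T : Module.End K Fock} {f : Module.End K Lam}
    (h : ∀ v, iota (T v) = onBoson f (iota v)) : T = pullback f :=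
  LinearMap.ext fun v => iota_injective ((h v).trans (iota_pullback f v).symm)

theorem bosonForm_single (c : ℤ) (f : Lam) (w : Boson) :
    bosonForm (Finsupp.single c f) w = tForm f (w c) := by
  simp [bosonForm]

theorem isAdjointPair_onBoson {f g : Module.End K Lam}
    (h : LinearMap.IsAdjointPair tForm tForm f g) :
    LinearMap.IsAdjointPair bosonForm bosonForm (onBoson f) (onBoson g) := by
  intro v w
  induction v using Finsupp.induction_linear with
  | zero => simp
  | add v v' hv hv' =>
    rw [map_add, map_add, map_add, LinearMap.add_apply, LinearMap.add_apply, hv, hv']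
  | single c a => rw [onBoson_single, bosonForm_single, bosonForm_single, onBoson_apply, h]

theorem fockForm_right_nondegenerate (w : Fock) (h : ∀ v, fockForm v w = 0) : w = 0 := by
  refine iota_injective ?_
  rw [map_zero]
  ext1 c
  refine tForm_right_nondegenerate fun f => ?_
  obtain ⟨v, hv⟩ := iota_surjective (Finsupp.single c f)
  rw [← bosonForm_single, ← hv]
  exact h v

theorem isAdjointPair_pullback {f g : Module.End K Lam}
    (h : LinearMap.IsAdjointPair tForm tForm f g) :
    LinearMap.IsAdjointPair fockForm fockForm (pullback f) (pullback g) := by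
  intro v w
  change bosonForm (iota (pullback f v)) (iota w) = bosonForm (iota v) (iota (pullback g w))
  rw [iota_pullback, iota_pullback]
  exact isAdjointPair_onBoson h _ _

/-! ### Locally finite sums under the correspondence. -/

section Sums

variable {I : Type*} {S : I → Module.End K Lam}

theorem PointwiseFinite.onBoson (h : PointwiseFinite S) :
    PointwiseFinite fun i => onBoson (S i) := by
  intro w
  refine (Set.Finite.biUnion w.support.finite_toSet fun c _ => h (w c)).subset fun i hi => ?_
  obtain ⟨c, hc⟩ := Finsupp.ne_iff.1 hi
  refine Set.mem_biUnion (x := c) ?_ hc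
  rw [Finset.mem_coe, Finsupp.mem_support_iff]
  intro h0
  apply hc
  change S i (w c) = 0
  rw [h0, map_zero]

theorem PointwiseFinite.pullback (h : PointwiseFinite S) :
    PointwiseFinite fun i => pullback (S i) := by
  intro v
  refine (h.onBoson (iota v)).subset fun i hi h0 => hi (iota_injective ?_)
  rw [iota_pullback, map_zero]
  exact h0

theorem sumOp_pullback (h : PointwiseFinite S) :
    sumOp (fun i => pullback (S i)) = pullback (sumOp S) := by
  refine eq_pullback fun v => ?_
  rw [sumOp_apply h.pullback]
  refine (AddMonoidHom.map_finsum iota.toAddMonoidHom (h.pullback v)).trans ?_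
  ext1 c
  rw [onBoson_apply, sumOp_apply h]
  refine (AddMonoidHom.map_finsum (Finsupp.lapply c : Boson →ₗ[K] Lam).toAddMonoidHom
    ((h.onBoson (iota v)).subset fun i hi h0 => hi ?_)).trans (finsum_congr fun i => ?_)
  · exact (iota_pullback _ _).trans h0
  · exact DFunLike.congr_fun (iota_pullback (S i) v) c

end Sums

/-! ### The transfer matrix, its inverse and the adjoints -/

/-- Multiplication by a symmetric function, on the fermionic side. -/
def mulFock : Lam →ₐ[K] Module.End K Fock := pullback.comp (Algebra.lmul K Lam)

theorem transfer_eq_map :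
    transfer = PowerSeries.map (mulFock : Lam →+* Module.End K Fock) serG := by
  ext1 m
  rw [transfer, PowerSeries.coeff_mk, PowerSeries.coeff_map, ← cG_natCast]
  exact eq_pullback (iota_transferCoeff m)

/-- The power series `A(x;t)` as a unit. -/
def transferUnit : (Module.End K Fock)⟦X⟧ˣ where
  val := transfer
  inv := PowerSeries.map (mulFock : Lam →+* Module.End K Fock) serQ
  val_inv := by rw [transfer_eq_map, ← map_mul, mul_comm, serQ_mul_serG, map_one]
  inv_val := by rw [transfer_eq_map, ← map_mul, serQ_mul_serG, map_one]

theorem transferCoeff_eq (m : ℕ) : transferCoeff m =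
    pullback (LinearMap.mulLeft K (PowerSeries.coeff m serG)) := by
  rw [← cG_natCast]
  exact eq_pullback (iota_transferCoeff m)

theorem transferInvCoeff_eq (m : ℕ) : transferInvCoeff m =
    pullback (LinearMap.mulLeft K (PowerSeries.coeff m serQ)) := by
  have h : transferInv = PowerSeries.map (mulFock : Lam →+* Module.End K Fock) serQ :=
    Ring.inverse_unit transferUnit
  rw [transferInvCoeff, h, PowerSeries.coeff_map]
  rfl

theorem isAdjointPair_serG (m : ℕ) : LinearMap.IsAdjointPair tForm tForm
    (LinearMap.mulLeft K (PowerSeries.coeff m serG)) (shiftCoeff (-1) m) := by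
  have h := isAdjointPair_expPos (-1) m
  rwa [neg_one_smul] at h

theorem isAdjointPair_serQ (m : ℕ) : LinearMap.IsAdjointPair tForm tForm
    (LinearMap.mulLeft K (PowerSeries.coeff m serQ)) (shiftCoeff 1 m) := by
  have h := isAdjointPair_expPos 1 m
  rwa [one_smul] at h

theorem isAdjointPair_transferCoeff (m : ℕ) : LinearMap.IsAdjointPair fockForm fockForm
    (transferCoeff m) (pullback (shiftCoeff (-1) m)) := by
  rw [transferCoeff_eq]
  exact isAdjointPair_pullback (isAdjointPair_serG m)

theorem isAdjointPair_transferInvCoeff (m : ℕ) : LinearMap.IsAdjointPair fockForm fockForm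
    (transferInvCoeff m) (pullback (shiftCoeff 1 m)) := by
  rw [transferInvCoeff_eq]
  exact isAdjointPair_pullback (isAdjointPair_serQ m)

theorem transferAdj_eq (m : ℕ) : transferAdj m = pullback (shiftCoeff (-1) m) :=
  adjointOp_eq fockForm_right_nondegenerate (isAdjointPair_transferCoeff m)

theorem transferInvAdj_eq (m : ℕ) : transferInvAdj m = pullback (shiftCoeff 1 m) :=
  adjointOp_eq fockForm_right_nondegenerate (isAdjointPair_transferInvCoeff m)

/-! ### Jing's vertex operators -/

/-- On a fixed `f` the shift is a polynomial in `u`, so only finitely many `s` contribute, and `r -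
s = m` then determines `r`. -/
theorem pointwiseFinite_laurentTerms_shiftCoeff (a : ℕ → Module.End K Lam) (ε : K) (m : ℤ) :
    PointwiseFinite (laurentTerms a (shiftCoeff ε) m) := by
  intro f
  refine Set.Finite.of_finite_image (f := fun p => p.1.2)
    ((Set.finite_Iic (shift ε f).natDegree).subset ?_) ?_
  · rintro _ ⟨p, hp, rfl⟩
    by_contra hc
    apply hp
    change a p.1.1 (shiftCoeff ε p.1.2 f) = 0
    rw [shiftCoeff_apply, Polynomial.coeff_eq_zero_of_natDegree_lt (by simpa using hc), map_zero]
  · rintro ⟨⟨r, s⟩, h⟩ _ ⟨⟨r', s'⟩, h'⟩ _ e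
    simp only at h h' e
    subst e
    have : r = r' := by omega
    subst this
    rfl

theorem phiMinusTerms_eq (m : ℤ) : phiMinusTerms m = laurentTerms
    (fun r => LinearMap.mulLeft K (PowerSeries.coeff r serQ)) (shiftCoeff (-1)) m := by
  funext p
  have h := coeff_expSeries_pAdj (-1) p.1.2
  rw [neg_one_smul] at h
  rw [phiMinusTerms, laurentTerms, coeff_expSeries_pMul, h]
  rfl

theorem phiPlusTerms_eq (m : ℤ) : phiPlusTerms m = laurentTerms
    (fun r => LinearMap.mulLeft K (PowerSeries.coeff r serG)) (shiftCoeff 1) m := by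
  funext p
  have h := coeff_expSeries_pAdj 1 p.1.2
  rw [one_smul] at h
  rw [phiPlusTerms, laurentTerms, coeff_expSeries_pMul, h]
  rfl

theorem psiModeTerms_eq (m : ℤ) : psiModeTerms m = fun p => pullback (phiMinusTerms m p) := by
  funext p
  rw [phiMinusTerms_eq, laurentTerms, map_mul, ← transferInvCoeff_eq, ← transferAdj_eq]
  rfl

theorem psiPlusModeTerms_eq (m : ℤ) :
    psiPlusModeTerms m = fun p => pullback (phiPlusTerms m p) := by
  funext p
  rw [phiPlusTerms_eq, laurentTerms, map_mul, ← transferCoeff_eq, ← transferInvAdj_eq]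
  rfl

theorem pointwiseFinite_phiMinusTerms (m : ℤ) : PointwiseFinite (phiMinusTerms m) := by
  rw [phiMinusTerms_eq]
  exact pointwiseFinite_laurentTerms_shiftCoeff _ _ _

theorem pointwiseFinite_phiPlusTerms (m : ℤ) : PointwiseFinite (phiPlusTerms m) := by
  rw [phiPlusTerms_eq]
  exact pointwiseFinite_laurentTerms_shiftCoeff _ _ _

theorem psiMode_eq (m : ℤ) : psiMode m = pullback (phiMinus m) := by
  rw [psiMode, psiModeTerms_eq]
  exact sumOp_pullback (pointwiseFinite_phiMinusTerms m)

theorem psiPlusMode_eq (m : ℤ) : psiPlusMode m = pullback (phiPlus m) := by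
  rw [psiPlusMode, psiPlusModeTerms_eq]
  exact sumOp_pullback (pointwiseFinite_phiPlusTerms m)

/-- Pairs `(r, s)` are replaced by `k = s`. Indices `k` with `m + k < 0` belong to no pair, but `cQ`
vanishes there, so the sum may run over all coefficients of the shifted polynomial. -/
theorem phiMinus_eq (m : ℤ) : phiMinus m = vertexOp cQ m := by
  refine LinearMap.ext fun f => ?_
  rw [phiMinus, sumOp_apply (pointwiseFinite_phiMinusTerms m), vertexOp_apply, pairing_apply,
    Polynomial.sum_def]
  have hinj : Function.Injective fun p : {p : ℕ × ℕ // (p.1 : ℤ) - (p.2 : ℤ) = m} => p.1.2 := by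
    rintro ⟨⟨r, s⟩, h⟩ ⟨⟨r', s'⟩, h'⟩ e
    simp only at h h' e
    subst e
    have : r = r' := by omega
    subst this
    rfl
  have h1 : ∀ p, phiMinusTerms m p f = (tau f).coeff p.1.2 * cQ (m + p.1.2) := by
    intro p
    rw [phiMinusTerms_eq, show m + (p.1.2 : ℤ) = (p.1.1 : ℤ) by have := p.2; omega, cQ_natCast,
      mul_comm]
    rfl
  rw [finsum_congr h1, ← finsum_mem_range (f := fun k : ℕ => (tau f).coeff k * cQ (m + k)) hinj,
    finsum_mem_def, Set.indicator_eq_self.2, finsum_eq_sum_of_support_subset]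
  · intro k hk
    rw [Finset.mem_coe, Polynomial.mem_support_iff]
    exact left_ne_zero_of_mul hk
  · intro k hk
    have hmk : 0 ≤ m + k := by
      by_contra hc
      exact right_ne_zero_of_mul hk (zcoeff_neg _ (by omega))
    exact ⟨⟨((m + k).toNat, k), by simp only; omega⟩, rfl⟩

theorem psiMode_relation (r s : ℤ) :
    psiMode (r - 1) * psiMode s - t • (psiMode r * psiMode (s - 1)) =
      t • (psiMode s * psiMode (r - 1)) - psiMode (s - 1) * psiMode r := by
  have h : vertexOp cQ (r - 1) * vertexOp cQ s - t • (vertexOp cQ r * vertexOp cQ (s - 1)) =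
      t • (vertexOp cQ s * vertexOp cQ (r - 1)) - vertexOp cQ (s - 1) * vertexOp cQ r :=
    LinearMap.ext fun f => vertexOp_cQ_relation r s f
  have h' := congrArg pullback h
  rw [map_sub, map_sub, map_smul, map_smul, map_mul, map_mul, map_mul, map_mul] at h'
  simpa only [psiMode_eq, phiMinus_eq] using h'

theorem iota_prod_psiMode (L : List ℕ) (c : ℤ) :
    iota ((L.map fun k : ℕ => psiMode (k : ℤ)).prod
      (Finsupp.single (Maya.ofPartition ⊥ c) 1)) =
      Finsupp.single c ((L.map fun k : ℕ => vertexOp cQ (k : ℤ)).prod 1) := by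
  have h : (L.map fun k : ℕ => psiMode (k : ℤ)).prod =
      pullback (L.map fun k : ℕ => vertexOp cQ (k : ℤ)).prod := by
    rw [map_list_prod, List.map_map]
    congr 1
    refine List.map_congr_left fun k _ => ?_
    rw [psiMode_eq, phiMinus_eq]
    rfl
  rw [h, iota_pullback, iota_vacuum, onBoson_single]

end

end HallLittlewoodIce

/-! ### The proposition. -/

theorem proposition1p3 :
    -- the correspondence is an isomorphism
    Function.Bijective iota ∧
    -- `A(x;t)` is the transfer matrix of the six-vertex model, and it is invertible
    (∀ σ σ' : Maya,
      PowerSeries.mk (fun m => transferCoeff m (Finsupp.single σ 1) σ') = rowPartition σ σ') ∧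
    IsUnit transfer ∧
    -- the adjoints for the deformed inner products exist and are unique
    (∀ r : ℕ+, ∃! g : Module.End K Lam, LinearMap.IsAdjointPair tForm tForm (pMul r) g) ∧
    (∀ m : ℕ, ∃! g : Module.End K Fock,
      LinearMap.IsAdjointPair fockForm fockForm (transferCoeff m) g) ∧
    (∀ m : ℕ, ∃! g : Module.End K Fock,
      LinearMap.IsAdjointPair fockForm fockForm (transferInvCoeff m) g) ∧
    -- the coefficients of the formal Laurent series are well defined
    (∀ m : ℤ, PointwiseFinite (phiMinusTerms m) ∧ PointwiseFinite (phiPlusTerms m) ∧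
      PointwiseFinite (psiModeTerms m) ∧ PointwiseFinite (psiPlusModeTerms m)) ∧
    -- `Φ⁻(x;t) ∘ ι_t = ι_t ∘ A⁻¹(x;t) ∘ A^*(x;t)`
    (∀ m : ℤ, onBoson (phiMinus m) ∘ₗ iota = iota ∘ₗ psiMode m) ∧
    -- `Φ⁺(x;t) ∘ ι_t = ι_t ∘ A(x;t) ∘ (A⁻¹(x;t))^*`
    (∀ m : ℤ, onBoson (phiPlus m) ∘ₗ iota = iota ∘ₗ psiPlusMode m) ∧
    -- the commutation relations
    (∀ r s : ℤ, psiMode (r - 1) * psiMode s - t • (psiMode r * psiMode (s - 1)) =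
      t • (psiMode s * psiMode (r - 1)) - psiMode (s - 1) * psiMode r) ∧
    -- the Hall-Littlewood functions
    (∀ (lam : YoungDiagram) (c : ℤ), ∃ q : Lam, IsHallLittlewoodQ lam q ∧
      iota ((lam.rowLens.map fun k : ℕ => psiMode (k : ℤ)).prod
        (Finsupp.single (Maya.ofPartition ⊥ c) 1)) = Finsupp.single c q) := by
  refine ⟨iota_bijective, transfer_eq_rowPartition, transferUnit.isUnit, fun r => ?_, fun m => ?_,
    fun m => ?_, fun m => ⟨pointwiseFinite_phiMinusTerms m, pointwiseFinite_phiPlusTerms m, ?_, ?_⟩,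
    fun m => ?_, fun m => ?_, psiMode_relation, fun lam c =>
      ⟨_, isHallLittlewoodQ_prod_vertexOp lam, iota_prod_psiMode lam.rowLens c⟩⟩
  · exact existsUnique_adjoint (fun _ => tForm_right_nondegenerate) (isAdjointPair_pMul r)
  · exact existsUnique_adjoint fockForm_right_nondegenerate (isAdjointPair_transferCoeff m)
  · exact existsUnique_adjoint fockForm_right_nondegenerate (isAdjointPair_transferInvCoeff m)
  · rw [psiModeTerms_eq]
    exact (pointwiseFinite_phiMinusTerms m).pullback
  · rw [psiPlusModeTerms_eq]
    exact (pointwiseFinite_phiPlusTerms m).pullback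
  · rw [psiMode_eq]
    exact LinearMap.ext fun v => (iota_pullback _ v).symm
  · rw [psiPlusMode_eq]
    exact LinearMap.ext fun v => (iota_pullback _ v).symm
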